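/- Let $\mathcal{P}=\langle\Sigma\mid\mathcal{R}\rangle$ be a semigroup presentation: $\mathcal R$ is a set of relations $u=v$ between nonempty words over $\Sigma$, with the convention that if $u=v$ belongs to $\mathcal R$ then $v=u$ does not (in particular no relation $u=u$ belongs to $\mathcal R$). Let $w\in\Sigma^+$ be a nonempty word and let $\kappa$ be the cardinality of $\mathcal R$. A braided diagram over $\mathcal P$ consists of a frame, finitely many transistors and finitely many wires labelled by letters of $\Sigma$. The top endpoint of each wire is attached to the top side of the frame or to the bottom side of a transistor, and its bottom endpoint to the bottom side of the frame or to the top side of a transistor, at pairwise distinct points. For each transistor, if $u$ and $v$ are the words read from left to right on its top and bottom sides, then $u=v$ or $v=u$ is in $\mathcal R$. Write $T_1\prec T_2$ when some wire goes from the bottom side of $T_2$ down to the top side of $T_1$; the transitive closure of $\prec$ is required to be a strict partial order. Diagrams are considered up to label- and order-preserving equivalence. A dipole is a pair of transistors $T_1\prec T_2$ such that the wires on the top side of $T_1$ are exactly the wires on the bottom side of $T_2$, in the same order, and the word on the top of $T_2$ equals the word on the bottom of $T_1$. It is reduced by removing $T_1$, $T_2$ and the wires between them and joining in order the wires arriving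 on the top of $T_2$ to the wires leaving the bottom of $T_1$. The braided diagram group $D_b(\mathcal P,w)$ is the group of braided diagrams with top and bottom words $w$, modulo reduction of dipoles, under vertical concatenation. For a cardinal $\alpha$, let $\mathbb F_\alpha$ be a free group with a fixed free basis of cardinality $\alpha$. Let $\mathscr V_\alpha$ be the braided picture product over $\langle x\mid x=x^2\rangle$ with the single group $\mathbb F_\alpha$ and base word $x$. It is defined as the braided diagram group of this presentation with base word $x$, except that each wire carries in addition an element of $\mathbb F_\alpha$; the elements carried by wires that are joined (in a concatenation or in the reduction of a dipole) are multiplied from top to bottom, and the wires between the two transistors of a dipole are required to carry the trivial element. The diagram length of an element of $D_b(\mathcal P,w)$ is the number of transistors of the reduced (dipole-free) diagram representing it. The diagram length of an element of $\mathscr V_\alpha$ is the number of transistors of the reduced diagram representing it plus the sum of the word lengths, in the fixed basis, of the elements of $\mathbb F_\alpha$ carried by its wires. Both are denoted $|\cdot|$. **Theorem.** For every cardinal $\alpha\ge\kappa$ there is an injective group homomorphism $\Phi:D_b(\mathcal P,w)\to\mathscr V_\alpha$ such that, if $\mathcal R$ is finite, there is a constant $C$ with $$|g|\le C\,|\Phi(g)|\qquad\text{and}\qquad|\Phi(g)|\le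 C\,\max(1,|g|)\qquad\text{for all } g\in D_b(\mathcal P,w).$$ (Thus $\Phi$ satisfies both biLipschitz inequalities on all elements of nonzero diagram length, and $|\Phi|$ is bounded on the elements of diagram length $0$, i.e. those represented by diagrams without transistors.) If moreover the letters of $w$ are pairwise distinct, then $C$ can be chosen so that in addition $|\Phi(g)|\le C\,|g|$ for all $g$, that is, $\Phi$ is biLipschitz with respect to diagram lengths without exception. -/

import Mathlib

universe u v

/-- A semigroup presentation `⟨S ∣ rels⟩`. A relation `u = v` is the ordered pair `(u, v)` of
nonempty words; if `u = v` is a relation then `v = u` is not (so there is no relation `u = u`). -/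
structure SemigroupPresentation (S : Type u) where
  rels : Set (List S × List S)
  ne_nil : ∀ r ∈ rels, r.1 ≠ [] ∧ r.2 ≠ []
  asymm : ∀ a b, (a, b) ∈ rels → (b, a) ∉ rels

namespace BraidedDiagram

variable {S : Type u}

/-- The points on one side (all top sides or all bottom sides) of a family `T` of transistors to
which wires are attached: the `idx`-th point from the left on the transistor `node`, where `f node`
is the word read on that side of `node`. -/
@[ext] structure Port {T : Type} (f : T → List S) where
  node : T
  idx : ℕ
  lt : idx < (f node).length

/-- The letter read at a port. -/
def Port.letter {T : Type} {f : T → List S} (p : Port f) : S := (f p.node)[p.idx]'p.lt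

/-- Endpoints of wires: either on a side of the frame, carrying the word `a` (`Sum.inl`), or on
the given side of a transistor (`Sum.inr`). -/
abbrev Ends {T : Type} (a : List S) (f : T → List S) : Type := Fin a.length ⊕ Port f

/-- The letter read at an endpoint. -/
def Ends.letter {T : Type} {a : List S} {f : T → List S} : Ends a f → S :=
  Sum.elim (fun i => a[i]) Port.letter

/-- Transport of ports along a map of transistors which preserves the words read on the side. -/
def Port.map {T T' : Type} {f : T → List S} {f' : T' → List S} (e : T → T')
    (h : ∀ t, f' (e t) = f t) (p : Port f) : Port f' :=
  ⟨e p.node, p.idx, by rw [h]; exact p.lt⟩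

/-- Transport of endpoints along a map of transistors (the frame is fixed). -/
def Ends.map {T T' : Type} {a : List S} {f : T → List S} {f' : T' → List S} (e : T → T')
    (h : ∀ t, f' (e t) = f t) : Ends a f → Ends a f' :=
  Sum.map id (Port.map e h)

/-- `t₁ ≺ t₂`: some wire has its bottom endpoint on the top side of `t₁` and its top endpoint on
the bottom side of `t₂`. -/
def Prec {T : Type} {a b : List S} {top bot : T → List S} (wire : Ends a bot ≃ Ends b top)
    (t₁ t₂ : T) : Prop :=
  ∃ i hi j hj, wire (Sum.inr ⟨t₂, i, hi⟩) = Sum.inr ⟨t₁, j, hj⟩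


end BraidedDiagram

open BraidedDiagram in
/-- A braided diagram over `P` with top word `a` and bottom word `b`, whose wires carry a second
label in the group `K` (a braided diagram over `(P, 𝒢)` where every group of `𝒢` is `K`).
A wire is recorded by its top endpoint, which lies on the top side of the frame or on the bottom
side of a transistor; `wire` sends it to its bottom endpoint, which lies on the bottom side of the
frame or on the top side of a transistor. -/
structure BraidedDiagram {S : Type u} (P : SemigroupPresentation S) (K : Type v)
    (a b : List S) where
  T : Type
  finite : Finite T
  top : T → List S
  bot : T → List S
  rel : ∀ t, (top t, bot t) ∈ P.rels ∨ (bot t, top t) ∈ P.rels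
  wire : Ends a bot ≃ Ends b top
  letter_wire : ∀ p, (wire p).letter = p.letter
  label : Ends a bot → K
  acyclic : ∀ t, ¬ Relation.TransGen (Prec wire) t t

namespace BraidedDiagram

variable {S : Type u} {P : SemigroupPresentation S} {K : Type v}

/-- Equivalence of diagrams: a bijection between the transistors preserving all words, all
attachments (hence the left-to-right orders) and all labels. -/
def Iso {a b : List S} (Δ Δ' : BraidedDiagram P K a b) : Prop :=
  ∃ (e : Δ.T ≃ Δ'.T) (ht : ∀ t, Δ'.top (e t) = Δ.top t) (hb : ∀ t, Δ'.bot (e t) = Δ.bot t),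
    ∀ p, Δ'.wire (Ends.map e hb p) = Ends.map e ht (Δ.wire p) ∧
      Δ'.label (Ends.map e hb p) = Δ.label p

/-- `t₁`, `t₂` form a dipole, `t₁` being the lower transistor: the wires attached to the top of
`t₁` are exactly the wires attached to the bottom of `t₂`, in the same order, they have trivial
second labels, and the top word of `t₂` is the bottom word of `t₁`. -/
structure IsDipole [Group K] {a b : List S} (Δ : BraidedDiagram P K a b) (t₁ t₂ : Δ.T) :
    Prop where
  inner : Δ.top t₁ = Δ.bot t₂
  outer : Δ.top t₂ = Δ.bot t₁
  wires : ∀ i h₁ h₂, Δ.wire (Sum.inr ⟨t₂, i, h₂⟩) = Sum.inr ⟨t₁, i, h₁⟩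
  labels : ∀ i h₂, Δ.label (Sum.inr ⟨t₂, i, h₂⟩) = 1

/-- A diagram without dipoles. -/
def IsReduced [Group K] {a b : List S} (Δ : BraidedDiagram P K a b) : Prop :=
  ∀ t₁ t₂, ¬ Δ.IsDipole t₁ t₂

/-- `Δ'` is obtained from `Δ` by reducing a dipole `t₁`, `t₂`: the transistors of `Δ'` are, via
`e`, those of `Δ` other than `t₁`, `t₂`; a wire of `Δ` ending at the `i`-th point of the top of
`t₂` is connected with the wire of `Δ` starting at the `i`-th point of the bottom of `t₁`, and the
labels are multiplied (from top to bottom); the other wires are unchanged. -/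
def Step [Group K] {a b : List S} (Δ Δ' : BraidedDiagram P K a b) : Prop :=
  ∃ t₁ t₂, Δ.IsDipole t₁ t₂ ∧
    ∃ (e : Δ'.T → Δ.T) (ht : ∀ s, Δ.top (e s) = Δ'.top s) (hb : ∀ s, Δ.bot (e s) = Δ'.bot s),
      Function.Injective e ∧ (∀ t, (∃ s, e s = t) ↔ t ≠ t₁ ∧ t ≠ t₂) ∧
      ∀ p,
        (∀ i h h', Δ.wire (Ends.map e hb p) = Sum.inr ⟨t₂, i, h⟩ →
          Ends.map e ht (Δ'.wire p) = Δ.wire (Sum.inr ⟨t₁, i, h'⟩) ∧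
          Δ'.label p = Δ.label (Ends.map e hb p) * Δ.label (Sum.inr ⟨t₁, i, h'⟩)) ∧
        ((∀ i h, Δ.wire (Ends.map e hb p) ≠ Sum.inr ⟨t₂, i, h⟩) →
          Ends.map e ht (Δ'.wire p) = Δ.wire (Ends.map e hb p) ∧
          Δ'.label p = Δ.label (Ends.map e hb p))

/-- Equality modulo dipoles: the equivalence relation generated by equivalence of diagrams and
reduction of dipoles. -/
def modDipoles (P : SemigroupPresentation S) (K : Type v) [Group K] (a b : List S) :
    Setoid (BraidedDiagram P K a b) :=
  Relation.EqvGen.setoid fun Δ Δ' => Iso Δ Δ' ∨ Step Δ Δ'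

/-! ### Concatenation -/

section rank

variable {T : Type}

theorem exists_rank [Finite T] {r : T → T → Prop} (h : ∀ t, ¬ Relation.TransGen r t t) :
    ∃ ρ : T → ℕ, ∀ x y, r x y → ρ x < ρ y := by
  refine ⟨fun x => {z | Relation.TransGen r z x}.ncard, fun x y hxy => ?_⟩
  refine Set.ncard_lt_ncard ⟨fun z hz => Relation.TransGen.tail hz hxy, fun hs => ?_⟩
    (Set.toFinite _)
  exact h x (hs (Relation.TransGen.single hxy))

theorem acyclic_of_rank {r : T → T → Prop} (ρ : T → ℕ) (h : ∀ x y, r x y → ρ x < ρ y) (t : T) :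
    ¬ Relation.TransGen r t t := by
  have key : ∀ x y, Relation.TransGen r x y → ρ x < ρ y := by
    intro x y hxy
    induction hxy with
    | single h1 => exact h _ _ h1
    | tail _ h2 ih => exact ih.trans (h _ _ h2)
  exact fun ht => lt_irrefl _ (key t t ht)

theorem exists_bound [Finite T] (ρ : T → ℕ) : ∃ M, ∀ t, ρ t ≤ M := by
  obtain ⟨M, hM⟩ := (Set.finite_range ρ).bddAbove
  exact ⟨M, fun t => hM ⟨t, rfl⟩⟩

end rank

/-- Ports of a disjoint union of families of transistors. -/
def portSum {T T' : Type} (f : T → List S) (g : T' → List S) :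
    Port (Sum.elim f g) ≃ Port f ⊕ Port g where
  toFun p := match p with
    | ⟨Sum.inl t, i, h⟩ => Sum.inl ⟨t, i, h⟩
    | ⟨Sum.inr t, i, h⟩ => Sum.inr ⟨t, i, h⟩
  invFun p := match p with
    | Sum.inl q => ⟨Sum.inl q.node, q.idx, q.lt⟩
    | Sum.inr q => ⟨Sum.inr q.node, q.idx, q.lt⟩
  left_inv := by rintro ⟨t | t, i, h⟩ <;> rfl
  right_inv := by rintro (⟨t, i, h⟩ | ⟨t, i, h⟩) <;> rfl

/-- Attachment of the wires in a concatenation: the `i`-th wire on the bottom of the frame of the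
upper diagram is glued to the `i`-th wire on the top of the frame of the lower diagram. -/
def compWire {T₁ T₂ : Type} {a b c : List S} {top₁ bot₁ : T₁ → List S} {top₂ bot₂ : T₂ → List S}
    (w₁ : Ends a bot₁ ≃ Ends b top₁) (w₂ : Ends b bot₂ ≃ Ends c top₂) :
    Ends a (Sum.elim bot₁ bot₂) ≃ Ends c (Sum.elim top₁ top₂) :=
  (Equiv.sumCongr (Equiv.refl (Fin a.length)) (portSum bot₁ bot₂)).trans <|
  (Equiv.sumAssoc _ _ _).symm.trans <|
  (Equiv.sumCongr w₁ (Equiv.refl (Port bot₂))).trans <|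
  (Equiv.sumCongr (Equiv.sumComm _ _) (Equiv.refl _)).trans <|
  (Equiv.sumAssoc (Port top₁) (Fin b.length) (Port bot₂)).trans <|
  (Equiv.sumCongr (Equiv.refl _) w₂).trans <|
  (Equiv.sumComm _ _).trans <|
  (Equiv.sumAssoc (Fin c.length) (Port top₂) (Port top₁)).trans <|
  (Equiv.sumCongr (Equiv.refl _) (Equiv.sumComm _ _)).trans <|
  Equiv.sumCongr (Equiv.refl _) (portSum top₁ top₂).symm

/-- Labels of the wires in a concatenation: labels of glued wires are multiplied from top to
bottom. -/
def compLabel [Group K] {T₁ T₂ : Type} {a b : List S} {top₁ bot₁ : T₁ → List S}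
    {bot₂ : T₂ → List S} (w₁ : Ends a bot₁ ≃ Ends b top₁) (l₁ : Ends a bot₁ → K)
    (l₂ : Ends b bot₂ → K) : Ends a (Sum.elim bot₁ bot₂) → K := fun p =>
  let upper : Ends a bot₁ → K := fun q =>
    match w₁ q with
    | Sum.inl i => l₁ q * l₂ (Sum.inl i)
    | Sum.inr _ => l₁ q
  match p with
  | Sum.inl i => upper (Sum.inl i)
  | Sum.inr q => Sum.elim (fun q₁ => upper (Sum.inr q₁)) (fun q₂ => l₂ (Sum.inr q₂))
      (portSum bot₁ bot₂ q)

section compLemmas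

variable {T₁ T₂ : Type} {a b c : List S} {top₁ bot₁ : T₁ → List S} {top₂ bot₂ : T₂ → List S}
  (w₁ : Ends a bot₁ ≃ Ends b top₁) (w₂ : Ends b bot₂ ≃ Ends c top₂)

/-- Endpoints of the upper diagram, seen in the concatenation. -/
def up (g : T₂ → List S) {f : T₁ → List S} : Ends a f → Ends a (Sum.elim f g) :=
  Ends.map Sum.inl (fun _ => rfl)

/-- Endpoints of the lower diagram, seen in the concatenation. -/
def lo (f : T₁ → List S) {g : T₂ → List S} : Ends c g → Ends c (Sum.elim f g) :=
  Ends.map Sum.inr (fun _ => rfl)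

theorem compWire_up_inr {p : Ends a bot₁} {q : Port top₁} (h : w₁ p = Sum.inr q) :
    compWire w₁ w₂ (up bot₂ p) = Sum.inr (q.map Sum.inl (fun _ => rfl)) := by
  rcases p with i | p <;> simp [compWire, up, Ends.map, Port.map, portSum, h]

theorem compWire_up_inl {p : Ends a bot₁} {i : Fin b.length} (h : w₁ p = Sum.inl i) :
    compWire w₁ w₂ (up bot₂ p) = lo top₁ (w₂ (Sum.inl i)) := by
  rcases p with j | p <;> rcases hq : w₂ (Sum.inl i) with k | q <;>
    simp [compWire, up, lo, Ends.map, Port.map, portSum, h, hq]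

theorem compWire_lo (q : Port bot₂) :
    compWire w₁ w₂ (Sum.inr (q.map Sum.inr (fun _ => rfl))) = lo top₁ (w₂ (Sum.inr q)) := by
  rcases hq : w₂ (Sum.inr q) with k | q' <;>
    simp [compWire, lo, Ends.map, Port.map, portSum, hq]

theorem compLabel_up_inr [Group K] {l₁ : Ends a bot₁ → K} {l₂ : Ends b bot₂ → K}
    {p : Ends a bot₁} {q : Port top₁} (h : w₁ p = Sum.inr q) :
    compLabel w₁ l₁ l₂ (up bot₂ p) = l₁ p := by
  rcases p with i | p <;> simp [compLabel, up, Ends.map, Port.map, portSum, h]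

theorem compLabel_up_inl [Group K] {l₁ : Ends a bot₁ → K} {l₂ : Ends b bot₂ → K}
    {p : Ends a bot₁} {i : Fin b.length} (h : w₁ p = Sum.inl i) :
    compLabel w₁ l₁ l₂ (up bot₂ p) = l₁ p * l₂ (Sum.inl i) := by
  rcases p with j | p <;> simp [compLabel, up, Ends.map, Port.map, portSum, h]

theorem compLabel_lo [Group K] {l₁ : Ends a bot₁ → K} {l₂ : Ends b bot₂ → K} (q : Port bot₂) :
    compLabel w₁ l₁ l₂ (Sum.inr (q.map Sum.inr (fun _ => rfl))) = l₂ (Sum.inr q) := by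
  simp [compLabel, Port.map, portSum]

@[simp] theorem letter_up (p : Ends a bot₁) : (up bot₂ p).letter = p.letter := by
  rcases p with i | p <;> rfl

@[simp] theorem letter_lo (p : Ends a bot₂) : (lo bot₁ p).letter = p.letter := by
  rcases p with i | p <;> rfl

theorem ends_cases {motive : Ends a (Sum.elim bot₁ bot₂) → Prop}
    (h1 : ∀ p : Ends a bot₁, motive (up bot₂ p))
    (h2 : ∀ q : Port bot₂, motive (Sum.inr (q.map Sum.inr (fun _ => rfl)))) (p) : motive p := by
  rcases p with i | ⟨t | t, i, h⟩
  · exact h1 (Sum.inl i)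
  · exact h1 (Sum.inr ⟨t, i, h⟩)
  · exact h2 ⟨t, i, h⟩

end compLemmas

@[simp] theorem letter_map {T T' : Type} {a : List S} {f : T → List S} {f' : T' → List S}
    (e : T → T') (h : ∀ t, f' (e t) = f t) (p : Ends a f) :
    (Ends.map e h p).letter = p.letter := by
  rcases p with i | p
  · rfl
  · simp [Ends.map, Ends.letter, Port.letter, Port.map, h]

theorem map_map {T T' T'' : Type} {a : List S} {f : T → List S} {f' : T' → List S}
    {f'' : T'' → List S} (e : T → T') (h : ∀ t, f' (e t) = f t) (e' : T' → T'')
    (h' : ∀ t, f'' (e' t) = f' t) (p : Ends a f) :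
    Ends.map e' h' (Ends.map e h p) =
      Ends.map (e' ∘ e) (fun t => (h' (e t)).trans (h t)) p := by
  rcases p with i | p <;> rfl

theorem map_injective {T T' : Type} {a : List S} {f : T → List S} {f' : T' → List S}
    {e : T → T'} (h : ∀ t, f' (e t) = f t) (he : Function.Injective e) :
    Function.Injective (Ends.map (a := a) e h) := by
  rintro (i | ⟨t, i, hi⟩) (j | ⟨t', j, hj⟩) hij
  · simpa [Ends.map] using hij
  · simp [Ends.map] at hij
  · simp [Ends.map] at hij
  · simp only [Ends.map, Port.map, Sum.map_inr, Sum.inr.injEq, Port.mk.injEq] at hij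
    obtain ⟨h1, rfl⟩ := hij
    obtain rfl := he h1
    rfl

/-- The concatenation `Δ₁ ∘ Δ₂`: the diagram `Δ₂` is glued below `Δ₁`. -/
abbrev comp [Group K] {a b c : List S} (Δ₁ : BraidedDiagram P K a b) (Δ₂ : BraidedDiagram P K b c) :
    BraidedDiagram P K a c where
  T := Δ₁.T ⊕ Δ₂.T
  finite := by
    have := Δ₁.finite
    have := Δ₂.finite
    infer_instance
  top := Sum.elim Δ₁.top Δ₂.top
  bot := Sum.elim Δ₁.bot Δ₂.bot
  rel := by rintro (t | t) <;> [exact Δ₁.rel t; exact Δ₂.rel t]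
  wire := compWire Δ₁.wire Δ₂.wire
  letter_wire := by
    intro p
    induction p using ends_cases with
    | h1 p =>
      have hp := Δ₁.letter_wire p
      rcases hq : Δ₁.wire p with i | q
      · rw [compWire_up_inl _ _ hq, letter_lo, letter_up, Δ₂.letter_wire, ← hp, hq]
        rfl
      · rw [compWire_up_inr _ _ hq, letter_up, ← hp, hq]
        rfl
    | h2 q =>
      rw [compWire_lo, letter_lo, Δ₂.letter_wire]
      rfl
  label := compLabel Δ₁.wire Δ₁.label Δ₂.label
  acyclic := by
    have := Δ₁.finite
    have := Δ₂.finite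
    obtain ⟨ρ₁, h₁⟩ := exists_rank Δ₁.acyclic
    obtain ⟨ρ₂, h₂⟩ := exists_rank Δ₂.acyclic
    obtain ⟨M, hM⟩ := exists_bound ρ₂
    refine acyclic_of_rank (Sum.elim (fun t => ρ₁ t + M + 1) ρ₂) ?_
    rintro (x | x) (y | y) ⟨i, hi, j, hj, h⟩
    · have : compWire Δ₁.wire Δ₂.wire (up _ (Sum.inr ⟨y, i, hi⟩)) = Sum.inr ⟨Sum.inl x, j, hj⟩ := h
      rcases hq : Δ₁.wire (Sum.inr ⟨y, i, hi⟩) with k | q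
      · rw [compWire_up_inl _ _ hq] at this
        rcases hr : Δ₂.wire (Sum.inl k) with l | r <;> simp [hr, lo, Ends.map, Port.map] at this
      · rw [compWire_up_inr _ _ hq] at this
        simp only [Port.map, Sum.inr.injEq, Port.mk.injEq, Sum.inl.injEq] at this
        obtain ⟨rfl, rfl⟩ := this
        have := h₁ q.node y ⟨i, hi, q.idx, q.lt, hq⟩
        simp only [Sum.elim_inl]
        omega
    · have : compWire Δ₁.wire Δ₂.wire
          (Sum.inr (Port.map Sum.inr (fun _ => rfl) (⟨y, i, hi⟩ : Port Δ₂.bot)))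
            = Sum.inr ⟨Sum.inl x, j, hj⟩ := h
      rw [compWire_lo] at this
      rcases hr : Δ₂.wire (Sum.inr ⟨y, i, hi⟩) with l | r <;>
        simp [hr, lo, Ends.map, Port.map] at this
    · have := hM x
      simp only [Sum.elim_inl, Sum.elim_inr]
      omega
    · have : compWire Δ₁.wire Δ₂.wire
          (Sum.inr (Port.map Sum.inr (fun _ => rfl) (⟨y, i, hi⟩ : Port Δ₂.bot)))
            = Sum.inr ⟨Sum.inr x, j, hj⟩ := h
      rw [compWire_lo] at this
      rcases hr : Δ₂.wire (Sum.inr ⟨y, i, hi⟩) with l | r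
      · simp [hr, lo, Ends.map] at this
      · simp only [hr, lo, Ends.map, Port.map, Sum.map_inr, Sum.inr.injEq, Port.mk.injEq] at this
        obtain ⟨rfl, rfl⟩ := this
        exact h₂ r.node y ⟨i, hi, r.idx, r.lt, hr⟩

/-- The trivial diagram `ε(a)`: no transistor, all labels trivial. -/
abbrev trivial [Group K] (a : List S) : BraidedDiagram P K a a where
  T := Empty
  finite := inferInstance
  top := Empty.elim
  bot := Empty.elim
  rel := by rintro ⟨⟩
  wire := Equiv.refl _
  letter_wire := fun _ => rfl
  label := fun _ => 1
  acyclic := by rintro ⟨⟩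

/-- The diagram obtained by turning `Δ` upside down and inverting the labels. -/
abbrev inverse [Group K] {a b : List S} (Δ : BraidedDiagram P K a b) : BraidedDiagram P K b a where
  T := Δ.T
  finite := Δ.finite
  top := Δ.bot
  bot := Δ.top
  rel := fun t => (Δ.rel t).symm
  wire := Δ.wire.symm
  letter_wire := fun p => by
    have := Δ.letter_wire (Δ.wire.symm p)
    rw [Equiv.apply_symm_apply] at this
    exact this.symm
  label := fun p => (Δ.label (Δ.wire.symm p))⁻¹
  acyclic := by
    have := Δ.finite
    obtain ⟨ρ, h⟩ := exists_rank Δ.acyclic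
    obtain ⟨M, hM⟩ := exists_bound ρ
    refine acyclic_of_rank (fun t => M - ρ t) ?_
    rintro x y ⟨i, hi, j, hj, hw⟩
    have := h y x ⟨j, hj, i, hi, by rw [← hw, Equiv.apply_symm_apply]⟩
    have := hM x
    show M - ρ x < M - ρ y
    omega

/-! ### Compatibility of the concatenation with equivalence and reduction -/

section congr

variable [Group K] {a b c : List S}

/-- Top endpoints of wires of the upper diagram, seen in the concatenation. -/
def upO (Δ₁ : BraidedDiagram P K a b) (Δ₂ : BraidedDiagram P K b c) (p : Ends a Δ₁.bot) :
    Ends a (comp Δ₁ Δ₂).bot := up Δ₂.bot p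

/-- Top endpoints of wires of the lower diagram, seen in the concatenation. -/
def loO (Δ₁ : BraidedDiagram P K a b) (Δ₂ : BraidedDiagram P K b c) (q : Port Δ₂.bot) :
    Ends a (comp Δ₁ Δ₂).bot := Sum.inr (q.map Sum.inr (fun _ => rfl))

/-- Bottom endpoints of wires of the upper diagram, seen in the concatenation. -/
def upI (Δ₁ : BraidedDiagram P K a b) (Δ₂ : BraidedDiagram P K b c) (q : Port Δ₁.top) :
    Ends c (comp Δ₁ Δ₂).top := Sum.inr (q.map Sum.inl (fun _ => rfl))

/-- Bottom endpoints of wires of the lower diagram, seen in the concatenation. -/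
def loI (Δ₁ : BraidedDiagram P K a b) (Δ₂ : BraidedDiagram P K b c) (p : Ends c Δ₂.top) :
    Ends c (comp Δ₁ Δ₂).top := lo Δ₁.top p

variable (Δ₁ : BraidedDiagram P K a b) (Δ₂ : BraidedDiagram P K b c)

theorem wire_upO_inr {p : Ends a Δ₁.bot} {q : Port Δ₁.top} (h : Δ₁.wire p = Sum.inr q) :
    (comp Δ₁ Δ₂).wire (upO Δ₁ Δ₂ p) = upI Δ₁ Δ₂ q := compWire_up_inr _ _ h

theorem wire_upO_inl {p : Ends a Δ₁.bot} {i} (h : Δ₁.wire p = Sum.inl i) :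
    (comp Δ₁ Δ₂).wire (upO Δ₁ Δ₂ p) = loI Δ₁ Δ₂ (Δ₂.wire (Sum.inl i)) := compWire_up_inl _ _ h

theorem wire_loO (q : Port Δ₂.bot) :
    (comp Δ₁ Δ₂).wire (loO Δ₁ Δ₂ q) = loI Δ₁ Δ₂ (Δ₂.wire (Sum.inr q)) := compWire_lo _ _ q

theorem label_upO_inr {p : Ends a Δ₁.bot} {q : Port Δ₁.top} (h : Δ₁.wire p = Sum.inr q) :
    (comp Δ₁ Δ₂).label (upO Δ₁ Δ₂ p) = Δ₁.label p := compLabel_up_inr _ h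

theorem label_upO_inl {p : Ends a Δ₁.bot} {i} (h : Δ₁.wire p = Sum.inl i) :
    (comp Δ₁ Δ₂).label (upO Δ₁ Δ₂ p) = Δ₁.label p * Δ₂.label (Sum.inl i) := compLabel_up_inl _ h

theorem label_loO (q : Port Δ₂.bot) :
    (comp Δ₁ Δ₂).label (loO Δ₁ Δ₂ q) = Δ₂.label (Sum.inr q) :=
  compLabel_lo (l₁ := Δ₁.label) Δ₁.wire q

theorem comp_cases {motive : Ends a (comp Δ₁ Δ₂).bot → Prop}
    (h1 : ∀ p, motive (upO Δ₁ Δ₂ p)) (h2 : ∀ q, motive (loO Δ₁ Δ₂ q)) (p) : motive p :=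
  ends_cases h1 h2 p

theorem upI_inj {p q : Port Δ₁.top} (h : upI Δ₁ Δ₂ p = upI Δ₁ Δ₂ q) : p = q := by
  have h := Sum.inr_injective h
  have h2 := congrArg Port.idx h
  exact Port.ext (Sum.inl_injective (congrArg Port.node h)) h2

theorem loI_inj {p q : Ends c Δ₂.top} (h : loI Δ₁ Δ₂ p = loI Δ₁ Δ₂ q) : p = q :=
  map_injective _ Sum.inr_injective h

theorem upI_ne_loI {p : Port Δ₁.top} {q : Ends c Δ₂.top} : upI Δ₁ Δ₂ p ≠ loI Δ₁ Δ₂ q := by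
  rcases q with i | q <;> intro h
  · exact Sum.inr_ne_inl h
  · exact Sum.inl_ne_inr (congrArg Port.node (Sum.inr_injective h))

theorem wire_upO_eq_upI {p : Ends a Δ₁.bot} {q : Port Δ₁.top} :
    (comp Δ₁ Δ₂).wire (upO Δ₁ Δ₂ p) = upI Δ₁ Δ₂ q ↔ Δ₁.wire p = Sum.inr q := by
  refine ⟨fun h => ?_, wire_upO_inr _ _⟩
  rcases hr : Δ₁.wire p with i | r
  · rw [wire_upO_inl _ _ hr] at h
    exact absurd h.symm (upI_ne_loI _ _)
  · rw [wire_upO_inr _ _ hr] at h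
    rw [upI_inj _ _ h]

variable {Δ₁ Δ₂}
variable {Δ₁' : BraidedDiagram P K a b} {Δ₂' : BraidedDiagram P K b c}

theorem map_upO (e₁ : Δ₁'.T → Δ₁.T) (e₂ : Δ₂'.T → Δ₂.T) (h₁ : ∀ t, Δ₁.bot (e₁ t) = Δ₁'.bot t)
    (h : ∀ t, (comp Δ₁ Δ₂).bot (Sum.map e₁ e₂ t) = (comp Δ₁' Δ₂').bot t) (p) :
    Ends.map (f' := (comp Δ₁ Δ₂).bot) (Sum.map e₁ e₂) h (upO Δ₁' Δ₂' p) =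
      upO Δ₁ Δ₂ (Ends.map e₁ h₁ p) := by
  rcases p with i | p <;> rfl

theorem map_loO (e₁ : Δ₁'.T → Δ₁.T) (e₂ : Δ₂'.T → Δ₂.T) (h₂ : ∀ t, Δ₂.bot (e₂ t) = Δ₂'.bot t)
    (h : ∀ t, (comp Δ₁ Δ₂).bot (Sum.map e₁ e₂ t) = (comp Δ₁' Δ₂').bot t) (q) :
    Ends.map (f' := (comp Δ₁ Δ₂).bot) (Sum.map e₁ e₂) h (loO Δ₁' Δ₂' q) =
      loO Δ₁ Δ₂ (Port.map e₂ h₂ q) := rfl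

theorem map_upI (e₁ : Δ₁'.T → Δ₁.T) (e₂ : Δ₂'.T → Δ₂.T) (h₁ : ∀ t, Δ₁.top (e₁ t) = Δ₁'.top t)
    (h : ∀ t, (comp Δ₁ Δ₂).top (Sum.map e₁ e₂ t) = (comp Δ₁' Δ₂').top t) (q) :
    Ends.map (f' := (comp Δ₁ Δ₂).top) (Sum.map e₁ e₂) h (upI Δ₁' Δ₂' q) =
      upI Δ₁ Δ₂ (Port.map e₁ h₁ q) := rfl

theorem map_loI (e₁ : Δ₁'.T → Δ₁.T) (e₂ : Δ₂'.T → Δ₂.T) (h₂ : ∀ t, Δ₂.top (e₂ t) = Δ₂'.top t)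
    (h : ∀ t, (comp Δ₁ Δ₂).top (Sum.map e₁ e₂ t) = (comp Δ₁' Δ₂').top t) (p) :
    Ends.map (f' := (comp Δ₁ Δ₂).top) (Sum.map e₁ e₂) h (loI Δ₁' Δ₂' p) =
      loI Δ₁ Δ₂ (Ends.map e₂ h₂ p) := by
  rcases p with i | p <;> rfl

theorem Iso.refl (Δ : BraidedDiagram P K a b) : Iso Δ Δ := by
  refine ⟨Equiv.refl _, fun _ => rfl, fun _ => rfl, fun p => ?_⟩
  have h1 : ∀ {d : List S} {f : Δ.T → List S} (q : Ends d f),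
      Ends.map (Equiv.refl Δ.T) (fun _ => rfl) q = q := by
    rintro d f (i | q) <;> rfl
  exact ⟨(congrArg _ (h1 p)).trans (h1 _).symm, congrArg _ (h1 p)⟩

theorem Iso.comp (h₁ : Iso Δ₁ Δ₁') (h₂ : Iso Δ₂ Δ₂') :
    Iso (comp Δ₁ Δ₂) (comp Δ₁' Δ₂') := by
  obtain ⟨e₁, ht₁, hb₁, H₁⟩ := h₁
  obtain ⟨e₂, ht₂, hb₂, H₂⟩ := h₂
  have hb : ∀ t, (BraidedDiagram.comp Δ₁' Δ₂').bot (Sum.map e₁ e₂ t) =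
      (BraidedDiagram.comp Δ₁ Δ₂).bot t := by
    rintro (t | t) <;> [exact hb₁ t; exact hb₂ t]
  have ht : ∀ t, (BraidedDiagram.comp Δ₁' Δ₂').top (Sum.map e₁ e₂ t) =
      (BraidedDiagram.comp Δ₁ Δ₂).top t := by
    rintro (t | t) <;> [exact ht₁ t; exact ht₂ t]
  refine ⟨Equiv.sumCongr e₁ e₂, ht, hb, fun p => ?_⟩
  show (BraidedDiagram.comp Δ₁' Δ₂').wire (Ends.map (Sum.map e₁ e₂) hb p) =
      Ends.map (Sum.map e₁ e₂) ht ((BraidedDiagram.comp Δ₁ Δ₂).wire p) ∧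
    (BraidedDiagram.comp Δ₁' Δ₂').label (Ends.map (Sum.map e₁ e₂) hb p) =
      (BraidedDiagram.comp Δ₁ Δ₂).label p
  induction p using comp_cases with
  | h1 p =>
    obtain ⟨H, L⟩ := H₁ p
    rw [map_upO _ _ hb₁]
    rcases hq : Δ₁.wire p with i | q
    · rw [hq] at H
      have H : Δ₁'.wire (Ends.map e₁ hb₁ p) = Sum.inl i := H
      obtain ⟨H', L'⟩ := H₂ (Sum.inl i)
      have H' : Δ₂'.wire (Sum.inl i) = _ := H'
      have L' : Δ₂'.label (Sum.inl i) = _ := L'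
      rw [wire_upO_inl _ _ H, wire_upO_inl _ _ hq, label_upO_inl _ _ H, label_upO_inl _ _ hq,
        H', L', L, map_loI _ _ ht₂]
      exact ⟨rfl, rfl⟩
    · rw [hq] at H
      have H : Δ₁'.wire (Ends.map e₁ hb₁ p) = Sum.inr (Port.map e₁ ht₁ q) := H
      rw [wire_upO_inr _ _ H, wire_upO_inr _ _ hq, label_upO_inr _ _ H, label_upO_inr _ _ hq,
        L, map_upI _ _ ht₁]
      exact ⟨rfl, rfl⟩
  | h2 q =>
    obtain ⟨H', L'⟩ := H₂ (Sum.inr q)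
    have H' : Δ₂'.wire (Sum.inr (Port.map e₂ hb₂ q)) = _ := H'
    have L' : Δ₂'.label (Sum.inr (Port.map e₂ hb₂ q)) = _ := L'
    rw [map_loO _ _ hb₂, wire_loO, wire_loO, label_loO, label_loO, H', L', map_loI _ _ ht₂]
    exact ⟨rfl, rfl⟩

theorem Step.comp_right (h₁ : Step Δ₁ Δ₁') (Δ₂ : BraidedDiagram P K b c) :
    Step (comp Δ₁ Δ₂) (comp Δ₁' Δ₂) := by
  obtain ⟨t₁, t₂, D, e, ht₁, hb₁, inj, rng, H₁⟩ := h₁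
  have hb : ∀ t, (comp Δ₁ Δ₂).bot (Sum.map e id t) = (comp Δ₁' Δ₂).bot t := by
    rintro (t | t) <;> [exact hb₁ t; rfl]
  have ht : ∀ t, (comp Δ₁ Δ₂).top (Sum.map e id t) = (comp Δ₁' Δ₂).top t := by
    rintro (t | t) <;> [exact ht₁ t; rfl]
  have hid : ∀ (x : Ends c Δ₂.top), Ends.map id (fun _ => rfl) x = x := by
    rintro (i | q) <;> rfl
  refine ⟨Sum.inl t₁, Sum.inl t₂, ⟨D.inner, D.outer, fun i h₁ h₂ => ?_, fun i h₂ => ?_⟩,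
    Sum.map e id, ht, hb, inj.sumMap Function.injective_id, ?_, fun p => ?_⟩
  · have h₁' : i < (Δ₁.top t₁).length := h₁
    have h₂' : i < (Δ₁.bot t₂).length := h₂
    have := wire_upO_inr Δ₁ Δ₂ (D.wires i h₁' h₂')
    exact this
  · have h₂' : i < (Δ₁.bot t₂).length := h₂
    have h₁' : i < (Δ₁.top t₁).length := by rw [D.inner]; exact h₂'
    have := (label_upO_inr Δ₁ Δ₂ (D.wires i h₁' h₂')).trans (D.labels i h₂')
    exact this
  · rintro (t | t)
    · have := rng t
      simp only [ne_eq, Sum.inl.injEq, Sum.exists, Sum.map_inl, Sum.map_inr, reduceCtorEq,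
        exists_false, or_false]
      exact this
    · simp
  induction p using comp_cases with
  | h1 p =>
    obtain ⟨H, H'⟩ := H₁ p
    rw [map_upO e id hb₁]
    refine ⟨fun i h h' hw => ?_, fun hw => ?_⟩
    · have hw : Δ₁.wire (Ends.map e hb₁ p) = Sum.inr ⟨t₂, i, h⟩ :=
        (wire_upO_eq_upI Δ₁ Δ₂ (q := ⟨t₂, i, h⟩)).1 hw
      obtain ⟨H, L⟩ := H i h h' hw
      show Ends.map (Sum.map e id) ht ((comp Δ₁' Δ₂).wire (upO Δ₁' Δ₂ p)) =
          (comp Δ₁ Δ₂).wire (upO Δ₁ Δ₂ (Sum.inr ⟨t₁, i, h'⟩)) ∧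
        (comp Δ₁' Δ₂).label (upO Δ₁' Δ₂ p) = (comp Δ₁ Δ₂).label (upO Δ₁ Δ₂ (Ends.map e hb₁ p)) *
          (comp Δ₁ Δ₂).label (upO Δ₁ Δ₂ (Sum.inr ⟨t₁, i, h'⟩))
      rw [label_upO_inr _ _ hw]
      rcases hq : Δ₁'.wire p with k | q
      · rw [hq] at H
        have H : Δ₁.wire (Sum.inr ⟨t₁, i, h'⟩) = Sum.inl k := H.symm
        rw [wire_upO_inl _ _ hq, wire_upO_inl _ _ H, label_upO_inl _ _ hq, label_upO_inl _ _ H, L,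
          map_loI e id (fun _ => rfl), hid, mul_assoc]
        exact ⟨rfl, rfl⟩
      · rw [hq] at H
        have H : Δ₁.wire (Sum.inr ⟨t₁, i, h'⟩) = Sum.inr (Port.map e ht₁ q) := H.symm
        rw [wire_upO_inr _ _ hq, wire_upO_inr _ _ H, label_upO_inr _ _ hq, label_upO_inr _ _ H, L,
          map_upI e id ht₁]
        exact ⟨rfl, rfl⟩
    · have hw : ∀ i h, Δ₁.wire (Ends.map e hb₁ p) ≠ Sum.inr ⟨t₂, i, h⟩ := fun i h hc =>
        hw i h ((wire_upO_eq_upI Δ₁ Δ₂ (q := ⟨t₂, i, h⟩)).2 hc)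
      obtain ⟨H, L⟩ := H' hw
      rcases hq : Δ₁'.wire p with k | q
      · rw [hq] at H
        have H : Δ₁.wire (Ends.map e hb₁ p) = Sum.inl k := H.symm
        rw [wire_upO_inl _ _ hq, wire_upO_inl _ _ H, label_upO_inl _ _ hq, label_upO_inl _ _ H, L,
          map_loI e id (fun _ => rfl), hid]
        exact ⟨rfl, rfl⟩
      · rw [hq] at H
        have H : Δ₁.wire (Ends.map e hb₁ p) = Sum.inr (Port.map e ht₁ q) := H.symm
        rw [wire_upO_inr _ _ hq, wire_upO_inr _ _ H, label_upO_inr _ _ hq, label_upO_inr _ _ H, L,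
          map_upI e id ht₁]
        exact ⟨rfl, rfl⟩
  | h2 q =>
    rw [map_loO e id (fun _ => rfl)]
    have hq : Port.map id (fun _ => rfl) q = q := rfl
    rw [hq, wire_loO, wire_loO, label_loO, label_loO, map_loI e id (fun _ => rfl), hid]
    exact ⟨fun i h h' hw => absurd hw.symm (upI_ne_loI Δ₁ Δ₂ (p := ⟨t₂, i, h⟩)),
      fun _ => ⟨rfl, rfl⟩⟩

theorem Step.comp_left (Δ₁ : BraidedDiagram P K a b) (h₂ : Step Δ₂ Δ₂') :
    Step (comp Δ₁ Δ₂) (comp Δ₁ Δ₂') := by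
  obtain ⟨t₁, t₂, D, e, ht₂, hb₂, inj, rng, H₂⟩ := h₂
  have hb : ∀ t, (comp Δ₁ Δ₂).bot (Sum.map id e t) = (comp Δ₁ Δ₂').bot t := by
    rintro (t | t) <;> [rfl; exact hb₂ t]
  have ht : ∀ t, (comp Δ₁ Δ₂).top (Sum.map id e t) = (comp Δ₁ Δ₂').top t := by
    rintro (t | t) <;> [rfl; exact ht₂ t]
  have hid : ∀ (x : Ends a Δ₁.bot), Ends.map id (fun _ => rfl) x = x := by
    rintro (i | q) <;> rfl
  refine ⟨Sum.inr t₁, Sum.inr t₂, ⟨D.inner, D.outer, fun i h₁ h₂ => ?_, fun i h₂ => ?_⟩,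
    Sum.map id e, ht, hb, Function.injective_id.sumMap inj, ?_, fun p => ?_⟩
  · exact (wire_loO Δ₁ Δ₂ ⟨t₂, i, h₂⟩).trans (congrArg _ (D.wires i h₁ h₂))
  · exact (label_loO Δ₁ Δ₂ ⟨t₂, i, h₂⟩).trans (D.labels i h₂)
  · rintro (t | t)
    · simp
    · have := rng t
      simp only [ne_eq, Sum.inr.injEq, Sum.exists, Sum.map_inl, Sum.map_inr, reduceCtorEq,
        exists_false, false_or]
      exact this
  have aux : ∀ (x : Ends c Δ₂.top) i h, loI Δ₁ Δ₂ x = Sum.inr ⟨Sum.inr t₂, i, h⟩ ↔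
      x = Sum.inr ⟨t₂, i, h⟩ := by
    intro x i h
    exact ⟨fun hx => loI_inj Δ₁ Δ₂ (q := Sum.inr ⟨t₂, i, h⟩) hx, fun hx => by rw [hx]; rfl⟩
  induction p using comp_cases with
  | h1 p =>
    rw [map_upO id e (fun _ => rfl), hid]
    rcases hq : Δ₁.wire p with k | q
    · obtain ⟨H, H'⟩ := H₂ (Sum.inl k)
      rw [wire_upO_inl _ _ hq, wire_upO_inl _ _ hq, label_upO_inl _ _ hq, label_upO_inl _ _ hq,
        map_loI id e ht₂]
      refine ⟨fun i h h' hw => ?_, fun hw => ?_⟩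
      · obtain ⟨H, L⟩ := H i h h' ((aux _ _ _).1 hw)
        have L : Δ₂'.label (Sum.inl k) = Δ₂.label (Sum.inl k) * _ := L
        rw [H, L, ← mul_assoc]
        exact ⟨(wire_loO Δ₁ Δ₂ ⟨t₁, i, h'⟩).symm,
          congrArg _ (label_loO Δ₁ Δ₂ ⟨t₁, i, h'⟩).symm⟩
      · obtain ⟨H, L⟩ := H' (fun i h hc => hw i h ((aux _ _ _).2 hc))
        have L : Δ₂'.label (Sum.inl k) = Δ₂.label (Sum.inl k) := L
        rw [H, L]
        exact ⟨rfl, rfl⟩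
    · rw [wire_upO_inr _ _ hq, wire_upO_inr _ _ hq, label_upO_inr _ _ hq, label_upO_inr _ _ hq,
        map_upI id e (fun _ => rfl)]
      refine ⟨fun i h h' hw => ?_, fun _ => ⟨rfl, rfl⟩⟩
      exact absurd (show upI Δ₁ Δ₂ q = loI Δ₁ Δ₂ (Sum.inr ⟨t₂, i, h⟩) from hw) (upI_ne_loI _ _)
  | h2 q =>
    obtain ⟨H, H'⟩ := H₂ (Sum.inr q)
    rw [map_loO id e hb₂, wire_loO, wire_loO, label_loO, label_loO, map_loI id e ht₂]
    refine ⟨fun i h h' hw => ?_, fun hw => ?_⟩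
    · obtain ⟨H, L⟩ := H i h h' ((aux _ _ _).1 hw)
      rw [H, L]
      exact ⟨(wire_loO Δ₁ Δ₂ ⟨t₁, i, h'⟩).symm,
        congrArg _ (label_loO Δ₁ Δ₂ ⟨t₁, i, h'⟩).symm⟩
    · obtain ⟨H, L⟩ := H' (fun i h hc => hw i h ((aux _ _ _).2 hc))
      rw [H, L]
      exact ⟨rfl, rfl⟩

theorem modDipoles_comp (h₁ : modDipoles P K a b Δ₁ Δ₁') (h₂ : modDipoles P K b c Δ₂ Δ₂') :
    modDipoles P K a c (comp Δ₁ Δ₂) (comp Δ₁' Δ₂') := by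
  have A : ∀ {Δ₁ Δ₁' : BraidedDiagram P K a b} (Δ₂ : BraidedDiagram P K b c),
      modDipoles P K a b Δ₁ Δ₁' → modDipoles P K a c (comp Δ₁ Δ₂) (comp Δ₁' Δ₂) := by
    intro Δ₁ Δ₁' Δ₂ h
    induction h with
    | rel x y h =>
      rcases h with h | h
      · exact .rel _ _ (Or.inl (h.comp (Iso.refl _)))
      · exact .rel _ _ (Or.inr (h.comp_right _))
    | refl x => exact .refl _
    | symm x y _ ih => exact .symm _ _ ih
    | trans x y z _ _ ih ih' => exact .trans _ _ _ ih ih'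
  have B : ∀ (Δ₁ : BraidedDiagram P K a b) {Δ₂ Δ₂' : BraidedDiagram P K b c},
      modDipoles P K b c Δ₂ Δ₂' → modDipoles P K a c (comp Δ₁ Δ₂) (comp Δ₁ Δ₂') := by
    intro Δ₁ Δ₂ Δ₂' h
    induction h with
    | rel x y h =>
      rcases h with h | h
      · exact .rel _ _ (Or.inl ((Iso.refl _).comp h))
      · exact .rel _ _ (Or.inr (h.comp_left _))
    | refl x => exact .refl _
    | symm x y _ ih => exact .symm _ _ ih
    | trans x y z _ _ ih ih' => exact .trans _ _ _ ih ih'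
  exact (modDipoles P K a c).trans (A Δ₂ h₁) (B Δ₁' h₂)

end congr

/-! ### Associativity and units -/

section assoc

variable [Group K] {a b c d : List S}

theorem comp_assoc (Δ₁ : BraidedDiagram P K a b) (Δ₂ : BraidedDiagram P K b c)
    (Δ₃ : BraidedDiagram P K c d) :
    Iso (comp (comp Δ₁ Δ₂) Δ₃) (comp Δ₁ (comp Δ₂ Δ₃)) := by
  refine ⟨Equiv.sumAssoc _ _ _, ?_, ?_, fun p => ?_⟩
  · rintro ((t | t) | t) <;> rfl
  · rintro ((t | t) | t) <;> rfl
  have hb : ∀ t, (comp Δ₁ (comp Δ₂ Δ₃)).bot (Equiv.sumAssoc _ _ _ t) =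
      (comp (comp Δ₁ Δ₂) Δ₃).bot t := by
    rintro ((t | t) | t) <;> rfl
  have ht : ∀ t, (comp Δ₁ (comp Δ₂ Δ₃)).top (Equiv.sumAssoc _ _ _ t) =
      (comp (comp Δ₁ Δ₂) Δ₃).top t := by
    rintro ((t | t) | t) <;> rfl
  show (comp Δ₁ (comp Δ₂ Δ₃)).wire (Ends.map (Equiv.sumAssoc _ _ _) hb p) =
      Ends.map (Equiv.sumAssoc _ _ _) ht ((comp (comp Δ₁ Δ₂) Δ₃).wire p) ∧
    (comp Δ₁ (comp Δ₂ Δ₃)).label (Ends.map (Equiv.sumAssoc _ _ _) hb p) =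
      (comp (comp Δ₁ Δ₂) Δ₃).label p
  have b1 : ∀ p, Ends.map (f' := (comp Δ₁ (comp Δ₂ Δ₃)).bot) (Equiv.sumAssoc _ _ _) hb
      (upO (comp Δ₁ Δ₂) Δ₃ (upO Δ₁ Δ₂ p)) = upO Δ₁ (comp Δ₂ Δ₃) p := by
    rintro (i | p) <;> rfl
  have b2 : ∀ q : Port Δ₂.bot, Ends.map (f' := (comp Δ₁ (comp Δ₂ Δ₃)).bot)
      (Equiv.sumAssoc _ _ _) hb (upO (comp Δ₁ Δ₂) Δ₃ (loO Δ₁ Δ₂ q)) =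
      loO Δ₁ (comp Δ₂ Δ₃) (q.map Sum.inl (fun _ => rfl)) := fun _ => rfl
  have b3 : ∀ q : Port Δ₃.bot, Ends.map (f' := (comp Δ₁ (comp Δ₂ Δ₃)).bot)
      (Equiv.sumAssoc _ _ _) hb (loO (comp Δ₁ Δ₂) Δ₃ q) =
      loO Δ₁ (comp Δ₂ Δ₃) (q.map Sum.inr (fun _ => rfl)) := fun _ => rfl
  have b2' : ∀ q : Port Δ₂.bot,
      (Sum.inr (q.map Sum.inl (fun _ => rfl)) : Ends b (comp Δ₂ Δ₃).bot) =
        upO Δ₂ Δ₃ (Sum.inr q) := fun _ => rfl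
  have b3' : ∀ q : Port Δ₃.bot,
      (Sum.inr (q.map Sum.inr (fun _ => rfl)) : Ends b (comp Δ₂ Δ₃).bot) =
        loO Δ₂ Δ₃ q := fun _ => rfl
  have b1' : ∀ i, (Sum.inl i : Ends b (comp Δ₂ Δ₃).bot) = upO Δ₂ Δ₃ (Sum.inl i) := fun _ => rfl
  have key : ∀ (x : Ends b Δ₂.bot) (y : Ends a (comp Δ₁ Δ₂).bot),
      (comp Δ₁ Δ₂).wire y = loI Δ₁ Δ₂ (Δ₂.wire x) →
      loI Δ₁ (comp Δ₂ Δ₃) ((comp Δ₂ Δ₃).wire (upO Δ₂ Δ₃ x)) =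
        Ends.map (f' := (comp Δ₁ (comp Δ₂ Δ₃)).top) (Equiv.sumAssoc _ _ _) ht
          ((comp (comp Δ₁ Δ₂) Δ₃).wire (upO (comp Δ₁ Δ₂) Δ₃ y)) ∧
      ∀ g, (comp Δ₁ Δ₂).label y = g * Δ₂.label x →
        g * (comp Δ₂ Δ₃).label (upO Δ₂ Δ₃ x) =
          (comp (comp Δ₁ Δ₂) Δ₃).label (upO (comp Δ₁ Δ₂) Δ₃ y) := by
    intro x y hy
    rcases hr : Δ₂.wire x with k | r
    · rw [hr] at hy
      have hy : (comp Δ₁ Δ₂).wire y = Sum.inl k := hy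
      rw [wire_upO_inl _ _ hr, wire_upO_inl _ _ hy, label_upO_inl _ _ hr, label_upO_inl _ _ hy]
      refine ⟨?_, fun g hg => by rw [hg, mul_assoc]⟩
      rcases Δ₃.wire (Sum.inl k) with l | s <;> rfl
    · rw [hr] at hy
      have hy : (comp Δ₁ Δ₂).wire y = Sum.inr (r.map Sum.inr (fun _ => rfl)) := hy
      rw [wire_upO_inr _ _ hr, wire_upO_inr _ _ hy, label_upO_inr _ _ hr, label_upO_inr _ _ hy]
      exact ⟨rfl, fun g hg => hg.symm⟩
  induction p using comp_cases with
  | h1 p =>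
    induction p using comp_cases with
    | h1 p =>
      rw [b1]
      rcases hq : Δ₁.wire p with i | q
      · rw [wire_upO_inl _ _ hq, label_upO_inl _ _ hq, b1']
        obtain ⟨h1, h2⟩ := key (Sum.inl i) (upO Δ₁ Δ₂ p) (wire_upO_inl _ _ hq)
        exact ⟨h1, h2 _ (label_upO_inl _ _ hq)⟩
      · have hq' : (comp Δ₁ Δ₂).wire (upO Δ₁ Δ₂ p) = Sum.inr (q.map Sum.inl (fun _ => rfl)) :=
          wire_upO_inr _ _ hq
        rw [wire_upO_inr _ _ hq, label_upO_inr _ _ hq, wire_upO_inr _ _ hq',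
          label_upO_inr _ _ hq', label_upO_inr _ _ hq]
        exact ⟨rfl, rfl⟩
    | h2 q =>
      rw [b2, wire_loO, label_loO, b2']
      obtain ⟨h1, h2⟩ := key (Sum.inr q) (loO Δ₁ Δ₂ q) (wire_loO _ _ _)
      refine ⟨h1, ?_⟩
      have := h2 1 (by rw [one_mul, label_loO])
      rwa [one_mul] at this
  | h2 q =>
    rw [b3, wire_loO, wire_loO, label_loO, label_loO, b3', wire_loO, label_loO]
    refine ⟨?_, rfl⟩
    rcases Δ₃.wire (Sum.inr q) with l | s <;> rfl

theorem comp_trivial (Δ : BraidedDiagram P K a b) : Iso (comp Δ (trivial b)) Δ := by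
  have hb : ∀ t, Δ.bot (Equiv.sumEmpty Δ.T Empty t) = (comp Δ (trivial b)).bot t := by
    rintro (t | ⟨⟨⟩⟩); rfl
  have ht : ∀ t, Δ.top (Equiv.sumEmpty Δ.T Empty t) = (comp Δ (trivial b)).top t := by
    rintro (t | ⟨⟨⟩⟩); rfl
  refine ⟨Equiv.sumEmpty Δ.T Empty, ht, hb, fun p => ?_⟩
  induction p using comp_cases with
  | h1 p =>
    have : Ends.map (Equiv.sumEmpty Δ.T Empty) hb (upO Δ (trivial b) p) = p := by
      rcases p with i | p <;> rfl
    rw [this]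
    rcases hq : Δ.wire p with i | q
    · rw [wire_upO_inl _ _ hq, label_upO_inl _ _ hq]
      exact ⟨rfl, (mul_one _).symm⟩
    · rw [wire_upO_inr _ _ hq, label_upO_inr _ _ hq]
      exact ⟨rfl, rfl⟩
  | h2 q => exact q.node.elim

theorem trivial_comp (Δ : BraidedDiagram P K a b) : Iso (comp (trivial a) Δ) Δ := by
  have hb : ∀ t, Δ.bot (Equiv.emptySum Empty Δ.T t) = (comp (trivial a) Δ).bot t := by
    rintro (⟨⟨⟩⟩ | t); rfl
  have ht : ∀ t, Δ.top (Equiv.emptySum Empty Δ.T t) = (comp (trivial a) Δ).top t := by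
    rintro (⟨⟨⟩⟩ | t); rfl
  have hlo : ∀ q, Ends.map (f' := Δ.top) (Equiv.emptySum Empty Δ.T) ht
      (loI (trivial a) Δ q) = q := by
    rintro (i | q) <;> rfl
  refine ⟨Equiv.emptySum Empty Δ.T, ht, hb, fun p => ?_⟩
  induction p using comp_cases with
  | h1 p =>
    rcases p with i | p
    · rw [wire_upO_inl _ _ (rfl : (trivial a : BraidedDiagram P K a a).wire (Sum.inl i) = Sum.inl i),
        label_upO_inl _ _ (rfl : (trivial a : BraidedDiagram P K a a).wire (Sum.inl i) = Sum.inl i),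
        hlo]
      exact ⟨rfl, (one_mul _).symm⟩
    · exact p.node.elim
  | h2 q =>
    rw [wire_loO, label_loO, hlo]
    exact ⟨rfl, rfl⟩

end assoc

/-! ### Existence of reductions -/

section reduction

variable [Group K] {a b : List S}

theorem top_ne_nil (Δ : BraidedDiagram P K a b) (t : Δ.T) : Δ.top t ≠ [] := by
  rcases Δ.rel t with h | h
  · exact (P.ne_nil _ h).1
  · exact (P.ne_nil _ h).2

theorem exists_map_val {T : Type} {d : List S} (f : T → List S) {t₁ t₂ : T} {q : Ends d f}
    (h₁ : ∀ i h, q ≠ Sum.inr ⟨t₁, i, h⟩) (h₂ : ∀ i h, q ≠ Sum.inr ⟨t₂, i, h⟩) :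
    ∃ q' : Ends d (fun t : {t // t ≠ t₁ ∧ t ≠ t₂} => f t.1),
      Ends.map Subtype.val (fun _ => rfl) q' = q := by
  rcases q with i | ⟨t, i, h⟩
  · exact ⟨Sum.inl i, rfl⟩
  · refine ⟨Sum.inr ⟨⟨t, ?_, ?_⟩, i, h⟩, rfl⟩
    · rintro rfl
      exact h₁ i h rfl
    · rintro rfl
      exact h₂ i h rfl

theorem map_val_ne {T : Type} {d : List S} (f : T → List S) {t₁ t₂ : T}
    (q' : Ends d (fun t : {t // t ≠ t₁ ∧ t ≠ t₂} => f t.1)) :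
    (∀ i h, Ends.map Subtype.val (fun _ => rfl) q' ≠ (Sum.inr ⟨t₁, i, h⟩ : Ends d f)) ∧
      ∀ i h, Ends.map Subtype.val (fun _ => rfl) q' ≠ (Sum.inr ⟨t₂, i, h⟩ : Ends d f) := by
  rcases q' with j | ⟨⟨t, ht₁, ht₂⟩, j, hj⟩
  · exact ⟨fun i h hc => Sum.inl_ne_inr hc, fun i h hc => Sum.inl_ne_inr hc⟩
  · exact ⟨fun i h hc => ht₁ (congrArg Port.node (Sum.inr_injective hc)),
      fun i h hc => ht₂ (congrArg Port.node (Sum.inr_injective hc))⟩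

/-- Every dipole can be reduced. -/
theorem exists_step (Δ : BraidedDiagram P K a b) {t₁ t₂ : Δ.T} (D : Δ.IsDipole t₁ t₂) :
    ∃ (Δ' : BraidedDiagram P K a b) (e : Δ'.T → Δ.T) (ht : ∀ s, Δ.top (e s) = Δ'.top s)
      (hb : ∀ s, Δ.bot (e s) = Δ'.bot s),
      Function.Injective e ∧ (∀ t, (∃ s, e s = t) ↔ t ≠ t₁ ∧ t ≠ t₂) ∧
      ∀ p,
        (∀ i h h', Δ.wire (Ends.map e hb p) = Sum.inr ⟨t₂, i, h⟩ →
          Ends.map e ht (Δ'.wire p) = Δ.wire (Sum.inr ⟨t₁, i, h'⟩) ∧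
          Δ'.label p = Δ.label (Ends.map e hb p) * Δ.label (Sum.inr ⟨t₁, i, h'⟩)) ∧
        ((∀ i h, Δ.wire (Ends.map e hb p) ≠ Sum.inr ⟨t₂, i, h⟩) →
          Ends.map e ht (Δ'.wire p) = Δ.wire (Ends.map e hb p) ∧
          Δ'.label p = Δ.label (Ends.map e hb p)) := by
  have := Δ.finite
  obtain ⟨ρ, hρ⟩ := exists_rank Δ.acyclic
  have hρ : ∀ x y i hi j hj, Δ.wire (Sum.inr ⟨y, i, hi⟩) = Sum.inr ⟨x, j, hj⟩ → ρ x < ρ y :=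
    fun x y i hi j hj h => hρ x y ⟨i, hi, j, hj, h⟩
  have h12 : ρ t₁ < ρ t₂ := by
    have h1 := List.length_pos_iff.2 (Δ.top_ne_nil t₁)
    have h2 : 0 < (Δ.bot t₂).length := by rw [← D.inner]; exact h1
    exact hρ _ _ _ _ _ _ (D.wires 0 h1 h2)
  let T' := {t // t ≠ t₁ ∧ t ≠ t₂}
  let bot' : T' → List S := fun t => Δ.bot t.1
  let top' : T' → List S := fun t => Δ.top t.1
  let vb : Ends a bot' → Ends a Δ.bot := Ends.map Subtype.val (fun _ => rfl)
  let vt : Ends b top' → Ends b Δ.top := Ends.map Subtype.val (fun _ => rfl)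
  have vbi : Function.Injective vb := map_injective _ Subtype.val_injective
  have vti : Function.Injective vt := map_injective _ Subtype.val_injective
  have vb_ne : ∀ p, (∀ i h, vb p ≠ Sum.inr ⟨t₁, i, h⟩) ∧ ∀ i h, vb p ≠ Sum.inr ⟨t₂, i, h⟩ :=
    fun p => map_val_ne _ p
  have vt_ne : ∀ p, (∀ i h, vt p ≠ Sum.inr ⟨t₁, i, h⟩) ∧ ∀ i h, vt p ≠ Sum.inr ⟨t₂, i, h⟩ :=
    fun p => map_val_ne _ p
  have key : ∀ p : Ends a bot', ∃ (q : Ends b top') (l : K),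
      (∀ i h h', Δ.wire (vb p) = Sum.inr ⟨t₂, i, h⟩ →
        vt q = Δ.wire (Sum.inr ⟨t₁, i, h'⟩) ∧
          l = Δ.label (vb p) * Δ.label (Sum.inr ⟨t₁, i, h'⟩)) ∧
      ((∀ i h, Δ.wire (vb p) ≠ Sum.inr ⟨t₂, i, h⟩) →
        vt q = Δ.wire (vb p) ∧ l = Δ.label (vb p)) := by
    intro p
    by_cases hit : ∃ i h, Δ.wire (vb p) = Sum.inr ⟨t₂, i, h⟩
    · obtain ⟨i, h, hw⟩ := hit
      have h' : i < (Δ.bot t₁).length := by rw [← D.outer]; exact h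
      obtain ⟨q, hq⟩ := exists_map_val Δ.top (t₁ := t₁) (t₂ := t₂)
        (q := Δ.wire (Sum.inr ⟨t₁, i, h'⟩))
        (fun j hj hc => lt_irrefl _ (hρ _ _ _ _ _ _ hc))
        (fun j hj hc => lt_asymm h12 (hρ _ _ _ _ _ _ hc))
      refine ⟨q, Δ.label (vb p) * Δ.label (Sum.inr ⟨t₁, i, h'⟩), ?_,
        fun hc => absurd hw (hc i h)⟩
      intro i' h1 h2 hw'
      rw [hw] at hw'
      obtain rfl : i = i' := congrArg Port.idx (Sum.inr_injective hw')
      exact ⟨hq, rfl⟩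
    · push Not at hit
      obtain ⟨q, hq⟩ := exists_map_val Δ.top (t₁ := t₁) (t₂ := t₂) (q := Δ.wire (vb p))
        (fun j hj hc => by
          have hj' : j < (Δ.bot t₂).length := by rw [← D.inner]; exact hj
          rw [← D.wires j hj hj'] at hc
          exact (vb_ne p).2 _ _ (Δ.wire.injective hc)) hit
      exact ⟨q, Δ.label (vb p), fun i h _ hw => absurd hw (hit i h), fun _ => ⟨hq, rfl⟩⟩
  choose g l hg using key
  have g_inj : Function.Injective g := by
    have aux : ∀ p p' i h, Δ.wire (vb p) = Sum.inr ⟨t₂, i, h⟩ →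
        (∀ i h, Δ.wire (vb p') ≠ Sum.inr ⟨t₂, i, h⟩) → g p ≠ g p' := by
      intro p p' i h hw hw' hc
      have h' : i < (Δ.bot t₁).length := by rw [← D.outer]; exact h
      have h1 := ((hg p).1 i h h' hw).1
      rw [hc, ((hg p').2 hw').1] at h1
      exact (vb_ne p').1 _ _ (Δ.wire.injective h1)
    intro p p' hpp
    by_cases hit : ∃ i h, Δ.wire (vb p) = Sum.inr ⟨t₂, i, h⟩ <;>
      by_cases hit' : ∃ i h, Δ.wire (vb p') = Sum.inr ⟨t₂, i, h⟩
    · obtain ⟨i, h, hw⟩ := hit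
      obtain ⟨i', h', hw'⟩ := hit'
      have k : i < (Δ.bot t₁).length := by rw [← D.outer]; exact h
      have k' : i' < (Δ.bot t₁).length := by rw [← D.outer]; exact h'
      have h1 := ((hg p).1 i h k hw).1
      rw [hpp, ((hg p').1 i' h' k' hw').1] at h1
      obtain rfl : i' = i := congrArg Port.idx (Sum.inr_injective (Δ.wire.injective h1))
      exact vbi (Δ.wire.injective (hw.trans hw'.symm))
    · obtain ⟨i, h, hw⟩ := hit
      push Not at hit'
      exact absurd hpp (aux _ _ _ _ hw hit')
    · obtain ⟨i, h, hw⟩ := hit'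
      push Not at hit
      exact absurd hpp.symm (aux _ _ _ _ hw hit)
    · push Not at hit hit'
      have h1 := ((hg p).2 hit).1
      rw [hpp, ((hg p').2 hit').1] at h1
      exact (vbi (Δ.wire.injective h1)).symm
  have g_surj : Function.Surjective g := by
    intro q
    by_cases hit : ∃ i h, Δ.wire.symm (vt q) = Sum.inr ⟨t₁, i, h⟩
    · obtain ⟨i, h, hw⟩ := hit
      have hw : Δ.wire (Sum.inr ⟨t₁, i, h⟩) = vt q := by rw [← hw, Equiv.apply_symm_apply]
      have h' : i < (Δ.top t₂).length := by rw [D.outer]; exact h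
      obtain ⟨p, hp⟩ := exists_map_val Δ.bot (t₁ := t₁) (t₂ := t₂)
        (q := Δ.wire.symm (Sum.inr ⟨t₂, i, h'⟩))
        (fun j hj hc => lt_asymm h12 (hρ _ _ j hj i h'
          (by rw [← hc, Equiv.apply_symm_apply])))
        (fun j hj hc => lt_irrefl _ (hρ _ _ j hj i h'
          (by rw [← hc, Equiv.apply_symm_apply])))
      have hp : Δ.wire (vb p) = Sum.inr ⟨t₂, i, h'⟩ := by
        show Δ.wire (Ends.map _ _ p) = _
        rw [hp, Equiv.apply_symm_apply]
      exact ⟨p, vti ((((hg p).1 i h' h hp).1).trans hw)⟩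
    · push Not at hit
      obtain ⟨p, hp⟩ := exists_map_val Δ.bot (t₁ := t₁) (t₂ := t₂)
        (q := Δ.wire.symm (vt q)) hit
        (fun j hj hc => by
          have hj' : j < (Δ.top t₁).length := by rw [D.inner]; exact hj
          rw [Equiv.symm_apply_eq, D.wires j hj' hj] at hc
          exact (vt_ne q).1 _ _ hc)
      have hp : Δ.wire (vb p) = vt q := by
        show Δ.wire (Ends.map _ _ p) = _
        rw [hp, Equiv.apply_symm_apply]
      refine ⟨p, vti ((((hg p).2 ?_).1).trans hp)⟩
      intro i h hc
      exact (vt_ne q).2 i h (hp.symm.trans hc)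
  refine ⟨⟨T', inferInstance, top', bot', fun t => Δ.rel t.1, Equiv.ofBijective g ⟨g_inj, g_surj⟩,
    ?_, l, ?_⟩, Subtype.val, fun _ => rfl, fun _ => rfl, Subtype.val_injective, ?_, hg⟩
  · intro p
    show (g p).letter = p.letter
    have e1 : (vt (g p)).letter = (g p).letter := letter_map _ _ _
    have e2 : (vb p).letter = p.letter := letter_map _ _ _
    rw [← e1, ← e2, ← Δ.letter_wire]
    by_cases hit : ∃ i h, Δ.wire (vb p) = Sum.inr ⟨t₂, i, h⟩
    · obtain ⟨i, h, hw⟩ := hit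
      have h' : i < (Δ.bot t₁).length := by rw [← D.outer]; exact h
      rw [((hg p).1 i h h' hw).1, hw, Δ.letter_wire]
      simp only [Ends.letter, Sum.elim_inr, Port.letter, D.outer]
    · push Not at hit
      rw [((hg p).2 hit).1]
  · refine acyclic_of_rank (fun t => ρ t.1) ?_
    rintro x y ⟨i, hi, j, hj, hw⟩
    have hw : g (Sum.inr ⟨y, i, hi⟩) = Sum.inr ⟨x, j, hj⟩ := hw
    by_cases hit : ∃ k h, Δ.wire (Sum.inr ⟨y.1, i, hi⟩) = Sum.inr ⟨t₂, k, h⟩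
    · obtain ⟨k, h, hk⟩ := hit
      have h' : k < (Δ.bot t₁).length := by rw [← D.outer]; exact h
      have h1 := ((hg (Sum.inr ⟨y, i, hi⟩)).1 k h h' hk).1
      rw [hw] at h1
      have r1 := hρ _ _ _ _ _ _ h1.symm
      have r2 := hρ _ _ _ _ _ _ hk
      exact r1.trans (h12.trans r2)
    · push Not at hit
      have h1 := ((hg (Sum.inr ⟨y, i, hi⟩)).2 hit).1
      rw [hw] at h1
      exact hρ _ _ _ _ _ _ h1.symm
  · exact fun t => ⟨fun ⟨s, hs⟩ => hs ▸ s.2, fun h => ⟨⟨t, h⟩, rfl⟩⟩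

theorem card_lt_of_range {Δ Δ' : BraidedDiagram P K a b} {e : Δ'.T → Δ.T} {t₁ t₂ : Δ.T}
    (he : Function.Injective e) (rng : ∀ t, (∃ s, e s = t) ↔ t ≠ t₁ ∧ t ≠ t₂) :
    Nat.card Δ'.T < Nat.card Δ.T := by
  have := Δ.finite
  have := Δ'.finite
  have h2 : t₁ ∉ Set.range e := fun h => ((rng t₁).1 h).1 rfl
  have := Fintype.ofFinite Δ.T
  have := Fintype.ofFinite Δ'.T
  rw [Nat.card_eq_fintype_card, Nat.card_eq_fintype_card]
  exact Fintype.card_lt_of_injective_of_notMem e he h2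

/-- Every diagram is equal modulo dipoles to a reduced diagram. -/
theorem exists_isReduced (Δ : BraidedDiagram P K a b) :
    ∃ Δ', IsReduced Δ' ∧ modDipoles P K a b Δ Δ' := by
  induction hn : Nat.card Δ.T using Nat.strong_induction_on generalizing Δ with
  | _ n ih =>
    by_cases h : IsReduced Δ
    · exact ⟨Δ, h, .refl _⟩
    · unfold IsReduced at h
      push Not at h
      obtain ⟨t₁, t₂, D⟩ := h
      obtain ⟨Δ', e, ht, hb, inj, rng, H⟩ := exists_step Δ D
      obtain ⟨Δ'', h1, h2⟩ := ih _ (hn ▸ card_lt_of_range inj rng) Δ' rfl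
      exact ⟨Δ'', h1, .trans _ _ _ (.rel _ _ (Or.inr ⟨t₁, t₂, D, e, ht, hb, inj, rng, H⟩)) h2⟩

end reduction

/-! ### Inverses -/

section inverses

variable [Group K] {a b : List S}

/-- `U` holds at the transistor carrying the given endpoint, if any. -/
def Ends.All {T : Type} {f : T → List S} (U : T → Prop) (p : Ends a f) : Prop :=
  ∀ t i h, p = Sum.inr ⟨t, i, h⟩ → U t

/-- A diagram which is symmetric under an up-down reflection `σ` exchanging the set `U` of its
upper transistors with its complement. -/
structure IsDouble (E : BraidedDiagram P K a a) (σ : E.T → E.T) (U : E.T → Prop) : Prop where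
  invol : ∀ t, σ (σ t) = t
  up_iff : ∀ t, U (σ t) ↔ ¬ U t
  top_eq : ∀ t, E.top (σ t) = E.bot t
  bot_eq : ∀ t, E.bot (σ t) = E.top t
  mirror : ∀ p, E.wire (Ends.map σ bot_eq (E.wire p)) = Ends.map σ top_eq p ∧
    E.label (Ends.map σ bot_eq (E.wire p)) = (E.label p)⁻¹
  cross : ∀ p, Ends.All U p → Ends.All (fun t => ¬ U t) (E.wire p) →
    E.wire p = Ends.map σ top_eq p ∧ E.label p = 1
  low : ∀ t i h, ¬ U t → Ends.All (fun t => ¬ U t) (E.wire (Sum.inr ⟨t, i, h⟩))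

theorem IsDouble.trivial {E : BraidedDiagram P K a a} {σ : E.T → E.T} {U : E.T → Prop}
    (hE : IsDouble E σ U) : modDipoles P K a a E (trivial a) := by
  induction hn : Nat.card E.T using Nat.strong_induction_on generalizing E with
  | _ n ih =>
  have := E.finite
  obtain ⟨invol, up_iff, top_eq, bot_eq, mirror, cross, low⟩ := hE
  rcases isEmpty_or_nonempty E.T with hemp | ⟨⟨t₀⟩⟩
  · refine .rel _ _ (Or.inl ⟨Equiv.equivOfIsEmpty _ _, hemp.elim, hemp.elim, ?_⟩)
    rintro (i | p)
    · obtain ⟨h1, h2⟩ := cross (Sum.inl i) (fun t => hemp.elim t) (fun t => hemp.elim t)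
      rw [h1, h2]
      exact ⟨rfl, rfl⟩
    · exact hemp.elim p.node
  obtain ⟨ρ, hρ⟩ := exists_rank E.acyclic
  obtain ⟨t, htU, htmin⟩ : ∃ t, U t ∧ ∀ t', U t' → ¬ ρ t' < ρ t := by
    have hne : {t | U t}.Nonempty := by
      by_cases h : U t₀
      · exact ⟨t₀, h⟩
      · exact ⟨σ t₀, (up_iff t₀).2 h⟩
    obtain ⟨t, h1, h2⟩ := (measure ρ).wf.has_min {t | U t} hne
    exact ⟨t, h1, h2⟩
  have hcross : ∀ i h, E.wire (Sum.inr ⟨t, i, h⟩) = Ends.map σ top_eq (Sum.inr ⟨t, i, h⟩) ∧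
      E.label (Sum.inr ⟨t, i, h⟩) = 1 := by
    intro i h
    refine cross _ ?_ ?_
    · intro t' j hj he
      have : t = t' := congrArg Port.node (Sum.inr_injective he)
      exact this ▸ htU
    · intro t' j hj he hU
      exact htmin t' hU (hρ _ _ ⟨i, h, j, hj, he⟩)
  have D : E.IsDipole (σ t) t :=
    ⟨top_eq t, (bot_eq t).symm, fun i h₁ h₂ => (hcross i h₂).1, fun i h₂ => (hcross i h₂).2⟩
  obtain ⟨E', e, ht, hb, inj, rng, H⟩ := exists_step E D
  refine .trans _ _ _ (.rel _ _ (Or.inr ⟨_, _, D, e, ht, hb, inj, rng, H⟩)) ?_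
  have hσ : ∀ s, ∃ s', e s' = σ (e s) := by
    intro s
    obtain ⟨h1, h2⟩ := (rng (e s)).1 ⟨s, rfl⟩
    refine (rng _).2 ⟨fun h => h2 ?_, fun h => h1 ?_⟩
    · rw [← invol (e s), h, invol]
    · rw [← h, invol]
  choose σ' hσ' using hσ
  have top_eq' : ∀ s, E'.top (σ' s) = E'.bot s := fun s => by
    rw [← ht, hσ', top_eq, hb]
  have bot_eq' : ∀ s, E'.bot (σ' s) = E'.top s := fun s => by
    rw [← hb, hσ', bot_eq, ht]
  have m1 : ∀ x : Ends a E'.top, Ends.map e hb (Ends.map σ' bot_eq' x) =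
      Ends.map σ bot_eq (Ends.map e ht x) := by
    rintro (i | ⟨s, i, h⟩)
    · rfl
    · exact congrArg Sum.inr (Port.ext (hσ' s) rfl)
  have m2 : ∀ x : Ends a E'.bot, Ends.map e ht (Ends.map σ' top_eq' x) =
      Ends.map σ top_eq (Ends.map e hb x) := by
    rintro (i | ⟨s, i, h⟩)
    · rfl
    · exact congrArg Sum.inr (Port.ext (hσ' s) rfl)
  have m3 : ∀ x : Ends a E.bot, Ends.map σ bot_eq (Ends.map σ top_eq x) = x := by
    rintro (i | ⟨s, i, h⟩)
    · rfl
    · exact congrArg Sum.inr (Port.ext (invol s) rfl)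
  have ie := map_injective (a := a) ht inj
  have ib := map_injective (a := a) hb inj
  have eb : ∀ (x : Ends a E'.bot) i h, Ends.map e hb x ≠ Sum.inr ⟨σ t, i, h⟩ := by
    rintro (j | ⟨s, j, hj⟩) i h hc
    · exact Sum.inl_ne_inr hc
    · exact ((rng (e s)).1 ⟨s, rfl⟩).1 (congrArg Port.node (Sum.inr_injective hc))
  have all_b : ∀ (x : Ends a E'.bot) (V : E.T → Prop), Ends.All (fun s => V (e s)) x →
      Ends.All V (Ends.map e hb x) := by
    rintro (j | ⟨s, j, hj⟩) V hV t i h hc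
    · exact absurd hc Sum.inl_ne_inr
    · have : e s = t := congrArg Port.node (Sum.inr_injective hc)
      exact this ▸ hV s j hj rfl
  have all_t : ∀ (x : Ends a E'.top) (V : E.T → Prop), Ends.All (fun s => V (e s)) x ↔
      Ends.All V (Ends.map e ht x) := by
    rintro (j | ⟨s, j, hj⟩) V
    · exact ⟨fun _ t i h hc => absurd hc Sum.inl_ne_inr, fun _ t i h hc => absurd hc Sum.inl_ne_inr⟩
    · constructor
      · intro hV t i h hc
        have : e s = t := congrArg Port.node (Sum.inr_injective hc)
        exact this ▸ hV s j hj rfl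
      · intro hV s' i h hc
        have : s = s' := congrArg Port.node (Sum.inr_injective hc)
        subst this
        exact hV (e s) j (by rw [ht]; exact hj) rfl
  have hit_spec : ∀ (p : Ends a E'.bot) i h, E.wire (Ends.map e hb p) = Sum.inr ⟨t, i, h⟩ →
      Ends.map e ht (E'.wire p) = Ends.map σ top_eq (Ends.map e hb p) ∧ E'.label p = 1 := by
    intro p i h hw
    have h' : i < (E.bot (σ t)).length := by rw [bot_eq]; exact h
    obtain ⟨h1, h2⟩ := (H p).1 i h h' hw
    obtain ⟨h3, h4⟩ := mirror (Ends.map e hb p)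
    rw [hw] at h3 h4
    have h3 : E.wire (Sum.inr ⟨σ t, i, h'⟩) = _ := h3
    have h4 : E.label (Sum.inr ⟨σ t, i, h'⟩) = _ := h4
    rw [h1, h2, h3, h4]
    exact ⟨rfl, mul_inv_cancel _⟩
  refine ih _ (hn ▸ card_lt_of_range inj rng) (E := E') (σ := σ') (U := fun s => U (e s))
    ⟨?_, ?_, top_eq', bot_eq', ?_, ?_, ?_⟩ rfl
  · intro s
    exact inj (by rw [hσ', hσ', invol])
  · intro s
    show U (e (σ' s)) ↔ _
    rw [hσ', up_iff]
  · intro p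
    by_cases hit : ∃ i h, E.wire (Ends.map e hb p) = Sum.inr ⟨t, i, h⟩
    · obtain ⟨i, h, hw⟩ := hit
      obtain ⟨h1, h2⟩ := hit_spec p i h hw
      have h3 : Ends.map σ' bot_eq' (E'.wire p) = p := by
        apply ib
        rw [m1, h1, m3]
      rw [h3, h2, inv_one]
      refine ⟨ie ?_, rfl⟩
      rw [h1, m2]
    · push Not at hit
      obtain ⟨h1, h2⟩ := (H p).2 hit
      obtain ⟨h3, h4⟩ := mirror (Ends.map e hb p)
      obtain ⟨h5, h6⟩ := (H (Ends.map σ' bot_eq' (E'.wire p))).2 (by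
        intro i h hc
        rw [m1, h1, h3] at hc
        have h' : i < (E.bot (σ t)).length := by rw [bot_eq]; exact h
        refine eb p i h' ?_
        rw [← m3 (Ends.map e hb p), hc]
        rfl)
      rw [m1, h1] at h5 h6
      refine ⟨ie ?_, ?_⟩
      · rw [h5, h3, m2]
      · rw [h6, h4, h2]
  · intro p hp hw
    by_cases hit : ∃ i h, E.wire (Ends.map e hb p) = Sum.inr ⟨t, i, h⟩
    · obtain ⟨i, h, hwt⟩ := hit
      obtain ⟨h1, h2⟩ := hit_spec p i h hwt
      exact ⟨ie (by rw [h1, m2]), h2⟩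
    · push Not at hit
      obtain ⟨h1, h2⟩ := (H p).2 hit
      have hw' := (all_t _ (fun t => ¬ U t)).1 hw
      rw [h1] at hw'
      obtain ⟨h3, h4⟩ := cross _ (all_b p U hp) hw'
      refine ⟨ie ?_, by rw [h2, h4]⟩
      rw [h1, h3, m2]
  · intro s i h hs
    refine (all_t _ (fun t => ¬ U t)).2 ?_
    have hl := low (e s) i (by rw [hb]; exact h) hs
    by_cases hit : ∃ j hj, E.wire (Ends.map e hb (Sum.inr ⟨s, i, h⟩)) = Sum.inr ⟨t, j, hj⟩
    · obtain ⟨j, hj, hw⟩ := hit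
      exact absurd htU (hl t j hj hw)
    · push Not at hit
      rw [((H _).2 hit).1]
      exact hl

theorem comp_inverse (Δ : BraidedDiagram P K a b) :
    modDipoles P K a a (comp Δ (inverse Δ)) (trivial a) := by
  have hb : ∀ t, (comp Δ (inverse Δ)).bot (Sum.swap t) = (comp Δ (inverse Δ)).top t := by
    rintro (t | t) <;> rfl
  have ht : ∀ t, (comp Δ (inverse Δ)).top (Sum.swap t) = (comp Δ (inverse Δ)).bot t := by
    rintro (t | t) <;> rfl
  have n1 : ∀ p, Ends.map (f' := (comp Δ (inverse Δ)).bot) Sum.swap hb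
      (loI Δ (inverse Δ) p) = upO Δ (inverse Δ) p := by
    rintro (i | p) <;> rfl
  have n2 : ∀ p, Ends.map (f' := (comp Δ (inverse Δ)).top) Sum.swap ht
      (upO Δ (inverse Δ) p) = loI Δ (inverse Δ) p := by
    rintro (i | p) <;> rfl
  have n3 : ∀ q, Ends.map (f' := (comp Δ (inverse Δ)).bot) Sum.swap hb
      (upI Δ (inverse Δ) q) = loO Δ (inverse Δ) q := fun _ => rfl
  have n4 : ∀ q, Ends.map (f' := (comp Δ (inverse Δ)).top) Sum.swap ht
      (loO Δ (inverse Δ) q) = upI Δ (inverse Δ) q := fun _ => rfl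
  have s1 : ∀ p y, Δ.wire p = y → (inverse Δ).wire y = p ∧
      (inverse Δ).label y = (Δ.label p)⁻¹ := by
    rintro p y rfl
    simp [inverse]
  have hlow : ∀ x, Ends.All (fun t => ¬ (Sum.isLeft t = true)) (loI Δ (inverse Δ) x) := by
    rintro (i | q) t j h hc
    · exact absurd hc Sum.inl_ne_inr
    · have : Sum.inr q.node = t := congrArg Port.node (Sum.inr_injective hc)
      simp [← this]
  refine IsDouble.trivial (σ := Sum.swap) (U := fun t => Sum.isLeft t = true)
    ⟨Sum.swap_swap, ?_, ht, hb, ?_, ?_, ?_⟩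
  · rintro (t | t) <;> simp
  · intro p
    induction p using comp_cases with
    | h1 p =>
      rcases hq : Δ.wire p with i | q
      · obtain ⟨h1, h2⟩ := s1 p _ hq
        rw [wire_upO_inl _ _ hq, h1, n1, n2, wire_upO_inl _ _ hq, h1, label_upO_inl _ _ hq, h2]
        simp
      · obtain ⟨h1, h2⟩ := s1 p _ hq
        rw [wire_upO_inr _ _ hq, n3, n2, wire_loO, h1, label_upO_inr _ _ hq, label_loO, h2]
        exact ⟨rfl, rfl⟩
    | h2 q =>
      have hq : Δ.wire (Δ.wire.symm (Sum.inr q)) = Sum.inr q := Equiv.apply_symm_apply _ _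
      obtain ⟨h1, h2⟩ := s1 _ _ hq
      rw [wire_loO, label_loO, h1, h2, n1, n4, wire_upO_inr _ _ hq, label_upO_inr _ _ hq]
      exact ⟨rfl, (inv_inv _).symm⟩
  · intro p hp hw
    induction p using comp_cases with
    | h1 p =>
      rcases hq : Δ.wire p with i | q
      · obtain ⟨h1, h2⟩ := s1 p _ hq
        rw [wire_upO_inl _ _ hq, h1, n2, label_upO_inl _ _ hq, h2]
        simp
      · rw [wire_upO_inr _ _ hq] at hw
        exact absurd rfl (hw (Sum.inl q.node) q.idx q.lt rfl)
    | h2 q =>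
      exact absurd (hp (Sum.inr q.node) q.idx q.lt rfl) (by simp)
  · rintro (t | t) i h hU
    · exact absurd rfl hU
    · have h' : i < ((inverse Δ).bot t).length := h
      have := wire_loO Δ (inverse Δ) ⟨t, i, h'⟩
      have h2 := hlow ((inverse Δ).wire (Sum.inr ⟨t, i, h'⟩))
      rw [← this] at h2
      exact h2

end inverses

end BraidedDiagram

/-- The set of braided `(w, w)`-diagrams over `P` with second labels in the group `K`, modulo
dipoles: the braided picture product `D_b(P, 𝒢, w)` where all the groups of `𝒢` are `K`. -/
def BraidedPictureProduct {S : Type u} (P : SemigroupPresentation S) (K : Type v) [Group K]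
    (w : List S) : Type (max u v 1) :=
  Quotient (BraidedDiagram.modDipoles P K w w)

namespace BraidedPictureProduct

open BraidedDiagram

variable {S : Type u} {P : SemigroupPresentation S} {K : Type v} [Group K] {w : List S}

/-- The class of a diagram modulo dipoles. -/
def mk (Δ : BraidedDiagram P K w w) : BraidedPictureProduct P K w := Quotient.mk _ Δ

/-- The product is the concatenation. -/
instance : Mul (BraidedPictureProduct P K w) :=
  ⟨Quotient.map₂ comp fun _ _ h₁ _ _ h₂ => modDipoles_comp h₁ h₂⟩

instance : One (BraidedPictureProduct P K w) := ⟨mk (trivial w)⟩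

theorem mk_mul (Δ₁ Δ₂ : BraidedDiagram P K w w) : mk Δ₁ * mk Δ₂ = mk (comp Δ₁ Δ₂) := rfl

theorem mk_eq_of_iso {Δ₁ Δ₂ : BraidedDiagram P K w w} (h : Iso Δ₁ Δ₂) : mk Δ₁ = mk Δ₂ :=
  Quotient.sound (.rel _ _ (Or.inl h))

theorem mk_mul_inverse (Δ : BraidedDiagram P K w w) : mk Δ * mk (inverse Δ) = 1 :=
  Quotient.sound (comp_inverse Δ)

instance : Monoid (BraidedPictureProduct P K w) where
  mul_assoc := by
    rintro ⟨Δ₁⟩ ⟨Δ₂⟩ ⟨Δ₃⟩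
    exact mk_eq_of_iso (comp_assoc Δ₁ Δ₂ Δ₃)
  one_mul := by
    rintro ⟨Δ⟩
    exact mk_eq_of_iso (trivial_comp Δ)
  mul_one := by
    rintro ⟨Δ⟩
    exact mk_eq_of_iso (comp_trivial Δ)

theorem inverse_mul_mk (Δ : BraidedDiagram P K w w) : mk (inverse Δ) * mk Δ = 1 := by
  have h := mk_mul_inverse (inverse Δ)
  have h2 := mk_mul_inverse Δ
  have : mk Δ = mk (inverse (inverse Δ)) := by
    rw [← mul_one (mk Δ), ← h, ← mul_assoc, h2, one_mul]
  rw [this, h]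

/-- Inverses are given by turning diagrams upside down. -/
instance : Inv (BraidedPictureProduct P K w) :=
  ⟨Quotient.lift (fun Δ => mk (inverse Δ)) (by
    intro Δ Δ' h
    have h : mk Δ = mk Δ' := Quotient.sound h
    show mk (inverse Δ) = mk (inverse Δ')
    rw [← mul_one (mk (inverse Δ)), ← mk_mul_inverse Δ', ← h, ← mul_assoc, inverse_mul_mk,
      one_mul])⟩

instance : Group (BraidedPictureProduct P K w) where
  inv_mul_cancel := by
    rintro ⟨Δ⟩
    exact inverse_mul_mk Δ

end BraidedPictureProduct

/-- The braided diagram group `D_b(P, w)`: braided `(w, w)`-diagrams over `P` modulo dipoles, with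
concatenation. Wires carry only a letter, i.e. the second labels are in the trivial group. -/
abbrev BraidedDiagramGroup {S : Type u} (P : SemigroupPresentation S) (w : List S) :
    Type (max u 1) :=
  BraidedPictureProduct P PUnit.{1} w

/-- The presentation `⟨x ∣ x = x²⟩`. -/
def thompsonPresentation : SemigroupPresentation Unit where
  rels := {([()], [(), ()])}
  ne_nil := by
    rintro _ rfl
    simp
  asymm := by
    intro a b h h'
    simp only [Set.mem_singleton_iff, Prod.mk.injEq] at h h'
    exact absurd (h.1.symm.trans h'.2) (by simp)

/-- The braided picture product `D_b(⟨x ∣ x = x²⟩, {F(A)}, x)`, where `F(A)` is the free group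
with free basis `A`. If `A` has cardinality `α`, this is `𝒱_α`. -/
abbrev UniversalPictureProduct (A : Type v) : Type (max v 1) :=
  BraidedPictureProduct thompsonPresentation (FreeGroup A) [()]

/-- The diagram length on `D_b(P, w)`: the number of transistors of the reduced diagram
representing `g` (which exists and is unique up to equivalence). -/
noncomputable def BraidedDiagramGroup.diagramLength {S : Type u} {P : SemigroupPresentation S}
    {w : List S} (g : BraidedDiagramGroup P w) : ℕ :=
  sInf {n | ∃ Δ : BraidedDiagram P PUnit.{1} w w, Δ.IsReduced ∧ BraidedPictureProduct.mk Δ = g ∧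
    Nat.card Δ.T = n}

open Classical in
/-- The diagram length on `𝒱_α`: the number of transistors of the reduced diagram representing `g`
(which exists and is unique up to equivalence) plus the sum of the lengths, with respect to the
free basis `A`, of the elements of `F(A)` labelling its wires. -/
noncomputable def UniversalPictureProduct.diagramLength {A : Type v}
    (g : UniversalPictureProduct A) : ℕ :=
  sInf {n | ∃ Δ : BraidedDiagram thompsonPresentation (FreeGroup A) [()] [()], Δ.IsReduced ∧
    BraidedPictureProduct.mk Δ = g ∧ Nat.card Δ.T + ∑ᶠ p, (Δ.label p).norm = n}

/-! A diagram is read as a circuit: values enter along the top of the frame, transistors transform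
them, and labels act on them along the wires. When opposite transistors act by inverse maps, the
resulting map depends only on the class modulo dipoles (`sem_eq_of_modDipoles`), and concatenation
becomes composition (`sem_comp`).

The values are elements of the free algebra on one generator with a bijective pairing, whose inverse
is given by two projections, and with one invertible unary operation for each element of `A`. They
are represented by normal forms (`NormalTerm`). A diagram over ⟨x ∣ x = x²⟩ acts by splitting values
into their projections, pairing values, and applying letters. In a reduced diagram fed with the
variable nothing cancels across a transistor, because a cancellation would exhibit a dipole
(`IsVal.formal`). Hence an element of 𝒱_α is determined by its value at the variable
(`eq_of_eval_var`).

A diagram over `P` acts on the same values: a transistor from u to v merges its inputs into one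
value, applies the letter attached to its relation (inverted for the opposite orientation), and
splits the result. Φ(g) is the element of 𝒱_α which splits one value into |w| values, acts as g, and
merges again (`Encodes`). Faithfulness makes it unique, so Φ is well defined and multiplicative
without any inspection of reductions. It exists because the circuit can be redrawn with binary
transistors and labels (`exists_realizes`), at a cost of at most |u| + |v| for each transistor; this
is the upper bound for the length.

The lower bound and injectivity come from the traces left by letters. In a reduced diagram over `P`,
different transistors create different terms beginning with a letter, and each of them survives as a
subterm of the output (`IsReduced.exists_labSubs`). A diagram over ⟨x ∣ x = x²⟩ creates at most one
such subterm for each letter of its labels (`card_le_cost_of_labSubs`). Hence |g| ≤ |Φ(g)|. If Φ(g)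
= 1, the output contains no letters, so the reduced diagram of g has no transistors, and comparison
of the outputs shows that its wires are not permuted. When the letters of w are distinct, only the
identity has length 0, and the additive constant can be absorbed. -/

/-- An interpretation of the relations of `P` and of the group `K` of second labels in a type `N`:
transistors act on lists of elements of `N`, opposite transistors act as inverse maps, and `K` acts
on `N` from the right. -/
structure WireAlgebra {S : Type*} (P : SemigroupPresentation S) (K : Type*) [Group K]
    (N : Type*) where
  op : List S → List S → List N → List N
  act : K → N → N
  length_op : ∀ u v, (u, v) ∈ P.rels ∨ (v, u) ∈ P.rels → ∀ L, L.length = u.length →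
    (op u v L).length = v.length
  op_op : ∀ u v, (u, v) ∈ P.rels ∨ (v, u) ∈ P.rels → ∀ L, L.length = u.length →
    op v u (op u v L) = L
  act_one : ∀ n, act 1 n = n
  act_mul : ∀ k l n, act (k * l) n = act l (act k n)

/-! ### Semantics of diagrams in a wire algebra -/

namespace BraidedDiagram

/-- The list of the values of `g` along one side of the transistor `t`. -/
def sideList {S N : Type*} {T : Type} (f : T → List S) (g : Port f → N) (t : T) : List N :=
  List.ofFn fun i : Fin (f t).length => g ⟨t, i, i.2⟩

section sideList

variable {S N : Type*} {T T' : Type} {f : T → List S} {f' : T' → List S}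

@[simp] theorem length_sideList (g : Port f → N) (t : T) :
    (sideList f g t).length = (f t).length := by
  simp [sideList]

@[simp] theorem getElem_sideList (g : Port f → N) (t : T) (i : ℕ)
    (h : i < (sideList f g t).length) :
    (sideList f g t)[i] = g ⟨t, i, by simpa using h⟩ := by
  simp [sideList]

theorem sideList_congr {g g' : Port f → N} {t : T} (h : ∀ q : Port f, q.node = t → g q = g' q) :
    sideList f g t = sideList f g' t := by
  refine List.ext_getElem (by simp) fun i h₁ h₂ => ?_
  simp only [getElem_sideList]
  exact h _ rfl

theorem sideList_apply (e : T → T') (h : ∀ t, f' (e t) = f t) (g : Port f' → N) (t : T) :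
    sideList f' g (e t) = sideList f (fun q => g (q.map e h)) t :=
  List.ext_getElem (by simp [h]) fun i h₁ h₂ => by simp [Port.map]

end sideList

variable {S : Type*} {P : SemigroupPresentation S} {K : Type*} {a b c : List S}

/-- A depth function for the transistors of a diagram. -/
theorem exists_depth (Δ : BraidedDiagram P K a b) : ∃ δ : Δ.T → ℕ, ∀ (q : Port Δ.bot)
    (r : Port Δ.top), Δ.wire (Sum.inr q) = Sum.inr r → δ q.node < δ r.node := by
  have := Δ.finite
  obtain ⟨ρ, h⟩ := exists_rank Δ.acyclic
  obtain ⟨M, hM⟩ := exists_bound ρ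
  -- The rank ρ increases towards the top of the diagram, so it is reversed inside an upper bound M.
  refine ⟨fun t => M - ρ t, fun q r hq => ?_⟩
  have h1 := h r.node q.node ⟨q.idx, q.lt, r.idx, r.lt, hq⟩
  have h2 := hM q.node
  show M - ρ _ < M - ρ _
  omega

/-- Induction on the transistors of a diagram, from top to bottom. -/
theorem node_induction (Δ : BraidedDiagram P K a b) {motive : Δ.T → Prop}
    (h : ∀ t, (∀ (q : Port Δ.bot) (r : Port Δ.top), Δ.wire (Sum.inr q) = Sum.inr r →
      r.node = t → motive q.node) → motive t) (t : Δ.T) : motive t := by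
  obtain ⟨δ, hδ⟩ := exists_depth Δ
  induction hn : δ t using Nat.strong_induction_on generalizing t with
  | _ n ih =>
    refine h t fun q r hq hr => ih (δ q.node) ?_ _ rfl
    have := hδ q r hq
    rw [hr] at this
    omega

/-- Induction on the transistors of a diagram, from bottom to top. -/
theorem node_induction_up (Δ : BraidedDiagram P K a b) {motive : Δ.T → Prop}
    (h : ∀ t, (∀ (q : Port Δ.bot) (r : Port Δ.top), Δ.wire (Sum.inr q) = Sum.inr r →
      q.node = t → motive r.node) → motive t) (t : Δ.T) : motive t := by
  have := Δ.finite
  obtain ⟨ρ, hρ⟩ := exists_rank Δ.acyclic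
  induction hn : ρ t using Nat.strong_induction_on generalizing t with
  | _ n ih =>
    refine h t fun q r hq hr => ih (ρ r.node) ?_ _ rfl
    have := hρ r.node q.node ⟨q.idx, q.lt, r.idx, r.lt, hq⟩
    rw [hr] at this
    omega

variable [Group K] {N : Type*} (𝔄 : WireAlgebra P K N)

/-- The values at the bottom endpoints of the wires, given the values at the top endpoints. -/
def lower (Δ : BraidedDiagram P K a b) (val : Ends a Δ.bot → N) (q : Ends b Δ.top) : N :=
  𝔄.act (Δ.label (Δ.wire.symm q)) (val (Δ.wire.symm q))

theorem lower_wire (Δ : BraidedDiagram P K a b) (val : Ends a Δ.bot → N) (p : Ends a Δ.bot) :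
    lower 𝔄 Δ val (Δ.wire p) = 𝔄.act (Δ.label p) (val p) := by
  simp [lower]

/-- The values on the top side of the transistor `t`. -/
def inputs (Δ : BraidedDiagram P K a b) (val : Ends a Δ.bot → N) (t : Δ.T) : List N :=
  sideList Δ.top (fun q => lower 𝔄 Δ val (Sum.inr q)) t

/-- The values on the bottom side of the transistor `t`. -/
def outputs (Δ : BraidedDiagram P K a b) (val : Ends a Δ.bot → N) (t : Δ.T) : List N :=
  sideList Δ.bot (fun q => val (Sum.inr q)) t

/-- The values on the bottom side of the frame. -/
def frameOutput (Δ : BraidedDiagram P K a b) (val : Ends a Δ.bot → N) : List N :=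
  List.ofFn fun i => lower 𝔄 Δ val (Sum.inl i)

@[simp] theorem length_inputs (Δ : BraidedDiagram P K a b) (val : Ends a Δ.bot → N) (t : Δ.T) :
    (inputs 𝔄 Δ val t).length = (Δ.top t).length := length_sideList _ _

/-- `val` is the valuation of the wires of `Δ` (at their top endpoints) with the values `L` on the
top side of the frame. -/
structure IsVal (Δ : BraidedDiagram P K a b) (L : List N) (val : Ends a Δ.bot → N) : Prop where
  frame : List.ofFn (fun i => val (Sum.inl i)) = L
  node : ∀ t, outputs Δ val t = 𝔄.op (Δ.top t) (Δ.bot t) (inputs 𝔄 Δ val t)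

variable {𝔄}

theorem IsVal.length {Δ : BraidedDiagram P K a b} {L : List N} {val : Ends a Δ.bot → N}
    (h : IsVal 𝔄 Δ L val) : L.length = a.length := by
  simp [← h.frame]

theorem IsVal.val_inl {Δ : BraidedDiagram P K a b} {L : List N} {val : Ends a Δ.bot → N}
    (h : IsVal 𝔄 Δ L val) (i : Fin a.length) :
    val (Sum.inl i) = L[i.1]'(i.2.trans_eq h.length.symm) := by
  obtain ⟨rfl, -⟩ := h
  simp

/-- Induction from top to bottom: the inputs of a transistor come from the frame or from transistors
above it. -/
theorem IsVal.unique {Δ : BraidedDiagram P K a b} {L : List N} {val val' : Ends a Δ.bot → N}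
    (h : IsVal 𝔄 Δ L val) (h' : IsVal 𝔄 Δ L val') : val = val' := by
  have hf : ∀ i, val (Sum.inl i) = val' (Sum.inl i) := fun i => by
    rw [h.val_inl, h'.val_inl]
  have hn : ∀ t, outputs Δ val t = outputs Δ val' t := by
    intro t
    induction t using node_induction Δ with
    | h t ih =>
      rw [h.node, h'.node]
      congr 1
      refine sideList_congr fun r hr => ?_
      simp only [lower]
      congr 1
      rcases hq : Δ.wire.symm (Sum.inr r) with i | q
      · exact hf i
      · have := ih q r (by rw [← hq, Equiv.apply_symm_apply]) hr
        have := List.getElem_of_eq this (i := q.idx) (by simpa [outputs] using q.lt)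
        simpa [outputs] using this
  funext p
  rcases p with i | q
  · exact hf i
  · have := List.getElem_of_eq (hn q.node) (i := q.idx) (by simpa [outputs] using q.lt)
    simpa [outputs] using this

variable (𝔄) in
/-- One step of the computation of a valuation. -/
def nextVal (Δ : BraidedDiagram P K a b) (L : List N) (hL : L.length = a.length)
    (val : Ends a Δ.bot → N) : Ends a Δ.bot → N
  | Sum.inl i => L[i.1]'(i.2.trans_eq hL.symm)
  | Sum.inr q => (𝔄.op (Δ.top q.node) (Δ.bot q.node) (inputs 𝔄 Δ val q.node))[q.idx]'(by
      rw [𝔄.length_op _ _ (Δ.rel _) _ (length_inputs _ _ _ _)]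
      exact q.lt)

theorem isVal_of_nextVal_eq {Δ : BraidedDiagram P K a b} {L : List N} {hL : L.length = a.length}
    {val : Ends a Δ.bot → N} (h : nextVal 𝔄 Δ L hL val = val) : IsVal 𝔄 Δ L val := by
  constructor
  · refine List.ext_getElem (by simp [hL]) fun i h₁ h₂ => ?_
    rw [List.getElem_ofFn]
    exact (congrFun h _).symm
  · intro t
    refine List.ext_getElem ?_ fun i h₁ h₂ => ?_
    · rw [𝔄.length_op _ _ (Δ.rel _) _ (length_inputs _ _ _ _)]
      simp [outputs]
    · simp only [outputs, getElem_sideList]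
      exact (congrFun h _).symm

-- Iterating `nextVal` from a constant reaches a fixed point: the value on a wire is settled after a
-- number of steps controlled by the depth of its top endpoint.
variable (𝔄) in
theorem exists_isVal (Δ : BraidedDiagram P K a b) {L : List N} (hL : L.length = a.length) :
    ∃ val, IsVal 𝔄 Δ L val := by
  have := Δ.finite
  -- An empty N offers no starting value, but then there is no wire: followed upwards, a wire leads
  -- to the top of the frame, where L would supply an element of N.
  rcases isEmpty_or_nonempty N with hN | ⟨⟨n₀⟩⟩
  · have e : ∀ p : Ends a Δ.bot, False := by
      have hn : ∀ t : Δ.T, False := by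
        intro t
        induction t using node_induction Δ with
        | h t ih =>
          have h0 := List.length_pos_iff.2 (Δ.top_ne_nil t)
          rcases hq : Δ.wire.symm (Sum.inr ⟨t, 0, h0⟩) with i | q
          · exact hN.false (L[i.1]'(i.2.trans_eq hL.symm))
          · exact ih q _ (by rw [← hq, Equiv.apply_symm_apply]) rfl
      rintro (i | q)
      · exact hN.false (L[i.1]'(i.2.trans_eq hL.symm))
      · exact hn q.node
    exact ⟨fun p => (e p).elim, isVal_of_nextVal_eq (hL := hL) (funext fun p => (e p).elim)⟩
  obtain ⟨δ, hδ⟩ := exists_depth Δ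
  obtain ⟨M, hM⟩ := exists_bound δ
  let F := nextVal 𝔄 Δ L hL
  let dE : Ends a Δ.bot → ℕ := Sum.elim (fun _ => 0) (fun q => δ q.node + 1)
  have key : ∀ n p, dE p < n → F^[n + 1] (fun _ => n₀) p = F^[n] (fun _ => n₀) p := by
    intro n
    induction n with
    | zero => intro p hp; omega
    | succ n ih =>
      intro p hp
      rw [Function.iterate_succ_apply' F (n + 1), Function.iterate_succ_apply' F n]
      rcases p with i | q
      · rfl
      · have : inputs 𝔄 Δ (F (F^[n] fun _ => n₀)) q.node =
            inputs 𝔄 Δ (F^[n] fun _ => n₀) q.node := by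
          refine sideList_congr fun r hr => ?_
          simp only [lower]
          congr 1
          rw [← Function.iterate_succ_apply' F n]
          refine ih _ ?_
          have hp : δ q.node + 1 < n + 1 := hp
          rcases hq : Δ.wire.symm (Sum.inr r) with i | q'
          · show 0 < n
            omega
          · have := hδ q' r (by rw [← hq, Equiv.apply_symm_apply])
            rw [hr] at this
            show δ q'.node + 1 < n
            omega
        exact List.getElem_of_eq (congrArg (𝔄.op (Δ.top q.node) (Δ.bot q.node)) this) _
  -- The depth `dE` is at most M + 1, so every wire is stationary after M + 2 iterations.
  refine ⟨F^[M + 2] (fun _ => n₀), isVal_of_nextVal_eq (hL := hL) (funext fun p => ?_)⟩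
  show F (F^[M + 2] _) p = _
  rw [← Function.iterate_succ_apply' F]
  refine key _ _ ?_
  rcases p with i | q
  · show 0 < _
    omega
  · have := hM q.node
    show δ q.node + 1 < _
    omega

variable (𝔄)

open Classical in
/-- The map on lists of values defined by a diagram. -/
noncomputable def sem (Δ : BraidedDiagram P K a b) (L : List N) : List N :=
  -- The default on lists of the wrong length is common to all diagrams, so that equality modulo
  -- dipoles gives equality of functions.
  if h : L.length = a.length then frameOutput 𝔄 Δ (exists_isVal 𝔄 Δ h).choose else []

variable {𝔄}

theorem IsVal.sem_eq {Δ : BraidedDiagram P K a b} {L : List N} {val : Ends a Δ.bot → N}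
    (h : IsVal 𝔄 Δ L val) : sem 𝔄 Δ L = frameOutput 𝔄 Δ val := by
  rw [sem, dif_pos h.length, (exists_isVal 𝔄 Δ h.length).choose_spec.unique h]

theorem length_sem (Δ : BraidedDiagram P K a b) {L : List N} (hL : L.length = a.length) :
    (sem 𝔄 Δ L).length = b.length := by
  rw [sem, dif_pos hL, frameOutput, List.length_ofFn]

theorem sem_eq_sem_of_exists {Δ Δ' : BraidedDiagram P K a b} (h : ∀ L (val : Ends a Δ.bot → N),
    IsVal 𝔄 Δ L val → ∃ val', IsVal 𝔄 Δ' L val' ∧ frameOutput 𝔄 Δ' val' = frameOutput 𝔄 Δ val) :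
    sem 𝔄 Δ = sem 𝔄 Δ' := by
  funext L
  by_cases hL : L.length = a.length
  · obtain ⟨val, hv⟩ := exists_isVal 𝔄 Δ hL
    obtain ⟨val', hv', h'⟩ := h L val hv
    rw [hv.sem_eq, hv'.sem_eq, h']
  · rw [sem, sem, dif_neg hL, dif_neg hL]

theorem inputs_map {Δ Δ' : BraidedDiagram P K a b} {val : Ends a Δ.bot → N} (e : Δ'.T → Δ.T)
    (ht : ∀ s, Δ.top (e s) = Δ'.top s) {val' : Ends a Δ'.bot → N}
    (h : ∀ q, lower 𝔄 Δ' val' q = lower 𝔄 Δ val (Ends.map e ht q)) (s : Δ'.T) :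
    inputs 𝔄 Δ' val' s = inputs 𝔄 Δ val (e s) := by
  rw [inputs, inputs, sideList_apply e ht]
  exact sideList_congr fun r _ => h (Sum.inr r)

/-- Valuations are transported along maps of transistors which preserve the values on wires. -/
theorem IsVal.comap {Δ Δ' : BraidedDiagram P K a b} {L : List N} {val : Ends a Δ.bot → N}
    (hv : IsVal 𝔄 Δ L val) (e : Δ'.T → Δ.T)
    (ht : ∀ s, Δ.top (e s) = Δ'.top s) (hb : ∀ s, Δ.bot (e s) = Δ'.bot s)
    (h : ∀ p, lower 𝔄 Δ val (Ends.map e ht (Δ'.wire p)) =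
      𝔄.act (Δ'.label p) (val (Ends.map e hb p))) :
    IsVal 𝔄 Δ' L (fun p => val (Ends.map e hb p)) ∧
      frameOutput 𝔄 Δ' (fun p => val (Ends.map e hb p)) = frameOutput 𝔄 Δ val := by
  have hl : ∀ q, lower 𝔄 Δ' (fun p => val (Ends.map e hb p)) q =
      lower 𝔄 Δ val (Ends.map e ht q) := by
    intro q
    obtain ⟨p, rfl⟩ := Δ'.wire.surjective q
    rw [h, lower_wire]
  refine ⟨⟨hv.frame, fun s => ?_⟩, ?_⟩
  · have h1 := hv.node (e s)
    rw [outputs, sideList_apply e hb, ht, hb] at h1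
    rw [inputs_map e ht hl, ← h1]
    rfl
  · unfold frameOutput
    congr 1
    funext i
    exact hl (Sum.inl i)

theorem Iso.sem_eq {Δ Δ' : BraidedDiagram P K a b} (h : Iso Δ Δ') : sem 𝔄 Δ = sem 𝔄 Δ' := by
  obtain ⟨e, ht, hb, H⟩ := h
  refine (sem_eq_sem_of_exists fun L val hv => ⟨_, hv.comap e ht hb fun p => ?_⟩).symm
  rw [← (H p).1, lower_wire, (H p).2]

/-- The two transistors of a dipole apply inverse operations, and the wires between them act
trivially. So the values leaving the lower transistor are those entering the upper one, and the
joined wires carry the same values as before. -/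
theorem Step.sem_eq {Δ Δ' : BraidedDiagram P K a b} (h : Step Δ Δ') : sem 𝔄 Δ = sem 𝔄 Δ' := by
  obtain ⟨t₁, t₂, D, e, ht, hb, -, -, H⟩ := h
  refine sem_eq_sem_of_exists fun L val hv => ⟨_, hv.comap e ht hb fun p => ?_⟩
  have h1 : inputs 𝔄 Δ val t₁ = outputs Δ val t₂ := by
    refine List.ext_getElem (by simp [inputs, outputs, D.inner]) fun i h₁ h₂ => ?_
    simp only [inputs, outputs, getElem_sideList]
    have h₁' : i < (Δ.top t₁).length := by simpa using h₁
    have h₂' : i < (Δ.bot t₂).length := by simpa [outputs] using h₂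
    rw [← D.wires i h₁' h₂', lower_wire, D.labels, 𝔄.act_one]
  have h2 : outputs Δ val t₁ = inputs 𝔄 Δ val t₂ := by
    rw [hv.node, h1, hv.node, D.inner, ← D.outer, 𝔄.op_op _ _ (Δ.rel t₂) _ (by simp)]
  by_cases hit : ∃ i h, Δ.wire (Ends.map e hb p) = Sum.inr ⟨t₂, i, h⟩
  · obtain ⟨i, h, hw⟩ := hit
    have h' : i < (Δ.bot t₁).length := by rw [← D.outer]; exact h
    obtain ⟨H1, H2⟩ := (H p).1 i h h' hw
    rw [H1, H2, lower_wire, 𝔄.act_mul, ← lower_wire 𝔄 Δ val (Ends.map e hb p), hw]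
    congr 1
    have := List.getElem_of_eq h2 (i := i) (by simpa [outputs] using h')
    simpa [outputs, inputs] using this
  · push Not at hit
    obtain ⟨H1, H2⟩ := (H p).2 hit
    rw [H1, H2, lower_wire]

theorem sem_eq_of_modDipoles {Δ Δ' : BraidedDiagram P K a b} (h : modDipoles P K a b Δ Δ') :
    sem 𝔄 Δ = sem 𝔄 Δ' := by
  induction h with
  | rel x y h =>
    rcases h with h | h
    · exact h.sem_eq
    · exact h.sem_eq
  | refl x => rfl
  | symm x y _ ih => exact ih.symm
  | trans x y z _ _ ih ih' => exact ih.trans ih'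

/-- The valuation of the lower diagram is started from the output of the upper one, and the two are
glued. On a joined wire, the product of the labels acts as the two labels in turn. -/
theorem sem_comp (Δ₁ : BraidedDiagram P K a b) (Δ₂ : BraidedDiagram P K b c) {L : List N}
    (hL : L.length = a.length) : sem 𝔄 (comp Δ₁ Δ₂) L = sem 𝔄 Δ₂ (sem 𝔄 Δ₁ L) := by
  obtain ⟨val₁, h₁⟩ := exists_isVal 𝔄 Δ₁ hL
  obtain ⟨val₂, h₂⟩ := exists_isVal 𝔄 Δ₂ (length_sem (𝔄 := 𝔄) Δ₁ hL)
  rw [h₂.sem_eq]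
  have glue : ∀ i, val₂ (Sum.inl i) = lower 𝔄 Δ₁ val₁ (Sum.inl i) := by
    intro i
    rw [h₂.val_inl]
    simp [h₁.sem_eq, frameOutput]
  let val : Ends a (comp Δ₁ Δ₂).bot → N := fun p => match p with
    | Sum.inl i => val₁ (Sum.inl i)
    | Sum.inr ⟨Sum.inl t, i, h⟩ => val₁ (Sum.inr ⟨t, i, h⟩)
    | Sum.inr ⟨Sum.inr t, i, h⟩ => val₂ (Sum.inr ⟨t, i, h⟩)
  have v1 : ∀ p, val (upO Δ₁ Δ₂ p) = val₁ p := by rintro (i | p) <;> rfl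
  have v2 : ∀ q, val (loO Δ₁ Δ₂ q) = val₂ (Sum.inr q) := fun _ => rfl
  have l1 : ∀ q, lower 𝔄 (comp Δ₁ Δ₂) val (upI Δ₁ Δ₂ q) = lower 𝔄 Δ₁ val₁ (Sum.inr q) := by
    intro q
    obtain ⟨p, hp⟩ := Δ₁.wire.surjective (Sum.inr q)
    rw [← wire_upO_inr _ _ hp, lower_wire, label_upO_inr _ _ hp, v1, ← hp, lower_wire]
  have l2 : ∀ q, lower 𝔄 (comp Δ₁ Δ₂) val (loI Δ₁ Δ₂ q) = lower 𝔄 Δ₂ val₂ q := by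
    intro q
    obtain ⟨p, rfl⟩ := Δ₂.wire.surjective q
    rcases p with i | p
    · obtain ⟨p, hp⟩ := Δ₁.wire.surjective (Sum.inl i)
      rw [← wire_upO_inl _ _ hp, lower_wire, label_upO_inl _ _ hp, v1, lower_wire, glue, ← hp,
        lower_wire, 𝔄.act_mul]
    · rw [← wire_loO, lower_wire, label_loO, v2, lower_wire]
  have hv : IsVal 𝔄 (comp Δ₁ Δ₂) L val := by
    refine ⟨h₁.frame, ?_⟩
    rintro (t | t)
    · refine (h₁.node t).trans (congrArg _ ?_)
      refine (sideList_congr fun q _ => (l1 q).symm).trans ?_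
      exact (sideList_apply (f' := (comp Δ₁ Δ₂).top) Sum.inl (fun _ => rfl)
        (fun q => lower 𝔄 (comp Δ₁ Δ₂) val (Sum.inr q)) t).symm
    · refine (h₂.node t).trans (congrArg _ ?_)
      refine (sideList_congr fun q _ => (l2 (Sum.inr q)).symm).trans ?_
      exact (sideList_apply (f' := (comp Δ₁ Δ₂).top) Sum.inr (fun _ => rfl)
        (fun q => lower 𝔄 (comp Δ₁ Δ₂) val (Sum.inr q)) t).symm
  rw [hv.sem_eq]
  unfold frameOutput
  congr 1
  funext i
  exact l2 (Sum.inl i)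

/-- The semantics of a diagram without transistors. -/
theorem sem_trivial {L : List N} (hL : L.length = a.length) :
    sem 𝔄 (trivial a : BraidedDiagram P K a a) L = L := by
  obtain ⟨val, hv⟩ := exists_isVal 𝔄 (trivial a : BraidedDiagram P K a a) hL
  rw [hv.sem_eq, ← hv.frame]
  unfold frameOutput
  congr 1
  funext i
  exact (lower_wire 𝔄 (trivial a : BraidedDiagram P K a a) val (Sum.inl i)).trans (𝔄.act_one _)

theorem sem_inverse (Δ : BraidedDiagram P K a b) {L : List N} (hL : L.length = a.length) :
    sem 𝔄 (inverse Δ) (sem 𝔄 Δ L) = L := by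
  rw [← sem_comp _ _ hL, sem_eq_of_modDipoles (comp_inverse Δ), sem_trivial hL]

end BraidedDiagram

/-! ### The free algebra on one generator with a bijective pairing and invertible letters -/

/-- Terms in one variable over two unary projections, a binary pairing and unary operations indexed
by the elements of `A` and their formal inverses. -/
inductive WireTerm (A : Type v) : Type v
  | var : WireTerm A
  | proj (b : Bool) (x : WireTerm A) : WireTerm A
  | pair (x y : WireTerm A) : WireTerm A
  | lab (s : A × Bool) (x : WireTerm A) : WireTerm A

/-- The formal inverse of a letter. -/
abbrev letterInv {A : Type v} (s : A × Bool) : A × Bool := (s.1, !s.2)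

theorem letterInv_letterInv {A : Type v} (s : A × Bool) : letterInv (letterInv s) = s := by
  simp [letterInv]

namespace WireTerm

variable {A : Type v}

/-- Terms to which none of the cancellation rules applies. -/
def Normal : WireTerm A → Prop
  | var => True
  | proj _ x => x.Normal ∧ ∀ y z, x ≠ pair y z
  | pair x y => x.Normal ∧ y.Normal ∧ ∀ z, ¬ (x = proj false z ∧ y = proj true z)
  | lab s x => x.Normal ∧ ∀ y, x ≠ lab (letterInv s) y

/-- The subterms which begin with a letter. -/
def labSub : WireTerm A → Set (WireTerm A)
  | var => ∅
  | proj _ x => x.labSub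
  | pair x y => x.labSub ∪ y.labSub
  | lab s x => insert (lab s x) x.labSub

end WireTerm

/-- Normal terms: the free object in one variable. -/
@[ext] structure NormalTerm (A : Type v) : Type v where
  val : WireTerm A
  normal : val.Normal

namespace NormalTerm

variable {A : Type v}

/-- The variable. -/
def var : NormalTerm A := ⟨.var, True.intro⟩

/-- The projections, as operations on normal terms. -/
def proj (b : Bool) : NormalTerm A → NormalTerm A
  | ⟨.pair x y, h⟩ => cond b ⟨y, h.2.1⟩ ⟨x, h.1⟩
  | ⟨.var, h⟩ => ⟨.proj b .var, h, by simp⟩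
  | ⟨.proj c x, h⟩ => ⟨.proj b (.proj c x), h, by simp⟩
  | ⟨.lab s x, h⟩ => ⟨.proj b (.lab s x), h, by simp⟩

open Classical in
/-- The pairing, as an operation on normal terms. -/
noncomputable def pair (x y : NormalTerm A) : NormalTerm A :=
  if h : ∃ z : WireTerm A, x.1 = .proj false z ∧ y.1 = .proj true z then
    ⟨h.choose, by
      have h1 := x.2
      rw [h.choose_spec.1] at h1
      exact h1.1⟩
  else ⟨.pair x.1 y.1, x.2, y.2, not_exists.1 h⟩

open Classical in
/-- The letters, as operations on normal terms. -/
noncomputable def lab (s : A × Bool) (x : NormalTerm A) : NormalTerm A :=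
  if h : ∃ y, x.1 = .lab (letterInv s) y then
    ⟨h.choose, by
      have h1 := x.2
      rw [h.choose_spec] at h1
      exact h1.1⟩
  else ⟨.lab s x.1, x.2, not_exists.1 h⟩

/-- `x` is not a pair. -/
def NotPair (x : NormalTerm A) : Prop := ∀ y z, x.1 ≠ .pair y z

theorem val_proj {x : NormalTerm A} (h : x.NotPair) (b : Bool) : (proj b x).1 = .proj b x.1 := by
  rcases x with ⟨_ | _ | ⟨y, z⟩ | _, hx⟩
  · rfl
  · rfl
  · exact absurd rfl (h y z)
  · rfl

theorem pair_of_eq {x y : NormalTerm A} {z : WireTerm A} (h₁ : x.1 = .proj false z)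
    (h₂ : y.1 = .proj true z) : (pair x y).1 = z := by
  have h : ∃ z : WireTerm A, x.1 = .proj false z ∧ y.1 = .proj true z := ⟨z, h₁, h₂⟩
  rw [pair, dif_pos h]
  have h2 := h₁.symm.trans h.choose_spec.1
  injection h2 with _ h2
  exact h2.symm

theorem val_pair {x y : NormalTerm A}
    (h : ¬ ∃ z : WireTerm A, x.1 = .proj false z ∧ y.1 = .proj true z) :
    (pair x y).1 = .pair x.1 y.1 := by
  rw [pair, dif_neg h]

theorem lab_of_eq {x : NormalTerm A} {s : A × Bool} {y : WireTerm A}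
    (h : x.1 = .lab (letterInv s) y) : (lab s x).1 = y := by
  have h' : ∃ y, x.1 = .lab (letterInv s) y := ⟨y, h⟩
  rw [lab, dif_pos h']
  have h2 := h.symm.trans h'.choose_spec
  injection h2 with _ h2
  exact h2.symm

theorem val_lab {x : NormalTerm A} {s : A × Bool} (h : ∀ y, x.1 ≠ .lab (letterInv s) y) :
    (lab s x).1 = .lab s x.1 := by
  rw [lab, dif_neg (not_exists.2 h)]

/-- If the pairing cancels to z, then z is not a pair, because `proj false z` is normal; projecting
z therefore simply restores the two arguments. -/
theorem proj_pair (b : Bool) (x y : NormalTerm A) : proj b (pair x y) = cond b y x := by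
  by_cases h : ∃ z : WireTerm A, x.1 = .proj false z ∧ y.1 = .proj true z
  · obtain ⟨z, h₁, h₂⟩ := h
    have hz := pair_of_eq h₁ h₂
    have hx := x.2
    rw [h₁] at hx
    have hp : NotPair (pair x y) := fun u w h => hx.2 u w (hz ▸ h)
    apply NormalTerm.ext
    rw [val_proj hp, hz]
    cases b
    · exact h₁.symm
    · exact h₂.symm
  · have hp : pair x y = ⟨.pair x.1 y.1, x.2, y.2, not_exists.1 h⟩ := NormalTerm.ext (val_pair h)
    rw [hp]
    cases b <;> rfl

theorem pair_proj (x : NormalTerm A) : pair (proj false x) (proj true x) = x := by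
  by_cases h : x.NotPair
  · exact NormalTerm.ext (pair_of_eq (val_proj h false) (val_proj h true))
  · unfold NotPair at h
    push Not at h
    obtain ⟨y, z, h⟩ := h
    obtain ⟨_, hx⟩ := x
    subst h
    exact NormalTerm.ext (val_pair (not_exists.2 hx.2.2))

/-- If the first letter cancels, normality of x forbids the second from cancelling again, so it is
put back. -/
theorem lab_lab (s : A × Bool) (x : NormalTerm A) : lab (letterInv s) (lab s x) = x := by
  by_cases h : ∃ y, x.1 = .lab (letterInv s) y
  · obtain ⟨y, h⟩ := h
    have hy := lab_of_eq h
    have hx := x.2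
    rw [h] at hx
    apply NormalTerm.ext
    rw [val_lab, hy, h]
    rw [hy]
    exact hx.2
  · push Not at h
    apply NormalTerm.ext
    apply lab_of_eq
    rw [val_lab h, letterInv_letterInv]

/-! ### The action of the free group -/

/-- The permutation of the normal terms defined by a generator. -/
noncomputable def labPerm (a : A) : Equiv.Perm (NormalTerm A) where
  toFun := lab (a, true)
  invFun := lab (a, false)
  left_inv := lab_lab (a, true)
  right_inv := lab_lab (a, false)

/-- The right action of the free group on normal terms. -/
noncomputable def act (k : FreeGroup A) (x : NormalTerm A) : NormalTerm A :=
  -- The opposite group makes the factors of a product act in the order in which they are read, from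
  -- top to bottom along a wire.
  (FreeGroup.lift (fun a => MulOpposite.op (labPerm a)) k).unop x

theorem act_one (x : NormalTerm A) : act 1 x = x := by
  simp [act]

theorem act_mul (k l : FreeGroup A) (x : NormalTerm A) : act (k * l) x = act l (act k x) := by
  simp [act]

theorem act_mk (w : List (A × Bool)) (x : NormalTerm A) :
    act (FreeGroup.mk w) x = w.foldl (fun y s => lab s y) x := by
  induction w generalizing x with
  | nil => exact act_one x
  | cons s w ih =>
    have h : FreeGroup.mk (s :: w) = FreeGroup.mk [s] * FreeGroup.mk w := by
      rw [FreeGroup.mul_mk]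
      rfl
    rw [h, act_mul, ih, List.foldl_cons]
    congr 1
    rcases s with ⟨a, _ | _⟩
    · simp [act, labPerm]
    · simp [act, labPerm]

/-- `x` does not begin with a letter. -/
def NotLab (x : NormalTerm A) : Prop := ∀ s y, x.1 ≠ .lab s y

/-- The letters of a reduced word pile up on x without cancellation, so the last one stays
outermost. -/
theorem val_foldl_lab {w : List (A × Bool)} (hw : FreeGroup.IsReduced w) {x : NormalTerm A}
    (hx : x.NotLab) : (∃ s y, w.getLast? = some s ∧
      (w.foldl (fun y s => lab s y) x).1 = .lab s y) ∨ w = [] := by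
  induction w using List.reverseRecOn with
  | nil => exact Or.inr rfl
  | append_singleton w s ih =>
    refine Or.inl ⟨s, (w.foldl (fun y s => lab s y) x).1, by simp, ?_⟩
    rw [List.foldl_append]
    refine val_lab fun y hy => ?_
    unfold FreeGroup.IsReduced at hw ih
    rw [List.isChain_append] at hw
    rcases ih hw.1 with ⟨s', y', h1, h2⟩ | rfl
    · rw [h2] at hy
      injection hy with hs
      have := hw.2.2 s' h1 s (by simp)
      rw [hs] at this
      simp at this
    · exact hx _ _ hy

/-- A nontrivial label leaves its last letter at the head of the term. -/
theorem eq_one_of_act {k : FreeGroup A} {x : NormalTerm A} (hx : x.NotLab)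
    (h : (act k x).NotLab) : k = 1 := by
  classical
  rw [← FreeGroup.mk_toWord (x := k), act_mk] at h
  rcases val_foldl_lab (FreeGroup.isReduced_toWord (x := k)) hx with ⟨s, y, -, h'⟩ | h'
  · exact absurd h' (h s y)
  · exact FreeGroup.toWord_eq_nil_iff.1 h'

/-- The label of a wire and the value at its top endpoint can both be read off from the value at its
bottom endpoint, provided the value at the top does not begin with a letter. -/
theorem act_injective {k k' : FreeGroup A} {x x' : NormalTerm A} (hx : x.NotLab) (hx' : x'.NotLab)
    (h : act k x = act k' x') : k = k' ∧ x = x' := by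
  have h1 : act (k * k'⁻¹) x = x' := by
    rw [act_mul, h, ← act_mul, mul_inv_cancel, act_one]
  have h2 := eq_one_of_act hx (h1 ▸ hx')
  rw [h2, act_one] at h1
  exact ⟨mul_inv_eq_one.1 h2, h1⟩

/-! ### Operations on lists -/

/-- Replace the first entry by its two projections. -/
def splitHead : List (NormalTerm A) → List (NormalTerm A)
  | [] => []
  | x :: L => proj false x :: proj true x :: L

/-- Replace the first two entries by their pair. -/
noncomputable def mergeHead : List (NormalTerm A) → List (NormalTerm A)
  | x :: y :: L => pair x y :: L
  | L => L

/-- Apply a letter to the first entry. -/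
noncomputable def labHead (s : A × Bool) : List (NormalTerm A) → List (NormalTerm A)
  | [] => []
  | x :: L => lab s x :: L

theorem mergeHead_splitHead :
    Function.LeftInverse (mergeHead (A := A)) splitHead := by
  rintro (_ | ⟨x, L⟩)
  · rfl
  · show pair _ _ :: L = _
    rw [pair_proj]

theorem splitHead_mergeHead {L : List (NormalTerm A)} (h : 2 ≤ L.length) :
    splitHead (mergeHead L) = L := by
  rcases L with _ | ⟨x, _ | ⟨y, L⟩⟩
  · simp at h
  · simp at h
  · show proj _ _ :: proj _ _ :: L = _
    rw [proj_pair, proj_pair]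
    rfl

theorem length_splitHead {L : List (NormalTerm A)} (h : L ≠ []) :
    (splitHead L).length = L.length + 1 := by
  rcases L with _ | ⟨x, L⟩
  · simp at h
  · simp [splitHead]

theorem length_mergeHead (L : List (NormalTerm A)) (h : 2 ≤ L.length) :
    (mergeHead L).length = L.length - 1 := by
  rcases L with _ | ⟨x, _ | ⟨y, L⟩⟩
  · simp at h
  · simp at h
  · simp [mergeHead]

@[simp] theorem length_labHead (s : A × Bool) (L : List (NormalTerm A)) :
    (labHead s L).length = L.length := by
  cases L <;> simp [labHead]

theorem length_iterate_splitHead {L : List (NormalTerm A)} (h : L ≠ []) (k : ℕ) :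
    (splitHead^[k] L).length = L.length + k := by
  have h0 := List.length_pos_iff.2 h
  induction k with
  | zero => rfl
  | succ k ih =>
    rw [Function.iterate_succ_apply', length_splitHead, ih, Nat.add_assoc]
    apply List.length_pos_iff.1
    omega

theorem length_iterate_mergeHead {L : List (NormalTerm A)} {k : ℕ} (h : k < L.length) :
    (mergeHead^[k] L).length = L.length - k := by
  induction k with
  | zero => rfl
  | succ k ih =>
    have := ih (by omega)
    rw [Function.iterate_succ_apply', length_mergeHead _ (by omega)]
    omega

theorem iterate_mergeHead_splitHead (k : ℕ) (L : List (NormalTerm A)) :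
    mergeHead^[k] (splitHead^[k] L) = L :=
  mergeHead_splitHead.iterate k L

theorem iterate_splitHead_mergeHead {L : List (NormalTerm A)} {k : ℕ} (h : k < L.length) :
    splitHead^[k] (mergeHead^[k] L) = L := by
  induction k with
  | zero => rfl
  | succ k ih =>
    rw [Function.iterate_succ_apply' mergeHead, Function.iterate_succ_apply splitHead,
      splitHead_mergeHead, ih (by omega)]
    rw [length_iterate_mergeHead (by omega)]
    omega

theorem labHead_labHead (s : A × Bool) (L : List (NormalTerm A)) :
    labHead (letterInv s) (labHead s L) = L := by
  rcases L with _ | ⟨x, L⟩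
  · rfl
  · show lab _ (lab _ x) :: L = _
    rw [lab_lab]

theorem labHead_append (s : A × Bool) {L : List (NormalTerm A)} (h : L ≠ [])
    (R : List (NormalTerm A)) : labHead s (L ++ R) = labHead s L ++ R := by
  rcases L with _ | ⟨x, L⟩
  · exact absurd rfl h
  · rfl

theorem iterate_splitHead_append {L : List (NormalTerm A)} (h : L ≠ []) (R : List (NormalTerm A))
    (k : ℕ) : splitHead^[k] (L ++ R) = splitHead^[k] L ++ R := by
  induction k generalizing L with
  | zero => rfl
  | succ k ih =>
    rcases L with _ | ⟨x, L⟩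
    · exact absurd rfl h
    · rw [Function.iterate_succ_apply, Function.iterate_succ_apply, ← ih (by simp [splitHead])]
      rfl

theorem iterate_mergeHead_append {L : List (NormalTerm A)} (R : List (NormalTerm A))
    {k : ℕ} (h : k < L.length) : mergeHead^[k] (L ++ R) = mergeHead^[k] L ++ R := by
  induction k generalizing L with
  | zero => rfl
  | succ k ih =>
    rcases L with _ | ⟨x, _ | ⟨y, L⟩⟩
    · simp at h
    · simp at h
    · rw [Function.iterate_succ_apply, Function.iterate_succ_apply,
        ← ih (by simpa [mergeHead] using h)]
      rfl

theorem iterate_splitHead_singleton (k : ℕ) (x : NormalTerm A) :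
    splitHead^[k] [x] = (proj false)^[k] x ::
      (List.range k).reverse.map fun j => proj true ((proj false)^[j] x) := by
  induction k with
  | zero => rfl
  | succ k ih =>
    rw [Function.iterate_succ_apply', ih, List.range_succ, List.reverse_append,
      Function.iterate_succ_apply']
    rfl

/-! ### Atoms -/

/-- `x` is the variable or begins with a letter. -/
def Atom (x : NormalTerm A) : Prop := x.NotPair ∧ ∀ b y, x.1 ≠ .proj b y

theorem atom_var : Atom (var : NormalTerm A) := ⟨by simp [NotPair, var], by simp [var]⟩

theorem atom_of_eq_lab {x : NormalTerm A} {s : A × Bool} {y} (h : x.1 = .lab s y) : Atom x :=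
  ⟨by simp [NotPair, h], by simp [h]⟩

theorem proj_injective {x y : NormalTerm A} (hx : x.NotPair) (hy : y.NotPair) {b c : Bool}
    (h : proj b x = proj c y) : b = c ∧ x = y := by
  have h := congrArg NormalTerm.val h
  rw [val_proj hx, val_proj hy] at h
  injection h with h1 h2
  exact ⟨h1, NormalTerm.ext h2⟩

theorem Atom.notPair_iterate {x : NormalTerm A} (hx : x.Atom) (k : ℕ) :
    NotPair ((proj false)^[k] x) := by
  induction k with
  | zero => exact hx.1
  | succ k ih =>
    rw [Function.iterate_succ_apply']
    intro y z h
    rw [val_proj ih] at h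
    cases h

theorem Atom.ne_proj {x y : NormalTerm A} (hx : x.Atom) (hy : y.NotPair) (b : Bool) :
    x ≠ proj b y := by
  intro h
  exact hx.2 b y.1 (by rw [h, val_proj hy])

theorem Atom.iterate_injective {x y : NormalTerm A} (hx : x.Atom) (hy : y.Atom) {k l : ℕ}
    (h : (proj false)^[k] x = (proj false)^[l] y) : x = y ∧ k = l := by
  induction k generalizing l with
  | zero =>
    cases l with
    | zero => exact ⟨h, rfl⟩
    | succ l =>
      rw [Function.iterate_succ_apply'] at h
      exact absurd h (hx.ne_proj (hy.notPair_iterate l) _)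
  | succ k ih =>
    cases l with
    | zero =>
      rw [Function.iterate_succ_apply'] at h
      exact absurd h.symm (hy.ne_proj (hx.notPair_iterate k) _)
    | succ l =>
      rw [Function.iterate_succ_apply', Function.iterate_succ_apply'] at h
      obtain ⟨h1, h2⟩ := ih (proj_injective (hx.notPair_iterate k) (hy.notPair_iterate l) h).2
      exact ⟨h1, by rw [h2]⟩

theorem getElem_iterate_splitHead (k : ℕ) (x : NormalTerm A) (i : ℕ)
    (h : i < (splitHead^[k] [x]).length) : (splitHead^[k] [x])[i] =
      if i = 0 then (proj false)^[k] x else proj true ((proj false)^[k - i] x) := by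
  have hk := h
  rw [length_iterate_splitHead (by simp), List.length_singleton] at hk
  simp only [iterate_splitHead_singleton]
  rcases i with _ | i
  · rfl
  · simp only [List.getElem_cons_succ, List.getElem_map, List.getElem_reverse, List.length_range,
      List.getElem_range, Nat.add_eq_zero_iff, one_ne_zero, and_false, if_false]
    rw [show k - 1 - i = k - (i + 1) by omega]

/-- An entry of an iterated splitting of an atom determines the atom and, nearly, the position. -/
theorem Atom.getElem_injective {x y : NormalTerm A} (hx : x.Atom) (hy : y.Atom) {k l i j : ℕ}
    (hi : i < (splitHead^[k] [x]).length) (hj : j < (splitHead^[l] [y]).length)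
    (h : (splitHead^[k] [x])[i] = (splitHead^[l] [y])[j]) :
    x = y ∧ (i = 0 → j = 0 ∧ k = l) ∧ (k = l → i = j) := by
  have hi' := hi
  have hj' := hj
  rw [length_iterate_splitHead (by simp), List.length_singleton] at hi' hj'
  rw [getElem_iterate_splitHead, getElem_iterate_splitHead] at h
  -- The first entry of a splitting is an atom under left projections only; every other entry has a
  -- right projection outermost.
  have aux : ∀ {x y : NormalTerm A} {k m : ℕ}, x.Atom → y.Atom →
      (proj false)^[k] x ≠ proj true ((proj false)^[m] y) := by
    intro x y k m hx hy h
    cases k with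
    | zero => exact hx.ne_proj (hy.notPair_iterate m) _ h
    | succ k =>
      rw [Function.iterate_succ_apply'] at h
      exact absurd (proj_injective (hx.notPair_iterate k) (hy.notPair_iterate m) h).1 (by simp)
  split_ifs at h with h1 h2 h2
  · obtain ⟨h3, h4⟩ := hx.iterate_injective hy h
    exact ⟨h3, fun _ => ⟨h2, h4⟩, fun _ => h1.trans h2.symm⟩
  · exact absurd h (aux hx hy)
  · exact absurd h.symm (aux hy hx)
  · obtain ⟨h3, h4⟩ := hx.iterate_injective hy
      (proj_injective (hx.notPair_iterate _) (hy.notPair_iterate _) h).2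
    exact ⟨h3, fun h => absurd h h1, fun _ => by omega⟩

/-! ### Subterms -/

/-- The subterms which begin with a letter. -/
def labSub (x : NormalTerm A) : Set (WireTerm A) := x.1.labSub

/-- The subterms of the entries of a list which begin with a letter. -/
def labSubs (L : List (NormalTerm A)) : Set (WireTerm A) := {z | ∃ x ∈ L, z ∈ x.labSub}

theorem labSub_proj_of_notPair {x : NormalTerm A} (h : x.NotPair) (b : Bool) :
    labSub (proj b x) = labSub x := by
  rw [labSub, val_proj h]
  rfl

/-- Subterms beginning with a letter are unaffected by the cancellation rule of pairs, since both
projections of z have the same such subterms as z. -/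
theorem labSub_pair (x y : NormalTerm A) : labSub (pair x y) = labSub x ∪ labSub y := by
  by_cases h : ∃ z : WireTerm A, x.1 = .proj false z ∧ y.1 = .proj true z
  · obtain ⟨z, h₁, h₂⟩ := h
    rw [labSub, pair_of_eq h₁ h₂, labSub, labSub, h₁, h₂]
    exact (Set.union_self _).symm
  · rw [labSub, val_pair h]
    rfl

/-- Every term is the pair of its projections, so `labSub_pair` applies. -/
theorem labSub_proj (x : NormalTerm A) (b : Bool) : labSub (proj b x) ⊆ labSub x := by
  conv_rhs => rw [← pair_proj x, labSub_pair]
  cases b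
  · exact Set.subset_union_left
  · exact Set.subset_union_right

/-- A cancelling letter only exposes a subterm; otherwise the whole new term is the only addition.
-/
theorem labSub_lab (s : A × Bool) (x : NormalTerm A) :
    labSub (lab s x) ⊆ insert (lab s x).1 (labSub x) := by
  by_cases h : ∃ y, x.1 = .lab (letterInv s) y
  · obtain ⟨y, h⟩ := h
    rw [labSub, lab_of_eq h, labSub, h]
    exact (Set.subset_insert _ _).trans (Set.subset_insert _ _)
  · push Not at h
    rw [labSub, val_lab h]
    exact subset_rfl

theorem labSubs_mergeHead (L : List (NormalTerm A)) : labSubs (mergeHead L) = labSubs L := by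
  rcases L with _ | ⟨x, _ | ⟨y, L⟩⟩
  · rfl
  · rfl
  · ext z
    simp [labSubs, mergeHead, labSub_pair, or_assoc]

theorem labSubs_iterate_mergeHead (L : List (NormalTerm A)) (k : ℕ) :
    labSubs (mergeHead^[k] L) = labSubs L := by
  induction k generalizing L with
  | zero => rfl
  | succ k ih => rw [Function.iterate_succ_apply, ih, labSubs_mergeHead]

theorem labSubs_splitHead (L : List (NormalTerm A)) : labSubs (splitHead L) ⊆ labSubs L := by
  rcases L with _ | ⟨x, L⟩
  · exact subset_rfl
  · rintro z ⟨y, hy, hz⟩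
    simp only [splitHead, List.mem_cons] at hy
    rcases hy with rfl | rfl | hy
    · exact ⟨x, by simp, labSub_proj _ _ hz⟩
    · exact ⟨x, by simp, labSub_proj _ _ hz⟩
    · exact ⟨y, by simp [hy], hz⟩

theorem Atom.labSub_iterate {x : NormalTerm A} (hx : x.Atom) (k : ℕ) :
    labSub ((proj false)^[k] x) = labSub x := by
  induction k with
  | zero => rfl
  | succ k ih => rw [Function.iterate_succ_apply', labSub_proj_of_notPair (hx.notPair_iterate k), ih]

theorem Atom.labSub_getElem {x : NormalTerm A} (hx : x.Atom) {k i : ℕ}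
    (hi : i < (splitHead^[k] [x]).length) : labSub (splitHead^[k] [x])[i] = labSub x := by
  rw [getElem_iterate_splitHead]
  split_ifs
  · exact hx.labSub_iterate k
  · rw [labSub_proj_of_notPair (hx.notPair_iterate _), hx.labSub_iterate]

/-- The terms which arise when the letters of a word are applied one after the other. -/
noncomputable def partials : List (A × Bool) → NormalTerm A → List (WireTerm A)
  | [], _ => []
  | s :: w, x => (lab s x).1 :: partials w (lab s x)

theorem length_partials (w : List (A × Bool)) (x : NormalTerm A) :
    (partials w x).length = w.length := by
  induction w generalizing x with
  | nil => rfl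
  | cons s w ih => simp [partials, ih]

theorem labSub_foldl (w : List (A × Bool)) (x : NormalTerm A) :
    labSub (w.foldl (fun y s => lab s y) x) ⊆ labSub x ∪ {z | z ∈ partials w x} := by
  induction w generalizing x with
  | nil => exact Set.subset_union_left
  | cons s w ih =>
    intro z hz
    rcases ih _ hz with hz | hz
    · rcases labSub_lab s x hz with rfl | hz
      · exact Or.inr (by simp [partials])
      · exact Or.inl hz
    · exact Or.inr (List.mem_cons_of_mem _ hz)

end NormalTerm

namespace BraidedDiagram

instance {S : Type*} {T : Type} [Finite T] (f : T → List S) : Finite (Port f) :=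
  Finite.of_injective (β := Σ t, Fin (f t).length) (fun p => ⟨p.node, p.idx, p.lt⟩) (by
    rintro ⟨t, i, h⟩ ⟨t', i', h'⟩ e
    simp only [Sigma.mk.injEq] at e
    obtain ⟨rfl, e⟩ := e
    simpa using e)

instance {S : Type*} {P : SemigroupPresentation S} {K : Type*} {a b : List S}
    (Δ : BraidedDiagram P K a b) : Finite Δ.T := Δ.finite

end BraidedDiagram

/-! ### The action of diagrams over ⟨x ∣ x = x²⟩ on normal terms -/

open BraidedDiagram NormalTerm

theorem mem_thompson_rels {u v : List Unit} :
    (u, v) ∈ thompsonPresentation.rels ↔ u = [()] ∧ v = [(), ()] := by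
  simp [thompsonPresentation]

/-- Normal terms as an algebra for `⟨x ∣ x = x²⟩` and the free group. -/
noncomputable def thompsonAlgebra (A : Type v) :
    WireAlgebra thompsonPresentation (FreeGroup A) (NormalTerm A) where
  -- The only relation has sides of lengths 1 and 2, so the lengths reveal the orientation of a
  -- transistor.
  op u v L := if u.length < v.length then splitHead L else mergeHead L
  act := act
  length_op := by
    intro u v h L hL
    simp only [mem_thompson_rels] at h
    rcases h with ⟨rfl, rfl⟩ | ⟨rfl, rfl⟩
    · rw [if_pos (by simp), length_splitHead, hL]
      · rfl
      · rintro rfl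
        simp at hL
    · rw [if_neg (by simp), length_mergeHead _ (by simp [hL]), hL]
      rfl
  op_op := by
    intro u v h L hL
    simp only [mem_thompson_rels] at h
    rcases h with ⟨rfl, rfl⟩ | ⟨rfl, rfl⟩
    · rw [if_neg (by simp), if_pos (by simp), mergeHead_splitHead]
    · rw [if_pos (by simp), if_neg (by simp), splitHead_mergeHead (by simp [hL])]
  act_one := act_one
  act_mul := act_mul

namespace BraidedDiagram

variable {A : Type v}

/-- The number of transistors plus the lengths of the labels. -/
noncomputable def cost {a b : List Unit}
    (Δ : BraidedDiagram thompsonPresentation (FreeGroup A) a b) : ℕ :=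
  Nat.card Δ.T + ∑ᶠ p, @FreeGroup.norm A (Classical.decEq A) (Δ.label p)

/-! ### Counting the subterms created by labels -/

section count

variable {a b : List Unit} {Δ : BraidedDiagram thompsonPresentation (FreeGroup A) a b}

open Classical in
theorem labSub_act (k : FreeGroup A) (x : NormalTerm A) :
    labSub (act k x) ⊆ labSub x ∪ {z | z ∈ partials k.toWord x} := by
  conv_lhs => rw [← FreeGroup.mk_toWord (x := k), act_mk]
  exact labSub_foldl _ _

open Classical in
/-- Subterms of the output of a diagram which begin with a letter come from the input or are
created by a letter of the label of a wire. -/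
theorem IsVal.labSubs_subset {L : List (NormalTerm A)} {val : Ends a Δ.bot → NormalTerm A}
    (hv : IsVal (thompsonAlgebra A) Δ L val) : labSubs (frameOutput (thompsonAlgebra A) Δ val) ⊆
      labSubs L ∪ {z | ∃ p, z ∈ partials (Δ.label p).toWord (val p)} := by
  set X := labSubs L ∪ {z | ∃ p, z ∈ partials (Δ.label p).toWord (val p)} with hX
  have low : ∀ p, labSub (val p) ⊆ X → labSub (lower (thompsonAlgebra A) Δ val (Δ.wire p)) ⊆ X := by
    intro p hp
    rw [lower_wire]
    refine (labSub_act _ _).trans (Set.union_subset hp fun z hz => Or.inr ⟨p, hz⟩)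
  have inl : ∀ i, labSub (val (Sum.inl i)) ⊆ X := by
    intro i z hz
    refine Or.inl ⟨_, ?_, hz⟩
    rw [hv.val_inl]
    exact List.getElem_mem _
  have node : ∀ t, labSubs (outputs Δ val t) ⊆ X := by
    intro t
    induction t using node_induction Δ with
    | h t ih =>
      rw [hv.node]
      have h1 : labSubs (inputs (thompsonAlgebra A) Δ val t) ⊆ X := by
        rintro z ⟨x, hx, hz⟩
        obtain ⟨i, hi, rfl⟩ := List.getElem_of_mem hx
        simp only [inputs, getElem_sideList] at hz
        revert hz
        generalize hr : (⟨t, i, _⟩ : Port Δ.top) = r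
        intro hz
        obtain ⟨p, hp⟩ := Δ.wire.surjective (Sum.inr r)
        rw [← hp] at hz
        refine low p ?_ hz
        rcases p with i | q
        · exact inl i
        · refine fun z hz => ih q r hp (by rw [← hr]) ⟨val (Sum.inr q), ?_, hz⟩
          rw [outputs, sideList, List.mem_ofFn]
          exact ⟨⟨q.idx, q.lt⟩, rfl⟩
      refine Set.Subset.trans ?_ h1
      show labSubs (if _ then _ else _) ⊆ _
      split_ifs
      · exact labSubs_splitHead _
      · exact (labSubs_mergeHead _).subset
  rintro z ⟨x, hx, hz⟩
  rw [frameOutput, List.mem_ofFn] at hx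
  obtain ⟨i, rfl⟩ := hx
  obtain ⟨p, hp⟩ := Δ.wire.surjective (Sum.inl i)
  rw [← hp] at hz
  refine low p ?_ hz
  rcases p with i | q
  · exact inl i
  · refine fun z hz => node q.node ⟨val (Sum.inr q), ?_, hz⟩
    rw [outputs, sideList, List.mem_ofFn]
    exact ⟨⟨q.idx, q.lt⟩, rfl⟩

/-- A diagram creates at most as many subterms beginning with a letter as there are letters in its
labels. -/
theorem card_le_cost_of_labSubs {ι : Type*} {L : List (NormalTerm A)} (hL : L.length = a.length)
    (h0 : labSubs L = ∅) (m : ι → WireTerm A) (hm : Function.Injective m)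
    (h : ∀ i, m i ∈ labSubs (sem (thompsonAlgebra A) Δ L)) : Nat.card ι ≤ cost Δ := by
  classical
  obtain ⟨val, hv⟩ := exists_isVal (thompsonAlgebra A) Δ hL
  rw [hv.sem_eq] at h
  have := Fintype.ofFinite (Ends a Δ.bot)
  -- As the input has no subterm beginning with a letter, those of the output all lie in this finite
  -- set, whose size is at most the total length of the labels.
  let W : Finset (WireTerm A) := Finset.univ.biUnion fun p =>
    (partials (@FreeGroup.toWord A (Classical.decEq A) (Δ.label p)) (val p)).toFinset
  have hW : ∀ i, m i ∈ W := by
    intro i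
    rcases hv.labSubs_subset (h i) with h | ⟨p, hp⟩
    · rw [h0] at h
      exact absurd h (Set.notMem_empty _)
    · simp only [W, Finset.mem_biUnion, Finset.mem_univ, true_and, List.mem_toFinset]
      refine ⟨p, ?_⟩
      convert hp
  have h1 : Nat.card ι ≤ W.card := by
    have := Nat.card_le_card_of_injective (fun i => (⟨m i, hW i⟩ : W))
      (fun i j hij => hm (congrArg Subtype.val hij))
    simpa using this
  have h2 : W.card ≤ ∑ᶠ p, @FreeGroup.norm A (Classical.decEq A) (Δ.label p) := by
    rw [finsum_eq_sum_of_fintype]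
    refine Finset.card_biUnion_le.trans (Finset.sum_le_sum fun p _ => ?_)
    refine (List.toFinset_card_le _).trans ?_
    rw [length_partials]
    rfl
  exact h1.trans (h2.trans (Nat.le_add_left _ _))

end count

/-! ### Faithfulness for ⟨x ∣ x = x²⟩ -/

section faithful

variable {Δ : BraidedDiagram thompsonPresentation (FreeGroup A) [()] [()]}

/-- The value at `q` is obtained from the values on the top of the transistor without
cancellation. -/
def Formal (val : Ends [()] Δ.bot → NormalTerm A) (q : Port Δ.bot) : Prop :=
  (∃ r : Port Δ.top, r.node = q.node ∧ Δ.top q.node = [()] ∧ Δ.bot q.node = [(), ()] ∧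
    r.idx = 0 ∧ (val (Sum.inr q)).val = .proj (decide (q.idx = 1))
      (lower (thompsonAlgebra A) Δ val (Sum.inr r)).val) ∨
  ∃ r r' : Port Δ.top, r.node = q.node ∧ r'.node = q.node ∧ Δ.top q.node = [(), ()] ∧
    Δ.bot q.node = [()] ∧ r.idx = 0 ∧ r'.idx = 1 ∧ (val (Sum.inr q)).val = .pair
      (lower (thompsonAlgebra A) Δ val (Sum.inr r)).val
      (lower (thompsonAlgebra A) Δ val (Sum.inr r')).val

theorem Formal.notLab {val : Ends [()] Δ.bot → NormalTerm A} {q : Port Δ.bot}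
    (h : Formal val q) : (val (Sum.inr q)).NotLab := by
  intro s y hy
  rcases h with ⟨r, -, -, -, -, h⟩ | ⟨r, r', -, -, -, -, -, -, h⟩ <;>
  · rw [h] at hy
    cases hy

theorem Formal.ne_var {val : Ends [()] Δ.bot → NormalTerm A} {q : Port Δ.bot}
    (h : Formal val q) : (val (Sum.inr q)).val ≠ .var := by
  intro hy
  rcases h with ⟨r, -, -, -, -, h⟩ | ⟨r, r', -, -, -, -, -, -, h⟩ <;>
  · rw [h] at hy
    cases hy

theorem IsVal.val_inl_var {val : Ends [()] Δ.bot → NormalTerm A}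
    (hv : IsVal (thompsonAlgebra A) Δ [var] val) (i) : val (Sum.inl i) = var := by
  rw [hv.val_inl]
  simp

theorem IsVal.output_split {L : List (NormalTerm A)} {val : Ends [()] Δ.bot → NormalTerm A}
    (hv : IsVal (thompsonAlgebra A) Δ L val) {q : Port Δ.bot} (ht : Δ.top q.node = [()])
    (hb : Δ.bot q.node = [(), ()]) : val (Sum.inr q) = proj (decide (q.idx = 1))
      (lower (thompsonAlgebra A) Δ val (Sum.inr ⟨q.node, 0, by simp [ht]⟩)) := by
  have h1 := hv.node q.node
  have h2 : inputs (thompsonAlgebra A) Δ val q.node =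
      [lower (thompsonAlgebra A) Δ val (Sum.inr ⟨q.node, 0, by simp [ht]⟩)] := by
    refine List.ext_getElem (by simp [ht]) fun i h h' => ?_
    simp only [List.length_singleton, Nat.lt_one_iff] at h'
    subst h'
    simp [inputs]
  rw [h2] at h1
  have h3 : outputs Δ val q.node = _ := h1.trans (if_pos (by simp [ht, hb]))
  have h4 : q.idx < (outputs Δ val q.node).length := by simpa [outputs] using q.lt
  have h5 : (outputs Δ val q.node)[q.idx] = val (Sum.inr q) := by simp [outputs]
  rw [← h5]
  have h6 : q.idx < 2 := by simpa [hb] using q.lt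
  rw [List.getElem_of_eq h3]
  simp only [splitHead]
  have : q.idx = 0 ∨ q.idx = 1 := by omega
  rcases this with h | h <;> simp [h]

theorem IsVal.output_merge {L : List (NormalTerm A)} {val : Ends [()] Δ.bot → NormalTerm A}
    (hv : IsVal (thompsonAlgebra A) Δ L val) {q : Port Δ.bot} (ht : Δ.top q.node = [(), ()])
    (hb : Δ.bot q.node = [()]) : val (Sum.inr q) = pair
      (lower (thompsonAlgebra A) Δ val (Sum.inr ⟨q.node, 0, by simp [ht]⟩))
      (lower (thompsonAlgebra A) Δ val (Sum.inr ⟨q.node, 1, by simp [ht]⟩)) := by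
  have h1 := hv.node q.node
  have h2 : inputs (thompsonAlgebra A) Δ val q.node =
      [lower (thompsonAlgebra A) Δ val (Sum.inr ⟨q.node, 0, by simp [ht]⟩),
        lower (thompsonAlgebra A) Δ val (Sum.inr ⟨q.node, 1, by simp [ht]⟩)] := by
    refine List.ext_getElem (by simp [ht]) fun i h h' => ?_
    have h' : i < 2 := h'
    have : i = 0 ∨ i = 1 := by omega
    rcases this with rfl | rfl <;> simp [inputs]
  rw [h2] at h1
  have h3 : outputs Δ val q.node = _ := h1.trans (if_neg (by simp [ht, hb]))
  have h4 : q.idx < (outputs Δ val q.node).length := by simpa [outputs] using q.lt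
  have h5 : (outputs Δ val q.node)[q.idx] = val (Sum.inr q) := by simp [outputs]
  rw [← h5, List.getElem_of_eq h3]
  have h6 : q.idx = 0 := by simpa [hb] using q.lt
  simp [mergeHead, h6]

/-- In a reduced diagram with a variable as input, there are no cancellations and the values on
different wires are different. -/
theorem IsVal.formal (hΔ : Δ.IsReduced) {val : Ends [()] Δ.bot → NormalTerm A}
    (hv : IsVal (thompsonAlgebra A) Δ [var] val) (q : Port Δ.bot) : Formal val q := by
  obtain ⟨δ, hδ⟩ := exists_depth Δ
  obtain ⟨M, hM⟩ := exists_bound δ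
  let dE : Ends [()] Δ.bot → ℕ := Sum.elim (fun _ => 0) (fun q => δ q.node + 1)
  -- Both claims are proved together by induction on depth: the absence of cancellations above depth
  -- n makes values on different wires different, and this in turn locates the dipole behind a
  -- possible cancellation at depth n.
  suffices H : ∀ n, (∀ q : Port Δ.bot, δ q.node < n → Formal val q) ∧
      ∀ p p', dE p ≤ n → dE p' ≤ n → val p = val p' → p = p' from
    (H (M + 1)).1 q (Nat.lt_succ_of_le (hM _))
  have dlt : ∀ p r, Δ.wire p = Sum.inr r → dE p ≤ δ r.node := by
    rintro (i | q) r h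
    · exact Nat.zero_le _
    · exact hδ q r h
  intro n
  induction n with
  | zero =>
    refine ⟨fun q h => absurd h (Nat.not_lt_zero _), ?_⟩
    rintro (i | q) (j | q') h h' -
    · exact congrArg _ (Subsingleton.elim (α := Fin 1) i j)
    all_goals simp [dE] at h h'
  | succ n ih =>
    obtain ⟨ih1, ih2⟩ := ih
    have nl : ∀ p, dE p ≤ n → (val p).NotLab := by
      rintro (i | q) h
      · rw [hv.val_inl_var]
        intro s y hy
        cases hy
      · exact (ih1 q h).notLab
    -- No value at the top endpoint of such a wire begins with a letter, so labels can be stripped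
    -- and the injectivity at top endpoints carries over to bottom endpoints.
    have linj : ∀ r r' : Port Δ.top, δ r.node ≤ n → δ r'.node ≤ n →
        lower (thompsonAlgebra A) Δ val (Sum.inr r) =
          lower (thompsonAlgebra A) Δ val (Sum.inr r') → r = r' := by
      intro r r' h h' e
      obtain ⟨p, hp⟩ := Δ.wire.surjective (Sum.inr r)
      obtain ⟨p', hp'⟩ := Δ.wire.surjective (Sum.inr r')
      have d := (dlt _ _ hp).trans h
      have d' := (dlt _ _ hp').trans h'
      rw [← hp, ← hp', lower_wire, lower_wire] at e
      have := ih2 p p' d d' (act_injective (nl _ d) (nl _ d') e).2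
      subst this
      exact Sum.inr_injective (hp.symm.trans hp')
    -- An input which neither begins with a letter nor is the variable has come unchanged from a
    -- higher transistor, along a wire with trivial label.
    have back : ∀ r : Port Δ.top, δ r.node ≤ n →
        (lower (thompsonAlgebra A) Δ val (Sum.inr r)).NotLab →
        (lower (thompsonAlgebra A) Δ val (Sum.inr r)).val ≠ .var →
        ∃ q : Port Δ.bot, Δ.wire (Sum.inr q) = Sum.inr r ∧ Δ.label (Sum.inr q) = 1 ∧
          Formal val q ∧ δ q.node < n ∧
          lower (thompsonAlgebra A) Δ val (Sum.inr r) = val (Sum.inr q) := by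
      intro r h h1 h2
      obtain ⟨p, hp⟩ := Δ.wire.surjective (Sum.inr r)
      have d := (dlt _ _ hp).trans h
      rw [← hp, lower_wire] at h1 h2 ⊢
      have hl := eq_one_of_act (nl p d) h1
      have e : (thompsonAlgebra A).act (Δ.label p) (val p) = val p := by
        rw [hl]
        exact act_one _
      rw [e] at h2 ⊢
      rcases p with i | q
      · rw [hv.val_inl_var] at h2
        exact absurd rfl h2
      · exact ⟨q, rfl, hl, ih1 q d, d, rfl⟩
    have form : ∀ q : Port Δ.bot, δ q.node < n + 1 → Formal val q := by
      intro q hq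
      have hq : δ q.node ≤ n := Nat.le_of_lt_succ hq
      have hrel := Δ.rel q.node
      rw [mem_thompson_rels, mem_thompson_rels] at hrel
      rcases hrel with ⟨ht, hb⟩ | ⟨hb, ht⟩
      · let r : Port Δ.top := ⟨q.node, 0, by simp [ht]⟩
        have hval := hv.output_split ht hb
        refine Or.inl ⟨r, rfl, ht, hb, rfl, ?_⟩
        rw [hval]
        -- If the term to be split were a pair, the transistor feeding it would be a merging one and
        -- would form a dipole with this one.
        refine val_proj (fun y z hyz => ?_) _
        obtain ⟨q', hw, hl, hf, -, he⟩ := back r hq (fun s y h => by rw [hyz] at h; cases h)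
          (fun h => by rw [hyz] at h; cases h)
        rw [he] at hyz
        rcases hf with ⟨r', -, -, -, -, h⟩ | ⟨r₁, r₂, -, -, ht', hb', -, -, h⟩
        · rw [h] at hyz
          cases hyz
        · have q0 : q'.idx = 0 := by simpa [hb'] using q'.lt
          refine hΔ q.node q'.node ⟨ht.trans hb'.symm, ht'.trans hb.symm, ?_, ?_⟩
          · intro i h₁ h₂
            have : i = 0 := by simpa [ht] using h₁
            subst this
            have e : (⟨q'.node, 0, h₂⟩ : Port Δ.bot) = q' := Port.ext rfl q0.symm
            rw [e, hw]
          · intro i h₂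
            have : i = 0 := by simpa [hb'] using h₂
            subst this
            have e : (⟨q'.node, 0, h₂⟩ : Port Δ.bot) = q' := Port.ext rfl q0.symm
            rw [e, hl]
      · let r : Port Δ.top := ⟨q.node, 0, by simp [ht]⟩
        let r' : Port Δ.top := ⟨q.node, 1, by simp [ht]⟩
        have hval := hv.output_merge ht hb
        refine Or.inr ⟨r, r', rfl, rfl, ht, hb, rfl, rfl, ?_⟩
        rw [hval]
        -- If the pairing cancelled, both inputs would come from splitting transistors applied to
        -- the same term z.
        refine val_pair ?_
        rintro ⟨z, hz, hz'⟩
        have hz : (lower (thompsonAlgebra A) Δ val (Sum.inr r)).val = _ := hz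
        have hz' : (lower (thompsonAlgebra A) Δ val (Sum.inr r')).val = _ := hz'
        obtain ⟨q₀, hw₀, hl₀, hf₀, hd₀, he₀⟩ := back r hq
          (fun s y h => by rw [hz] at h; cases h) (fun h => by rw [hz] at h; cases h)
        obtain ⟨q₁, hw₁, hl₁, hf₁, hd₁, he₁⟩ := back r' hq
          (fun s y h => by rw [hz'] at h; cases h) (fun h => by rw [hz'] at h; cases h)
        rw [he₀] at hz
        rw [he₁] at hz'
        rcases hf₀ with ⟨r₀, hr₀, ht₀, hb₀, i₀, h₀⟩ | ⟨r₀, r₀', -, -, -, -, -, -, h₀⟩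
        swap
        · rw [h₀] at hz
          cases hz
        rcases hf₁ with ⟨r₁, hr₁, ht₁, hb₁, i₁, h₁⟩ | ⟨r₁, r₁', -, -, -, -, -, -, h₁⟩
        swap
        · rw [h₁] at hz'
          cases hz'
        rw [h₀] at hz
        rw [h₁] at hz'
        injection hz with z1 z2
        injection hz' with z3 z4
        -- Equal terms at bottom endpoints mean the same wire, so the two projections leave one and
        -- the same transistor and their order is right: a dipole.
        have e := linj r₀ r₁ (by rw [hr₀]; omega) (by rw [hr₁]; omega)
          (NormalTerm.ext (z2.trans z4.symm))
        have en : q₁.node = q₀.node := by rw [← hr₀, ← hr₁, e]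
        have q1 : q₁.idx = 1 := by simpa using z3
        have q0 : q₀.idx = 0 := by
          have h1 : q₀.idx ≠ 1 := by simpa using z1
          have h2 : q₀.idx < 2 := by simpa [hb₀] using q₀.lt
          omega
        have key : ∀ i (h₁ : i < (Δ.top q.node).length) (h₂ : i < (Δ.bot q₀.node).length),
            Δ.wire (Sum.inr ⟨q₀.node, i, h₂⟩) = Sum.inr ⟨q.node, i, h₁⟩ ∧
            Δ.label (Sum.inr ⟨q₀.node, i, h₂⟩) = 1 := by
          intro i h₁ h₂
          have hi : i < 2 := by simpa [ht] using h₁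
          have hi : i = 0 ∨ i = 1 := by omega
          rcases hi with rfl | rfl
          · have e : (⟨q₀.node, 0, h₂⟩ : Port Δ.bot) = q₀ := Port.ext rfl q0.symm
            rw [e, hw₀, hl₀]
            exact ⟨rfl, rfl⟩
          · have e : (⟨q₀.node, 1, h₂⟩ : Port Δ.bot) = q₁ := Port.ext en.symm q1.symm
            rw [e, hw₁, hl₁]
            exact ⟨rfl, rfl⟩
        exact hΔ q.node q₀.node ⟨ht.trans hb₀.symm, ht₀.trans hb.symm,
          fun i h₁ h₂ => (key i h₁ h₂).1,
          fun i h₂ => (key i (by rw [ht]; rw [hb₀] at h₂; exact h₂) h₂).2⟩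
    refine ⟨form, ?_⟩
    rintro (i | q) (j | q') h h' e
    · exact congrArg _ (Subsingleton.elim (α := Fin 1) i j)
    · rw [hv.val_inl_var] at e
      exact absurd (by rw [← e]; rfl) (form q' h').ne_var
    · rw [hv.val_inl_var] at e
      exact absurd (by rw [e]; rfl) (form q h).ne_var
    · have h : δ q.node ≤ n := Nat.le_of_succ_le_succ h
      have h' : δ q'.node ≤ n := Nat.le_of_succ_le_succ h'
      have e := congrArg NormalTerm.val e
      -- Without cancellation the outermost constructor tells the kind of transistor and the output
      -- position, and its argument identifies an input wire, hence the transistor.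
      rcases form q (Nat.lt_succ_of_le h) with ⟨r, hr, ht, hb, -, hq⟩ |
          ⟨r, r', hr, -, -, hb, -, -, hq⟩ <;>
        rcases form q' (Nat.lt_succ_of_le h') with ⟨s, hs, ht', hb', -, hq'⟩ |
          ⟨s, s', hs, -, -, hb', -, -, hq'⟩ <;>
        rw [hq, hq'] at e
      · injection e with e1 e2
        have e := linj r s (by rw [hr]; exact h) (by rw [hs]; exact h') (NormalTerm.ext e2)
        congr 1
        refine Port.ext (by rw [← hr, ← hs, e]) ?_
        have h1 : q.idx < 2 := by simpa [hb] using q.lt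
        have h2 : q'.idx < 2 := by simpa [hb'] using q'.lt
        have h3 : q.idx = 1 ↔ q'.idx = 1 := by simpa using e1
        omega
      · cases e
      · cases e
      · injection e with e1 e2
        have e := linj r s (by rw [hr]; exact h) (by rw [hs]; exact h') (NormalTerm.ext e1)
        congr 1
        refine Port.ext (by rw [← hr, ← hs, e]) ?_
        have h1 : q.idx = 0 := by simpa [hb] using q.lt
        have h2 : q'.idx = 0 := by simpa [hb'] using q'.lt
        rw [h1, h2]

/-- A reduced diagram which fixes the variable is trivial. -/
theorem IsReduced.iso_trivial (hΔ : Δ.IsReduced)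
    (h : sem (thompsonAlgebra A) Δ [var] = [var]) : Iso Δ (trivial [()]) := by
  obtain ⟨val, hv⟩ := exists_isVal (thompsonAlgebra A) Δ (L := [var]) rfl
  have hf := hv.formal hΔ
  rw [hv.sem_eq] at h
  have hlow : lower (thompsonAlgebra A) Δ val (Sum.inl 0) = var := by
    have := List.getElem_of_eq h (i := 0) (by simp [frameOutput])
    simpa [frameOutput] using this
  obtain ⟨p, hp⟩ := Δ.wire.surjective (Sum.inl 0)
  rw [← hp, lower_wire] at hlow
  have nv : (var : NormalTerm A).NotLab := by
    intro s y h
    cases h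
  have nl : (val p).NotLab := by
    rcases p with i | q
    · rw [hv.val_inl_var]
      exact nv
    · exact (hf q).notLab
  have hl : Δ.label p = 1 := eq_one_of_act nl (by
    rw [show act (Δ.label p) (val p) = var from hlow]
    exact nv)
  -- The outputs of transistors are projections or pairs, never the variable, so the wire reaching
  -- the bottom of the frame starts at its top.
  have hp0 : ∃ i, p = Sum.inl i := by
    rcases p with i | q
    · exact ⟨i, rfl⟩
    · rw [hl] at hlow
      have : val (Sum.inr q) = var := (act_one _).symm.trans hlow
      exact absurd (by rw [this]; rfl) (hf q).ne_var
  obtain ⟨i, rfl⟩ := hp0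
  have hi : ∀ j : Fin [()].length, j = i := fun j => Subsingleton.elim (α := Fin 1) _ _
  -- A chain of wires going up from a transistor would end at the only wire on the top of the frame,
  -- but that wire goes straight to the bottom.
  have hE : ∀ t : Δ.T, False := by
    intro t
    induction t using node_induction Δ with
    | h t ih =>
      have h0 := List.length_pos_iff.2 (Δ.top_ne_nil t)
      obtain ⟨p', hp'⟩ := Δ.wire.surjective (Sum.inr ⟨t, 0, h0⟩)
      rcases p' with j | q
      · rw [hi j, hp] at hp'
        cases hp'
      · exact ih q _ hp' rfl
  have : IsEmpty Δ.T := ⟨hE⟩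
  refine ⟨Equiv.equivEmpty Δ.T, fun t => (hE t).elim, fun t => (hE t).elim, ?_⟩
  rintro (j | q)
  · rw [hi j, hp, hl, ← hi 0]
    exact ⟨rfl, rfl⟩
  · exact (hE q.node).elim

end faithful

end BraidedDiagram

/-! ### The action of diagrams over `P` on normal terms -/

section presentation

variable {S : Type u} {P : SemigroupPresentation S} {A : Type v} (ι : P.rels → A)

open Classical in
/-- The letter which encodes a transistor with top word `u` and bottom word `v`. -/
noncomputable def relLetter (u v : List S) : Option (A × Bool) :=
  if h : (u, v) ∈ P.rels then some (ι ⟨_, h⟩, true)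
  else if h : (v, u) ∈ P.rels then some (ι ⟨_, h⟩, false) else none

/-- By asymmetry of the relations only one of the two orientations lies in `P.rels`, so reversing a
transistor inverts its letter. -/
theorem exists_relLetter {u v : List S} (h : (u, v) ∈ P.rels ∨ (v, u) ∈ P.rels) :
    ∃ s, relLetter ι u v = some s ∧ relLetter ι v u = some (letterInv s) := by
  rcases h with h | h
  · exact ⟨_, dif_pos h, by rw [relLetter, dif_neg (P.asymm _ _ h), dif_pos h]; rfl⟩
  · exact ⟨(ι ⟨_, h⟩, false), by rw [relLetter, dif_neg (P.asymm _ _ h), dif_pos h], dif_pos h⟩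

-- The generator determines the relation because ι is injective, and the sign determines its
-- orientation.
variable {ι} in
theorem relLetter_injective (hι : Function.Injective ι) {u v u' v' : List S} {s : A × Bool}
    (h : relLetter ι u v = some s) (h' : relLetter ι u' v' = some s) : u = u' ∧ v = v' := by
  unfold relLetter at h h'
  split_ifs at h with h1 h2 <;> split_ifs at h' with h3 h4
  all_goals
    have e := Option.some_injective _ (h.trans h'.symm)
    simp only [Prod.mk.injEq, reduceCtorEq, and_false, and_true] at e
  all_goals
    have e := congrArg Subtype.val (hι e)
    simp only [Prod.mk.injEq] at e
  · exact e
  · exact e.symm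

/-- Apply the letter of a relation to the first entry. -/
noncomputable def relHead (u v : List S) (L : List (NormalTerm A)) : List (NormalTerm A) :=
  (relLetter ι u v).elim L fun s => labHead s L

@[simp] theorem length_relHead (u v : List S) (L : List (NormalTerm A)) :
    (relHead ι u v L).length = L.length := by
  unfold relHead
  cases relLetter ι u v <;> simp

/-- Normal terms as an algebra for the presentation `P`: a transistor merges its inputs, applies a
letter and splits the result. -/
noncomputable def presentationAlgebra : WireAlgebra P PUnit.{1} (NormalTerm A) where
  -- It takes n − 1 binary merges to turn n values into one, and n − 1 splittings to turn one value
  -- into n.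
  op u v L := splitHead^[v.length - 1] (relHead ι u v (mergeHead^[u.length - 1] L))
  act _ x := x
  length_op := by
    intro u v h L hL
    have hu : 0 < u.length ∧ 0 < v.length := by
      rcases h with h | h
      · exact ⟨List.length_pos_iff.2 (P.ne_nil _ h).1, List.length_pos_iff.2 (P.ne_nil _ h).2⟩
      · exact ⟨List.length_pos_iff.2 (P.ne_nil _ h).2, List.length_pos_iff.2 (P.ne_nil _ h).1⟩
    have h1 : (relHead ι u v (mergeHead^[u.length - 1] L)).length = 1 := by
      rw [length_relHead, length_iterate_mergeHead (by omega)]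
      omega
    rw [length_iterate_splitHead (List.length_pos_iff.1 (by omega)), h1]
    omega
  op_op := by
    intro u v h L hL
    have hu : 0 < u.length := by
      rcases h with h | h
      · exact List.length_pos_iff.2 (P.ne_nil _ h).1
      · exact List.length_pos_iff.2 (P.ne_nil _ h).2
    obtain ⟨s, h1, h2⟩ := exists_relLetter ι h
    rw [iterate_mergeHead_splitHead]
    simp only [relHead, h1, h2, Option.elim_some]
    rw [labHead_labHead, iterate_splitHead_mergeHead (by omega)]
  act_one _ := rfl
  act_mul _ _ _ := rfl

end presentation

/-! ### Reduced diagrams over `P` and the traces of their transistors -/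

namespace BraidedDiagram

variable {S : Type u} {P : SemigroupPresentation S} {A : Type v} {ι : P.rels → A}
  {w : List S} {Δ : BraidedDiagram P PUnit.{1} w w}

/-- The variable, split into as many terms as there are letters in `w`. -/
noncomputable def splitVar (A : Type v) (w : List S) : List (NormalTerm A) :=
  splitHead^[w.length - 1] [var]

theorem length_splitVar (hw : w ≠ []) : (splitVar A w).length = w.length := by
  have := List.length_pos_iff.2 hw
  rw [splitVar, length_iterate_splitHead (by simp), List.length_singleton]
  omega

/-- Merging back to the variable does not change the subterms that begin with a letter. -/
theorem labSubs_splitVar : labSubs (splitVar A w) = ∅ := by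
  have h : labSubs ([var] : List (NormalTerm A)) = ∅ := by
    ext z
    simp [labSubs, labSub, var, WireTerm.labSub]
  rw [← h, splitVar]
  conv_rhs => rw [← iterate_mergeHead_splitHead (w.length - 1) [var], labSubs_iterate_mergeHead]

theorem lower_wire_presentation (val : Ends w Δ.bot → NormalTerm A) (p : Ends w Δ.bot) :
    lower (presentationAlgebra ι) Δ val (Δ.wire p) = val p := lower_wire _ _ _ _

theorem bot_ne_nil (t : Δ.T) : Δ.bot t ≠ [] := top_ne_nil (inverse Δ) t

/-- The inputs and outputs of a transistor are the splittings of a term and of the term obtained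
from it by applying a letter. -/
theorem IsVal.exists_core {L : List (NormalTerm A)} {val : Ends w Δ.bot → NormalTerm A}
    (hv : IsVal (presentationAlgebra ι) Δ L val) (t : Δ.T) : ∃ (s : A × Bool) (x : NormalTerm A),
      relLetter ι (Δ.top t) (Δ.bot t) = some s ∧
      relLetter ι (Δ.bot t) (Δ.top t) = some (letterInv s) ∧
      inputs (presentationAlgebra ι) Δ val t = splitHead^[(Δ.top t).length - 1] [x] ∧
      outputs Δ val t = splitHead^[(Δ.bot t).length - 1] [lab s x] := by
  have ht := List.length_pos_iff.2 (Δ.top_ne_nil t)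
  obtain ⟨s, h1, h2⟩ := exists_relLetter ι (Δ.rel t)
  have h3 : (mergeHead^[(Δ.top t).length - 1]
      (inputs (presentationAlgebra ι) Δ val t)).length = 1 := by
    rw [length_iterate_mergeHead (by rw [length_inputs]; omega), length_inputs]
    omega
  obtain ⟨x, hx⟩ := List.length_eq_one_iff.1 h3
  refine ⟨s, x, h1, h2, ?_, ?_⟩
  · rw [← hx, iterate_splitHead_mergeHead (by rw [length_inputs]; omega)]
  · rw [hv.node]
    show splitHead^[_] (relHead ι _ _ _) = _
    rw [hx, relHead, h1]
    rfl

/-- In a reduced diagram with generic input no letter is cancelled, and different transistors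
produce different terms. -/
theorem IsVal.exists_terms (hι : Function.Injective ι) (hΔ : Δ.IsReduced)
    {val : Ends w Δ.bot → NormalTerm A}
    (hv : IsVal (presentationAlgebra ι) Δ (splitVar A w) val) :
    ∃ (s : Δ.T → A × Bool) (x m : Δ.T → NormalTerm A), Function.Injective m ∧ ∀ t,
      (m t).val = .lab (s t) (x t).val ∧
      inputs (presentationAlgebra ι) Δ val t = splitHead^[(Δ.top t).length - 1] [x t] ∧
      outputs Δ val t = splitHead^[(Δ.bot t).length - 1] [m t] := by
  choose s x hs hs' hin hout using fun t => hv.exists_core t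
  obtain ⟨δ, hδ⟩ := exists_depth Δ
  obtain ⟨M, hM⟩ := exists_bound δ
  let dE : Ends w Δ.bot → ℕ := Sum.elim (fun _ => 0) (fun q => δ q.node + 1)
  -- As for ⟨x ∣ x = x²⟩, the absence of cancellations and the injectivity are proved by a joint
  -- induction on depth.
  suffices H : ∀ n, (∀ t, δ t < n → (lab (s t) (x t)).val = .lab (s t) (x t).val) ∧
      ∀ t t', δ t < n → δ t' < n → lab (s t) (x t) = lab (s t') (x t') → t = t' from
    ⟨s, x, fun t => lab (s t) (x t), fun t t' h => (H (M + 1)).2 t t' (Nat.lt_succ_of_le (hM _))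
      (Nat.lt_succ_of_le (hM _)) h,
      fun t => ⟨(H (M + 1)).1 t (Nat.lt_succ_of_le (hM _)), hin t, hout t⟩⟩
  have dlt : ∀ p r, Δ.wire p = Sum.inr r → dE p ≤ δ r.node := by
    rintro (i | q) r h
    · exact Nat.zero_le _
    · exact hδ q r h
  have val_inr : ∀ q : Port Δ.bot, ∃ h, val (Sum.inr q) =
      (splitHead^[(Δ.bot q.node).length - 1] [lab (s q.node) (x q.node)])[q.idx]'h := by
    intro q
    have h4 : q.idx < (outputs Δ val q.node).length := by simpa [outputs] using q.lt
    have h5 : (outputs Δ val q.node)[q.idx] = val (Sum.inr q) := by simp [outputs]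
    exact ⟨hout q.node ▸ h4, by rw [← h5, List.getElem_of_eq (hout q.node)]⟩
  have low : ∀ r : Port Δ.top, ∃ h, lower (presentationAlgebra ι) Δ val (Sum.inr r) =
      (splitHead^[(Δ.top r.node).length - 1] [x r.node])[r.idx]'h := by
    intro r
    have h4 : r.idx < (inputs (presentationAlgebra ι) Δ val r.node).length := by simpa using r.lt
    have h5 : (inputs (presentationAlgebra ι) Δ val r.node)[r.idx] =
        lower (presentationAlgebra ι) Δ val (Sum.inr r) := by simp [inputs]
    exact ⟨hin r.node ▸ h4, by rw [← h5, List.getElem_of_eq (hin r.node)]⟩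
  have val_inl : ∀ i, ∃ h, val (Sum.inl i) = (splitHead^[w.length - 1] [var])[i.1]'h :=
    fun i => ⟨_, hv.val_inl i⟩
  intro n
  induction n with
  | zero =>
    exact ⟨fun t h => absurd h (Nat.not_lt_zero _), fun t t' h => absurd h (Nat.not_lt_zero _)⟩
  | succ n ih =>
    obtain ⟨ih1, ih2⟩ := ih
    have nvar : ∀ t, δ t < n → (var : NormalTerm A) ≠ lab (s t) (x t) := by
      intro t ht h
      have h := congrArg NormalTerm.val h
      rw [ih1 t ht] at h
      cases h
    -- Each such value is an entry in the splitting of an atom. The atom distinguishes the frame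
    -- from the transistors and these from each other; once the splitting is known, the entry gives
    -- the position.
    have inj : ∀ p p', dE p ≤ n → dE p' ≤ n → val p = val p' → p = p' := by
      rintro (i | q) (j | q') h h' e
      · obtain ⟨hi, ei⟩ := val_inl i
        obtain ⟨hj, ej⟩ := val_inl j
        rw [ei, ej] at e
        exact congrArg _ (Fin.ext ((atom_var.getElem_injective atom_var hi hj e).2.2 rfl))
      · obtain ⟨hi, ei⟩ := val_inl i
        obtain ⟨hj, ej⟩ := val_inr q'
        rw [ei, ej] at e
        exact absurd (atom_var.getElem_injective (atom_of_eq_lab (ih1 _ h')) hi hj e).1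
          (nvar _ h')
      · obtain ⟨hi, ei⟩ := val_inr q
        obtain ⟨hj, ej⟩ := val_inl j
        rw [ei, ej] at e
        exact absurd ((atom_of_eq_lab (ih1 _ h)).getElem_injective atom_var hi hj e).1.symm
          (nvar _ h)
      · obtain ⟨hi, ei⟩ := val_inr q
        obtain ⟨hj, ej⟩ := val_inr q'
        rw [ei, ej] at e
        obtain ⟨e1, -, e3⟩ := (atom_of_eq_lab (ih1 _ h)).getElem_injective
          (atom_of_eq_lab (ih1 _ h')) hi hj e
        have e1 := ih2 _ _ h h' e1
        exact congrArg _ (Port.ext e1 (e3 (by rw [e1])))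
    have linj : ∀ r r' : Port Δ.top, δ r.node ≤ n → δ r'.node ≤ n →
        lower (presentationAlgebra ι) Δ val (Sum.inr r) =
          lower (presentationAlgebra ι) Δ val (Sum.inr r') → r = r' := by
      intro r r' h h' e
      obtain ⟨p, hp⟩ := Δ.wire.surjective (Sum.inr r)
      obtain ⟨p', hp'⟩ := Δ.wire.surjective (Sum.inr r')
      have d := (dlt _ _ hp).trans h
      have d' := (dlt _ _ hp').trans h'
      rw [← hp, ← hp', lower_wire_presentation, lower_wire_presentation] at e
      have := inj p p' d d' e
      subst this
      exact Sum.inr_injective (hp.symm.trans hp')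
    have form : ∀ t, δ t < n + 1 → (lab (s t) (x t)).val = .lab (s t) (x t).val := by
      intro t ht
      have ht : δ t ≤ n := Nat.le_of_lt_succ ht
      -- Suppose the letter cancels. Then `x t` begins with a letter, and so all inputs of t, being
      -- entries of its splitting, come from transistors producing that same term.
      refine val_lab fun y hy => ?_
      have hx : (x t).Atom := atom_of_eq_lab hy
      have src : ∀ i (h : i < (Δ.top t).length), ∃ q : Port Δ.bot,
          Δ.wire (Sum.inr q) = Sum.inr ⟨t, i, h⟩ ∧ δ q.node < n ∧
          x t = lab (s q.node) (x q.node) ∧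
          (i = 0 → q.idx = 0 ∧ (Δ.top t).length - 1 = (Δ.bot q.node).length - 1) ∧
          ((Δ.top t).length - 1 = (Δ.bot q.node).length - 1 → i = q.idx) := by
        intro i h
        obtain ⟨p, hp⟩ := Δ.wire.surjective (Sum.inr ⟨t, i, h⟩)
        obtain ⟨hl, el⟩ := low ⟨t, i, h⟩
        rw [← hp, lower_wire_presentation] at el
        have d := (dlt _ _ hp).trans ht
        rcases p with j | q
        · obtain ⟨hj, ej⟩ := val_inl j
          rw [ej] at el
          have := (atom_var.getElem_injective hx hj hl el).1
          rw [← this] at hy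
          cases hy
        · obtain ⟨hj, ej⟩ := val_inr q
          rw [ej] at el
          obtain ⟨h1, h2, h3⟩ := hx.getElem_injective (atom_of_eq_lab (ih1 _ d)) hl hj el.symm
          exact ⟨q, hp, d, h1, h2, h3⟩
      obtain ⟨q₀, hw₀, hd₀, hx₀, hi₀, -⟩ := src 0 (List.length_pos_iff.2 (Δ.top_ne_nil t))
      have hs₀ : s q₀.node = letterInv (s t) := by
        have h := ih1 _ hd₀
        rw [← hx₀, hy] at h
        injection h with h
        exact h.symm
      have hr := hs q₀.node
      rw [hs₀] at hr
      -- The transistor above carries the inverse letter, hence the same relation in the opposite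
      -- orientation.
      obtain ⟨r1, r2⟩ := relLetter_injective hι hr (hs' t)
      refine hΔ t q₀.node ⟨r2.symm, r1, fun i h₁ h₂ => ?_, fun _ _ => rfl⟩
      -- By the induction hypothesis the source of each input is the same transistor, and equal
      -- splitting sizes force equal positions: the wires are parallel, which gives a dipole.
      obtain ⟨q, hw, hd, hxq, -, hi⟩ := src i h₁
      have e := ih2 _ _ hd hd₀ (hxq.symm.trans hx₀)
      rw [← hw]
      congr 2
      exact Port.ext e.symm (hi (by rw [e, r2]))
    refine ⟨form, fun t t' h h' e => ?_⟩
    have e' := congrArg NormalTerm.val e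
    rw [form t h, form t' h'] at e'
    -- Equal letters give equal top words, and equal arguments then give equal values at the first
    -- inputs. Since values on different wires differ, these inputs belong to the same transistor.
    injection e' with e1 e2
    have ht' := hs t'
    rw [← e1] at ht'
    obtain ⟨r1, -⟩ := relLetter_injective hι (hs t) ht'
    have h0 := List.length_pos_iff.2 (Δ.top_ne_nil t)
    have h0' := List.length_pos_iff.2 (Δ.top_ne_nil t')
    have := linj ⟨t, 0, h0⟩ ⟨t', 0, h0'⟩ (Nat.le_of_lt_succ h) (Nat.le_of_lt_succ h') (by
      obtain ⟨_, el⟩ := low ⟨t, 0, h0⟩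
      obtain ⟨_, el'⟩ := low ⟨t', 0, h0'⟩
      rw [el, el']
      refine List.getElem_of_eq ?_ _
      rw [r1, NormalTerm.ext e2])
    exact congrArg Port.node this

/-- The transistors of a reduced diagram are detected by different subterms of the output. -/
theorem IsReduced.exists_labSubs (hι : Function.Injective ι) (hΔ : Δ.IsReduced) (hw : w ≠ []) :
    ∃ m : Δ.T → WireTerm A, Function.Injective m ∧
      ∀ t, m t ∈ labSubs (sem (presentationAlgebra ι) Δ (splitVar A w)) := by
  obtain ⟨val, hv⟩ := exists_isVal (presentationAlgebra ι) Δ (length_splitVar hw)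
  obtain ⟨s, x, m, minj, hm⟩ := hv.exists_terms hι hΔ
  refine ⟨fun t => (m t).val, fun t t' h => minj (NormalTerm.ext h), ?_⟩
  rw [hv.sem_eq]
  have sub : ∀ t, labSub (x t) ⊆ labSub (m t) := by
    intro t
    rw [labSub, labSub, (hm t).1]
    exact Set.subset_insert _ _
  -- The trace of a transistor is followed downwards: it is contained in the trace of the next
  -- transistor, until the bottom of the frame is reached.
  have key : ∀ t, labSub (m t) ⊆ labSubs (frameOutput (presentationAlgebra ι) Δ val) := by
    intro t
    induction t using node_induction_up Δ with
    | h t ih =>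
      -- One outgoing wire is enough, because each entry of the splitting of an atom contains all of
      -- its subterms beginning with a letter.
      have h0 := List.length_pos_iff.2 (bot_ne_nil t)
      have h1 : labSub (val (Sum.inr ⟨t, 0, h0⟩)) = labSub (m t) := by
        have h4 : 0 < (outputs Δ val t).length := by simpa [outputs] using h0
        have h5 : (outputs Δ val t)[0] = val (Sum.inr ⟨t, 0, h0⟩) := by simp [outputs]
        rw [← h5, List.getElem_of_eq (hm t).2.2, (atom_of_eq_lab (hm t).1).labSub_getElem]
      rw [← h1]
      have h2 := lower_wire_presentation (ι := ι) val (Sum.inr ⟨t, 0, h0⟩)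
      rcases hq : Δ.wire (Sum.inr ⟨t, 0, h0⟩) with i | r
      · rw [hq] at h2
        intro z hz
        refine ⟨_, ?_, h2 ▸ hz⟩
        rw [frameOutput, List.mem_ofFn]
        exact ⟨i, rfl⟩
      · rw [hq] at h2
        refine Set.Subset.trans ?_ ((sub r.node).trans (ih _ r hq rfl))
        intro z hz
        have h3 : z ∈ labSubs (inputs (presentationAlgebra ι) Δ val r.node) := by
          refine ⟨_, ?_, h2 ▸ hz⟩
          rw [inputs, sideList, List.mem_ofFn]
          exact ⟨⟨r.idx, r.lt⟩, rfl⟩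
        rw [(hm r.node).2.1, ← labSubs_iterate_mergeHead _ ((Δ.top r.node).length - 1),
          iterate_mergeHead_splitHead] at h3
        obtain ⟨y, hy, hz⟩ := h3
        rw [List.mem_singleton] at hy
        exact hy ▸ hz
  intro t
  refine key t ?_
  show (m t).val ∈ _
  rw [labSub, (hm t).1]
  exact Set.mem_insert _ _

/-- A reduced diagram which fixes the generic input is trivial. -/
theorem IsReduced.iso_trivial_of_sem (hι : Function.Injective ι) (hΔ : Δ.IsReduced) (hw : w ≠ [])
    (h : sem (presentationAlgebra ι) Δ (splitVar A w) = splitVar A w) : Iso Δ (trivial w) := by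
  obtain ⟨m, -, hm⟩ := hΔ.exists_labSubs hι hw
  have hE : ∀ t : Δ.T, False := fun t => by
    have := hm t
    rw [h, labSubs_splitVar] at this
    exact this
  have : IsEmpty Δ.T := ⟨hE⟩
  obtain ⟨val, hv⟩ := exists_isVal (presentationAlgebra ι) Δ (length_splitVar hw)
  rw [hv.sem_eq] at h
  refine ⟨Equiv.equivEmpty Δ.T, fun t => (hE t).elim, fun t => (hE t).elim, ?_⟩
  rintro (i | q)
  · refine ⟨?_, rfl⟩
    rcases hj : Δ.wire (Sum.inl i) with j | q
    · have h1 := lower_wire_presentation (ι := ι) val (Sum.inl i)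
      rw [hj, hv.val_inl] at h1
      have h2 := List.getElem_of_eq h (i := j) (by simp [frameOutput])
      simp only [frameOutput, List.getElem_ofFn, Fin.eta] at h2
      rw [h2] at h1
      -- The entries of `splitVar` are pairwise distinct, so an unchanged output leaves no room for
      -- a permutation of the wires.
      have := (atom_var.getElem_injective atom_var _ _ h1).2.2 rfl
      exact congrArg Sum.inl (Fin.ext this.symm)
    · exact (hE q.node).elim
  · exact (hE q.node).elim

end BraidedDiagram

/-! ### The cost of diagrams over ⟨x ∣ x = x²⟩ -/

namespace BraidedDiagram

variable {A : Type v}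

/-- The length of a word in the free group. -/
noncomputable def wordLength (k : FreeGroup A) : ℕ := @FreeGroup.norm A (Classical.decEq A) k

@[simp] theorem wordLength_one : wordLength (1 : FreeGroup A) = 0 := by
  classical
  exact FreeGroup.norm_one

theorem wordLength_mul_le (k l : FreeGroup A) :
    wordLength (k * l) ≤ wordLength k + wordLength l := by
  classical
  exact FreeGroup.norm_mul_le k l

theorem cost_eq {a b : List Unit} (Δ : BraidedDiagram thompsonPresentation (FreeGroup A) a b)
    [Fintype (Ends a Δ.bot)] : cost Δ = Nat.card Δ.T + ∑ p, wordLength (Δ.label p) := by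
  rw [cost, finsum_eq_sum_of_fintype]
  rfl

variable {a b c : List Unit}

/-- Word length is subadditive, and each wire from the top frame of the lower diagram is joined to
exactly one wire of the upper diagram. -/
theorem cost_comp_le (Δ₁ : BraidedDiagram thompsonPresentation (FreeGroup A) a b)
    (Δ₂ : BraidedDiagram thompsonPresentation (FreeGroup A) b c) :
    cost (comp Δ₁ Δ₂) ≤ cost Δ₁ + cost Δ₂ := by
  classical
  have := Fintype.ofFinite (Ends a Δ₁.bot)
  have := Fintype.ofFinite (Port Δ₂.bot)
  have := Fintype.ofFinite (Port Δ₁.top)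
  have := Fintype.ofFinite (Ends a (comp Δ₁ Δ₂).bot)
  rw [cost_eq, cost_eq, cost_eq]
  have hT : Nat.card (comp Δ₁ Δ₂).T = Nat.card Δ₁.T + Nat.card Δ₂.T := Nat.card_sum
  let e : Ends a Δ₁.bot ⊕ Port Δ₂.bot ≃ Ends a (comp Δ₁ Δ₂).bot :=
    (Equiv.sumAssoc _ _ _).trans (Equiv.sumCongr (Equiv.refl _) (portSum Δ₁.bot Δ₂.bot).symm)
  have e1 : ∀ p, e (Sum.inl p) = upO Δ₁ Δ₂ p := by rintro (i | q) <;> rfl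
  have e2 : ∀ q, e (Sum.inr q) = loO Δ₁ Δ₂ q := fun _ => rfl
  let G : Ends b Δ₁.top → ℕ := Sum.elim (fun i => wordLength (Δ₂.label (Sum.inl i))) (fun _ => 0)
  have h1 : ∀ p, wordLength ((comp Δ₁ Δ₂).label (upO Δ₁ Δ₂ p)) ≤
      wordLength (Δ₁.label p) + G (Δ₁.wire p) := by
    intro p
    rcases hq : Δ₁.wire p with i | q
    · rw [label_upO_inl _ _ hq]
      exact wordLength_mul_le _ _
    · rw [label_upO_inr _ _ hq]
      exact Nat.le_add_right _ _
  have h2 : ∑ p, wordLength ((comp Δ₁ Δ₂).label (upO Δ₁ Δ₂ p)) ≤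
      ∑ p, wordLength (Δ₁.label p) + ∑ i, wordLength (Δ₂.label (Sum.inl i)) := by
    refine (Finset.sum_le_sum fun p _ => h1 p).trans ?_
    rw [Finset.sum_add_distrib, Equiv.sum_comp Δ₁.wire G, Fintype.sum_sum_type]
    simp [G]
  have h3 : ∑ q, wordLength ((comp Δ₁ Δ₂).label (loO Δ₁ Δ₂ q)) =
      ∑ q, wordLength (Δ₂.label (Sum.inr q)) :=
    Finset.sum_congr rfl fun q _ => congrArg _ (label_loO Δ₁ Δ₂ q)
  have h4 : ∑ p, wordLength ((comp Δ₁ Δ₂).label p) =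
      ∑ p, wordLength ((comp Δ₁ Δ₂).label (upO Δ₁ Δ₂ p)) +
        ∑ q, wordLength ((comp Δ₁ Δ₂).label (loO Δ₁ Δ₂ q)) := by
    rw [← Equiv.sum_comp e, Fintype.sum_sum_type]
    exact congrArg₂ _ (Finset.sum_congr rfl fun p _ => by rw [e1]) rfl
  rw [hT, h4, h3, Fintype.sum_sum_type (fun p => wordLength (Δ₂.label p))]
  omega

/-- Two transistors disappear, and the length of each new label is charged to the wires that were
joined to form its wire. -/
theorem Step.cost_le {Δ Δ' : BraidedDiagram thompsonPresentation (FreeGroup A) a b}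
    (h : Step Δ Δ') : cost Δ' ≤ cost Δ := by
  classical
  obtain ⟨t₁, t₂, D, e, ht, hb, inj, rng, H⟩ := h
  have := Fintype.ofFinite (Ends a Δ.bot)
  have := Fintype.ofFinite (Ends a Δ'.bot)
  rw [cost_eq, cost_eq]
  refine Nat.add_le_add (card_lt_of_range inj rng).le ?_
  -- `R p'` contains the wires of Δ making up the wire p': one, or two if it passed through the
  -- dipole. These sets are pairwise disjoint.
  let R : Ends a Δ'.bot → Finset (Ends a Δ.bot) := fun p' => Finset.univ.filter fun p =>
    p = Ends.map e hb p' ∨ ∃ i h h', Δ.wire (Ends.map e hb p') = Sum.inr ⟨t₂, i, h⟩ ∧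
      p = Sum.inr ⟨t₁, i, h'⟩
  have ne : ∀ (p' : Ends a Δ'.bot) i h, Ends.map e hb p' ≠ Sum.inr ⟨t₁, i, h⟩ := by
    rintro (j | q) i h hc
    · cases hc
    · exact ((rng _).1 ⟨q.node, congrArg Port.node (Sum.inr_injective hc)⟩).1 rfl
  have disj : ((Finset.univ : Finset (Ends a Δ'.bot)) : Set (Ends a Δ'.bot)).PairwiseDisjoint R := by
    intro p' _ p'' _ hne
    refine Finset.disjoint_left.2 fun p h h' => hne ?_
    simp only [R, Finset.mem_filter, Finset.mem_univ, true_and] at h h'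
    apply map_injective hb inj
    rcases h with h | ⟨i, hi, hi', hw, h⟩ <;> rcases h' with h' | ⟨j, hj, hj', hw', h'⟩
    · exact h.symm.trans h'
    · exact absurd (h.symm.trans h') (ne _ _ _)
    · exact absurd (h'.symm.trans h) (ne _ _ _)
    · obtain rfl : i = j := congrArg Port.idx (Sum.inr_injective (h.symm.trans h'))
      exact Δ.wire.injective (hw.trans hw'.symm)
  have bound : ∀ p', wordLength (Δ'.label p') ≤ ∑ p ∈ R p', wordLength (Δ.label p) := by
    intro p'
    by_cases hit : ∃ i h, Δ.wire (Ends.map e hb p') = Sum.inr ⟨t₂, i, h⟩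
    · obtain ⟨i, h, hw⟩ := hit
      have h' : i < (Δ.bot t₁).length := by rw [← D.outer]; exact h
      rw [((H p').1 i h h' hw).2]
      refine (wordLength_mul_le _ _).trans ?_
      rw [← Finset.sum_pair (f := fun p => wordLength (Δ.label p)) (ne p' i h')]
      refine Finset.sum_le_sum_of_subset ?_
      intro p hp
      simp only [Finset.mem_insert, Finset.mem_singleton] at hp
      simp only [R, Finset.mem_filter, Finset.mem_univ, true_and]
      exact hp.imp_right fun hp => ⟨i, h, h', hw, hp⟩
    · push Not at hit
      rw [((H p').2 hit).2]
      refine Finset.single_le_sum (f := fun p => wordLength (Δ.label p)) (fun _ _ => Nat.zero_le _) ?_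
      simp [R]
  calc ∑ p', wordLength (Δ'.label p') ≤ ∑ p', ∑ p ∈ R p', wordLength (Δ.label p) :=
        Finset.sum_le_sum fun p' _ => bound p'
    _ = ∑ p ∈ Finset.univ.biUnion R, wordLength (Δ.label p) := (Finset.sum_biUnion disj).symm
    _ ≤ ∑ p, wordLength (Δ.label p) := Finset.sum_le_sum_of_subset (Finset.subset_univ _)

/-- The length refers to reduced diagrams; with this lemma it can be bounded by the cost of any
representative. -/
theorem exists_isReduced_cost_le (Δ : BraidedDiagram thompsonPresentation (FreeGroup A) a b) :
    ∃ Δ', IsReduced Δ' ∧ modDipoles _ _ a b Δ Δ' ∧ cost Δ' ≤ cost Δ := by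
  induction hn : Nat.card Δ.T using Nat.strong_induction_on generalizing Δ with
  | _ n ih =>
    by_cases h : IsReduced Δ
    · exact ⟨Δ, h, .refl _, le_rfl⟩
    · unfold IsReduced at h
      push Not at h
      obtain ⟨t₁, t₂, D⟩ := h
      obtain ⟨Δ', e, ht, hb, inj, rng, H⟩ := exists_step Δ D
      have hs : Step Δ Δ' := ⟨t₁, t₂, D, e, ht, hb, inj, rng, H⟩
      obtain ⟨Δ'', h1, h2, h3⟩ := ih _ (hn ▸ card_lt_of_range inj rng) Δ' rfl
      exact ⟨Δ'', h1, .trans _ _ _ (.rel _ _ (Or.inr hs)) h2, h3.trans hs.cost_le⟩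

/-! ### Elementary diagrams -/

/-- A diagram without transistors. -/
def wireDiagram (σ : Fin a.length ≃ Fin b.length) (l : Fin a.length → FreeGroup A) :
    BraidedDiagram thompsonPresentation (FreeGroup A) a b where
  T := Empty
  finite := inferInstance
  top := Empty.elim
  bot := Empty.elim
  rel := by rintro ⟨⟩
  wire := Equiv.sumCongr σ (Equiv.refl _)
  letter_wire := fun _ => rfl
  label := Sum.elim l fun p => p.node.elim
  acyclic := by rintro ⟨⟩

theorem cost_wireDiagram (σ : Fin a.length ≃ Fin b.length) (l : Fin a.length → FreeGroup A) :
    cost (wireDiagram σ l) = ∑ i, wordLength (l i) := by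
  have : IsEmpty (Port (wireDiagram σ l).bot) := ⟨fun p => p.node.elim⟩
  have := Fintype.ofFinite (Port (wireDiagram σ l).bot)
  rw [cost_eq, Fintype.sum_sum_type]
  have : Nat.card (wireDiagram σ l).T = 0 := Nat.card_of_isEmpty (α := Empty)
  simp [this]
  rfl

theorem getElem_sem_wireDiagram (σ : Fin a.length ≃ Fin b.length) (l : Fin a.length → FreeGroup A)
    {L : List (NormalTerm A)} (hL : L.length = a.length) (i : Fin a.length) :
    (sem (thompsonAlgebra A) (wireDiagram σ l) L)[(σ i).1]'(by
      rw [length_sem _ hL]; exact (σ i).2) = act (l i) (L[i.1]'(i.2.trans_eq hL.symm)) := by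
  obtain ⟨val, hv⟩ := exists_isVal (thompsonAlgebra A) (wireDiagram σ l) hL
  have h1 := lower_wire (thompsonAlgebra A) (wireDiagram σ l) val (Sum.inl i)
  rw [hv.val_inl] at h1
  simp only [hv.sem_eq, frameOutput, List.getElem_ofFn]
  exact h1

/-- The diagram which merges the first two wires. -/
def mergeDiagram (A : Type v) (l : List Unit) :
    BraidedDiagram thompsonPresentation (FreeGroup A) (() :: () :: l) (() :: l) where
  T := Unit
  finite := inferInstance
  top := fun _ => [(), ()]
  bot := fun _ => [()]
  rel := fun _ => by simp [thompsonPresentation]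
  wire :=
    { toFun := fun p => match p with
        | Sum.inl ⟨0, _⟩ => Sum.inr ⟨(), 0, by simp⟩
        | Sum.inl ⟨1, _⟩ => Sum.inr ⟨(), 1, by simp⟩
        | Sum.inl ⟨i + 2, h⟩ => Sum.inl ⟨i + 1, Nat.lt_of_succ_lt_succ h⟩
        | Sum.inr _ => Sum.inl ⟨0, Nat.succ_pos _⟩
      invFun := fun p => match p with
        | Sum.inl ⟨0, _⟩ => Sum.inr ⟨(), 0, by simp⟩
        | Sum.inl ⟨i + 1, h⟩ => Sum.inl ⟨i + 2, Nat.succ_lt_succ h⟩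
        | Sum.inr r => Sum.inl ⟨r.idx, r.lt.trans_le (by simp)⟩
      left_inv := by
        rintro (⟨_ | _ | i, h⟩ | ⟨⟨⟩, i, h⟩)
        · rfl
        · rfl
        · rfl
        · have : i = 0 := by simpa using h
          subst this
          rfl
      right_inv := by
        rintro (⟨_ | i, h⟩ | ⟨⟨⟩, _ | _ | i, h⟩)
        · rfl
        · rfl
        · rfl
        · rfl
        · simp at h }
  letter_wire := fun _ => rfl
  label := fun _ => 1
  acyclic := by
    refine acyclic_of_rank (fun _ => 0) ?_
    rintro x y ⟨i, hi, j, hj, h⟩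
    cases h

theorem cost_mergeDiagram (l : List Unit) : cost (mergeDiagram A l) = 1 := by
  have := Fintype.ofFinite (Ends (() :: () :: l) (mergeDiagram A l).bot)
  rw [cost_eq]
  have h1 : Nat.card (mergeDiagram A l).T = 1 := Nat.card_unique (α := Unit)
  have h2 : ∀ p, (mergeDiagram A l).label p = 1 := fun _ => rfl
  rw [h1, Finset.sum_eq_zero fun p _ => by rw [h2, wordLength_one], Nat.add_zero]

theorem cost_inverse_mergeDiagram (l : List Unit) : cost (inverse (mergeDiagram A l)) = 1 := by
  have := Fintype.ofFinite (Ends (() :: l) (inverse (mergeDiagram A l)).bot)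
  rw [cost_eq]
  have h1 : Nat.card (inverse (mergeDiagram A l)).T = 1 := Nat.card_unique (α := Unit)
  have h2 : ∀ p, (inverse (mergeDiagram A l)).label p = 1 := fun _ => inv_one
  rw [h1, Finset.sum_eq_zero fun p _ => by rw [h2, wordLength_one], Nat.add_zero]

theorem sem_mergeDiagram (l : List Unit) {L : List (NormalTerm A)}
    (hL : L.length = l.length + 2) :
    sem (thompsonAlgebra A) (mergeDiagram A l) L = mergeHead L := by
  rcases L with _ | ⟨x, _ | ⟨y, L⟩⟩
  · simp at hL
  · simp at hL
  have hL' : L.length = l.length := by simpa using hL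
  let val : Ends (() :: () :: l) (mergeDiagram A l).bot → NormalTerm A :=
    Sum.elim (fun i => (x :: y :: L)[i.1]'(i.2.trans_eq hL.symm)) (fun _ => pair x y)
  have hin : inputs (thompsonAlgebra A) (mergeDiagram A l) val () = [x, y] := by
    refine List.ext_getElem rfl fun i h h' => ?_
    rcases i with _ | _ | i
    · exact (lower_wire (thompsonAlgebra A) (mergeDiagram A l) val
        (Sum.inl ⟨0, by simp⟩)).trans (act_one _)
    · exact (lower_wire (thompsonAlgebra A) (mergeDiagram A l) val
        (Sum.inl ⟨1, by simp⟩)).trans (act_one _)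
    · simp at h'
  have hv : IsVal (thompsonAlgebra A) (mergeDiagram A l) (x :: y :: L) val := by
    refine ⟨List.ext_getElem (by simp [hL']) fun i h h' => by
      rw [List.getElem_ofFn]
      rfl, ?_⟩
    rintro ⟨⟩
    rw [hin]
    rfl
  rw [hv.sem_eq]
  refine List.ext_getElem (by simp [frameOutput, mergeHead, hL']) fun i h h' => ?_
  simp only [frameOutput, List.getElem_ofFn]
  rcases i with _ | i
  · exact (lower_wire (thompsonAlgebra A) (mergeDiagram A l) val
      (Sum.inr ⟨(), 0, by simp [mergeDiagram]⟩)).trans (act_one _)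
  · have hi : i + 2 < (() :: () :: l).length := by simpa [frameOutput] using h
    exact (lower_wire (thompsonAlgebra A) (mergeDiagram A l) val
      (Sum.inl ⟨i + 2, hi⟩)).trans (act_one _)

/-- The upside-down diagram acts by the inverse map, and every list of this length is the image
under `mergeHead` of its splitting. -/
theorem sem_inverse_mergeDiagram (l : List Unit) {L : List (NormalTerm A)}
    (hL : L.length = l.length + 1) :
    sem (thompsonAlgebra A) (inverse (mergeDiagram A l)) L = splitHead L := by
  have h0 : L ≠ [] := by
    rintro rfl
    simp at hL
  have h1 : (splitHead L).length = l.length + 2 := by rw [length_splitHead h0, hL]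
  have h2 := sem_mergeDiagram l h1
  rw [mergeHead_splitHead] at h2
  rw [← h2]
  exact (sem_inverse (𝔄 := thompsonAlgebra A) (mergeDiagram A l) h1).trans (by rw [h2])

/-! ### Realizable maps -/

/-- The map `F` on lists of length `k` is given by a diagram of cost at most `n`. -/
def Realizes (n k k' : ℕ) (F : List (NormalTerm A) → List (NormalTerm A)) : Prop :=
  ∃ D : BraidedDiagram thompsonPresentation (FreeGroup A) (List.replicate k ())
    (List.replicate k' ()), cost D ≤ n ∧ ∀ L, L.length = k → sem (thompsonAlgebra A) D L = F L

theorem Realizes.comp {n₁ n₂ k₁ k₂ k₃ : ℕ} {F G : List (NormalTerm A) → List (NormalTerm A)}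
    (hF : Realizes n₁ k₁ k₂ F) (hG : Realizes n₂ k₂ k₃ G) :
    Realizes (n₁ + n₂) k₁ k₃ fun L => G (F L) := by
  obtain ⟨D, hD, h⟩ := hF
  obtain ⟨E, hE, h'⟩ := hG
  refine ⟨BraidedDiagram.comp D E, (cost_comp_le D E).trans (Nat.add_le_add hD hE), fun L hL => ?_⟩
  rw [sem_comp _ _ (by simpa using hL), h' _ _, h L hL]
  rw [length_sem _ (by simpa using hL), List.length_replicate]

theorem Realizes.congr {n n' k k' : ℕ} {F G : List (NormalTerm A) → List (NormalTerm A)}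
    (hF : Realizes n k k' F) (hn : n ≤ n') (h : ∀ L, L.length = k → F L = G L) :
    Realizes n' k k' G := by
  obtain ⟨D, hD, hF⟩ := hF
  exact ⟨D, hD.trans hn, fun L hL => (hF L hL).trans (h L hL)⟩

/-- Wires may cross freely in a braided diagram, so a permutation needs no transistor and no label.
-/
theorem realizes_of_perm {k k' : ℕ} (σ : Fin k ≃ Fin k')
    {F : List (NormalTerm A) → List (NormalTerm A)}
    (h : ∀ L (hL : L.length = k), ∃ h' : (F L).length = k', ∀ i : Fin k,
      (F L)[(σ i).1]'((σ i).2.trans_eq h'.symm) = L[i.1]'(i.2.trans_eq hL.symm)) :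
    Realizes 0 k k' F := by
  let σ' : Fin (List.replicate k ()).length ≃ Fin (List.replicate k' ()).length :=
    ((finCongr List.length_replicate).trans σ).trans (finCongr List.length_replicate.symm)
  refine ⟨wireDiagram σ' fun _ => 1, by rw [cost_wireDiagram]; simp, fun L hL => ?_⟩
  have hL' : L.length = (List.replicate k ()).length := by simpa using hL
  obtain ⟨h1, h2⟩ := h L hL
  refine List.ext_getElem (by rw [length_sem _ hL', h1, List.length_replicate]) fun i h₁ h₂ => ?_
  have hi : i < (List.replicate k' ()).length := by rwa [List.length_replicate, ← h1]
  obtain ⟨j, hj⟩ := σ'.surjective ⟨i, hi⟩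
  have h3 := getElem_sem_wireDiagram σ' (fun _ => (1 : FreeGroup A)) hL' j
  have h4 := h2 ((finCongr List.length_replicate) j)
  have h5 : (σ ((finCongr List.length_replicate) j)).1 = i := congrArg Fin.val hj
  simp only [hj, h5, act_one] at h3 h4
  exact h3.trans h4.symm

theorem realizes_merge (k : ℕ) : Realizes 1 (k + 2) (k + 1) (mergeHead (A := A)) :=
  ⟨mergeDiagram A (List.replicate k ()), (cost_mergeDiagram _).le,
    fun _ hL => sem_mergeDiagram _ (by simpa using hL)⟩

theorem realizes_split (k : ℕ) : Realizes 1 (k + 1) (k + 2) (splitHead (A := A)) :=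
  ⟨inverse (mergeDiagram A (List.replicate k ())), (cost_inverse_mergeDiagram _).le,
    fun _ hL => sem_inverse_mergeDiagram _ (by simpa using hL)⟩

theorem realizes_lab (s : A × Bool) (k : ℕ) : Realizes 1 (k + 1) (k + 1) (labHead s) := by
  refine ⟨wireDiagram (Equiv.refl (Fin (() :: List.replicate k ()).length))
    (Fin.cons (FreeGroup.mk [s]) fun _ => 1), ?_, fun L hL => ?_⟩
  · rw [cost_wireDiagram]
    refine (Fin.sum_univ_succ _).trans_le ?_
    simp only [Fin.cons_zero, Fin.cons_succ, wordLength_one, Finset.sum_const_zero, add_zero]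
    classical
    exact FreeGroup.norm_mk_le
  · have hL' : L.length = (() :: List.replicate k ()).length := by simpa using hL
    refine List.ext_getElem ?_ fun i h₁ h₂ => ?_
    · rw [length_labHead]
      exact (length_sem _ hL').trans hL'.symm
    · rw [length_labHead, hL'] at h₂
      refine (getElem_sem_wireDiagram (Equiv.refl (Fin (() :: List.replicate k ()).length))
        (Fin.cons (FreeGroup.mk [s]) fun _ => 1) hL' ⟨i, h₂⟩).trans ?_
      rcases L with _ | ⟨x, L⟩
      · simp at hL
      rcases i with _ | i
      · exact act_mk [s] x
      · exact act_one _

theorem realizes_iterate_merge (j k : ℕ) :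
    Realizes j (k + 1 + j) (k + 1) (mergeHead (A := A))^[j] := by
  induction j with
  | zero => exact realizes_of_perm (Equiv.refl _) fun L hL => ⟨hL, fun _ => rfl⟩
  | succ j ih =>
    have h := (realizes_merge (A := A) (k + j))
    rw [show k + j + 2 = k + 1 + (j + 1) by omega, show k + j + 1 = k + 1 + j by omega] at h
    exact (h.comp ih).congr (by omega) fun _ _ => rfl

theorem realizes_iterate_split (j k : ℕ) :
    Realizes j (k + 1) (k + 1 + j) (splitHead (A := A))^[j] := by
  induction j with
  | zero => exact realizes_of_perm (Equiv.refl _) fun L hL => ⟨hL, fun _ => rfl⟩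
  | succ j ih =>
    have h := (realizes_split (A := A) (k + j))
    rw [show k + j + 2 = k + 1 + (j + 1) by omega, show k + j + 1 = k + 1 + j by omega] at h
    exact (ih.comp h).congr (by omega) fun _ _ => (Function.iterate_succ_apply' _ _ _).symm

/-- The entries of a family of lists can be rearranged at no cost. -/
theorem Realizes.map_of_perm {n k : ℕ} {E : Type*} {V : List (NormalTerm A) → E → NormalTerm A}
    {l l' : List E} (h : Realizes n k l.length fun L => l.map (V L)) (hl : l.Nodup)
    (hl' : l'.Nodup) (hm : ∀ p, p ∈ l ↔ p ∈ l') : Realizes n k l'.length fun L => l'.map (V L) := by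
  classical
  let σ : Fin l.length ≃ Fin l'.length := ((List.Nodup.getEquiv l hl).trans
    (Equiv.subtypeEquivRight hm)).trans (List.Nodup.getEquiv l' hl').symm
  have hσ : ∀ i, l'[(σ i).1] = l[i.1] := by
    intro i
    have : (List.Nodup.getEquiv l' hl') (σ i) =
        (Equiv.subtypeEquivRight hm) (List.Nodup.getEquiv l hl i) := by
      simp [σ]
    exact congrArg Subtype.val this
  obtain ⟨D, hD, h⟩ := h
  let σ' : Fin (List.replicate l.length ()).length ≃ Fin (List.replicate l'.length ()).length :=
    ((finCongr List.length_replicate).trans σ).trans (finCongr List.length_replicate.symm)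
  refine ⟨BraidedDiagram.comp D (wireDiagram σ' fun _ => 1), ?_, fun L hL => ?_⟩
  · refine (cost_comp_le _ _).trans ?_
    rw [cost_wireDiagram]
    simpa using hD
  · have hL' : (l.map (V L)).length = (List.replicate l.length ()).length := by simp
    rw [sem_comp _ _ (by simpa using hL), h L hL]
    refine List.ext_getElem (by rw [length_sem _ hL']; simp) fun i h₁ h₂ => ?_
    have hi : i < (List.replicate l'.length ()).length := by simpa using h₂
    obtain ⟨j, hj⟩ := σ'.surjective ⟨i, hi⟩
    have h3 := getElem_sem_wireDiagram σ' (fun _ => (1 : FreeGroup A)) hL' j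
    have h4 := hσ ((finCongr List.length_replicate) j)
    have h5 : (σ ((finCongr List.length_replicate) j)).1 = i := congrArg Fin.val hj
    simp only [hj, h5, act_one, List.getElem_map] at h3 h4 ⊢
    rw [h3, h4]
    rfl

end BraidedDiagram

/-! ### Redrawing a diagram over `P` with binary transistors and labels -/

namespace BraidedDiagram

variable {S : Type u} {P : SemigroupPresentation S} {A : Type v} {ι : P.rels → A}
  {w : List S} {Δ : BraidedDiagram P PUnit.{1} w w}

/-- The map defined by a diagram over `P` whose transistors carry at most `B` wires is given by a
diagram over `⟨x ∣ x = x²⟩` of cost at most `B` times the number of transistors. -/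
theorem exists_realizes (ι : P.rels → A) (Δ : BraidedDiagram P PUnit.{1} w w) {B : ℕ}
    (hB : ∀ t, (Δ.top t).length + (Δ.bot t).length ≤ B) :
    Realizes (B * Nat.card Δ.T) w.length w.length (sem (presentationAlgebra ι) Δ) := by
  classical
  have := Fintype.ofFinite Δ.T
  obtain ⟨δ, hδ⟩ := exists_depth Δ
  -- A valuation is chosen for every list, with an irrelevant one for wrong lengths, so that the
  -- values on any set of wires become functions of L.
  have hV : ∀ L : List (NormalTerm A), ∃ val : Ends w Δ.bot → NormalTerm A,
      L.length = w.length → IsVal (presentationAlgebra ι) Δ L val := by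
    intro L
    by_cases hL : L.length = w.length
    · obtain ⟨val, hv⟩ := exists_isVal (presentationAlgebra ι) Δ hL
      exact ⟨val, fun _ => hv⟩
    · exact ⟨fun _ => var, fun h => absurd h hL⟩
  choose V hV using hV
  -- The diagram is swept from top to bottom. U is an upwards closed set of n transistors already
  -- drawn, and l lists the wires crossing the cut below U; the claim is that the values on l can be
  -- computed from the input at cost B n.
  have key : ∀ n ≤ Fintype.card Δ.T, ∃ U : Finset Δ.T, U.card = n ∧
      (∀ q r, Δ.wire (Sum.inr q) = Sum.inr r → r.node ∈ U → q.node ∈ U) ∧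
      ∃ l : List (Ends w Δ.bot), l.Nodup ∧
        (∀ p, p ∈ l ↔ (∀ q, p = Sum.inr q → q.node ∈ U) ∧
          ∀ r, Δ.wire p = Sum.inr r → r.node ∉ U) ∧
        Realizes (B * n) w.length l.length fun L => l.map (V L) := by
    intro n
    induction n with
    | zero =>
      intro _
      refine ⟨∅, rfl, by simp, List.ofFn Sum.inl, ?_, ?_, ?_⟩
      · exact List.nodup_ofFn.2 Sum.inl_injective
      · rintro (i | q)
        · simp
        · simp
      · have h : Realizes 0 w.length w.length fun L : List (NormalTerm A) => L :=
          realizes_of_perm (Equiv.refl _) fun L hL => ⟨hL, fun _ => rfl⟩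
        rw [List.length_ofFn]
        refine h.congr (Nat.zero_le _) fun L hL => ?_
        rw [List.map_ofFn]
        exact (hV L hL).frame.symm
    | succ n ih =>
      intro hn
      obtain ⟨U, hU, hup, l, hl, hm, hR⟩ := ih (by omega)
      -- A remaining transistor of least depth has only transistors of U above it, so all its input
      -- wires cross the cut.
      obtain ⟨t, htU, hmin⟩ := Finset.exists_min_image Uᶜ δ
        (Finset.card_pos.1 (by rw [Finset.card_compl]; omega))
      rw [Finset.mem_compl] at htU
      have above : ∀ q r, Δ.wire (Sum.inr q) = Sum.inr r → r.node = t → q.node ∈ U := by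
        intro q r h hr
        by_contra hq
        have h1 := hmin q.node (Finset.mem_compl.2 hq)
        have h2 := hδ q r h
        rw [hr] at h2
        omega
      let pin : List (Ends w Δ.bot) := sideList Δ.top (fun r => Δ.wire.symm (Sum.inr r)) t
      let pout : List (Ends w Δ.bot) := sideList Δ.bot Sum.inr t
      let rest := l.filter fun p => p ∉ pin
      have mem_pin : ∀ p, p ∈ pin ↔ ∃ r : Port Δ.top, Δ.wire p = Sum.inr r ∧ r.node = t := by
        intro p
        simp only [pin, sideList, List.mem_ofFn]
        constructor
        · rintro ⟨i, rfl⟩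
          exact ⟨_, Equiv.apply_symm_apply _ _, rfl⟩
        · rintro ⟨⟨t', i, h⟩, h1, rfl⟩
          exact ⟨⟨i, h⟩, by rw [← h1, Equiv.symm_apply_apply]⟩
      have mem_pout : ∀ p, p ∈ pout ↔ ∃ q : Port Δ.bot, p = Sum.inr q ∧ q.node = t := by
        intro p
        simp only [pout, sideList, List.mem_ofFn]
        constructor
        · rintro ⟨i, rfl⟩
          exact ⟨_, rfl, rfl⟩
        · rintro ⟨⟨t', i, h⟩, rfl, rfl⟩
          exact ⟨⟨i, h⟩, rfl⟩
      have mem_rest : ∀ p, p ∈ rest ↔ p ∈ l ∧ p ∉ pin := fun p => by simp [rest]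
      have nodup_pin : pin.Nodup := by
        refine List.nodup_ofFn.2 fun i j h => ?_
        have h := Sum.inr_injective (Δ.wire.symm.injective h)
        exact Fin.ext (congrArg Port.idx h)
      have nodup_pout : pout.Nodup := by
        refine List.nodup_ofFn.2 fun i j h => ?_
        exact Fin.ext (congrArg Port.idx (Sum.inr_injective h))
      have nodup_rest : rest.Nodup := hl.filter _
      have pin_sub : ∀ p ∈ pin, p ∈ l := by
        intro p hp
        obtain ⟨r, hr, hrt⟩ := (mem_pin p).1 hp
        refine (hm p).2 ⟨?_, ?_⟩
        · rintro q rfl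
          exact above q r hr hrt
        · intro r' hr'
          rw [hr] at hr'
          rw [← Sum.inr_injective hr', hrt]
          exact htU
      have rest_node : ∀ p ∈ rest, ∀ q, p = Sum.inr q → q.node ∈ U := fun p hp =>
        ((hm p).1 ((mem_rest p).1 hp).1).1
      -- The inputs of t are moved to the front of the list, at no cost, because the elementary
      -- diagrams act there.
      have hR := hR.map_of_perm (l' := pin ++ rest) hl
        (List.nodup_append'.2 ⟨nodup_pin, nodup_rest,
          fun p h h' => ((mem_rest p).1 h').2 h⟩) (fun p => by
          rw [List.mem_append, mem_rest]
          constructor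
          · intro h
            by_cases hp : p ∈ pin
            · exact Or.inl hp
            · exact Or.inr ⟨h, hp⟩
          · rintro (h | h)
            · exact pin_sub p h
            · exact h.1)
      refine ⟨insert t U, by rw [Finset.card_insert_of_notMem htU, hU], ?_, pout ++ rest, ?_, ?_, ?_⟩
      · intro q r h hr
        rw [Finset.mem_insert] at hr ⊢
        rcases hr with hr | hr
        · exact Or.inr (above q r h hr)
        · exact Or.inr (hup q r h hr)
      · refine List.nodup_append'.2 ⟨nodup_pout, nodup_rest, fun p h h' => ?_⟩
        obtain ⟨q, hq, hqt⟩ := (mem_pout p).1 h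
        have := rest_node p h' q hq
        rw [hqt] at this
        exact htU this
      · intro p
        rw [List.mem_append, mem_pout, mem_rest, hm, mem_pin]
        constructor
        · rintro (⟨q, rfl, hq⟩ | ⟨⟨h1, h2⟩, h3⟩)
          · refine ⟨?_, ?_⟩
            · rintro q' h
              rw [← Sum.inr_injective h, hq]
              exact Finset.mem_insert_self _ _
            · intro r hr hc
              rw [Finset.mem_insert] at hc
              rcases hc with hc | hc
              · exact htU (hq ▸ above q r hr hc)
              · exact htU (hq ▸ hup q r hr hc)
          · refine ⟨fun q hq => Finset.mem_insert_of_mem (h1 q hq), fun r hr hc => ?_⟩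
            rw [Finset.mem_insert] at hc
            rcases hc with hc | hc
            · exact h3 ⟨r, hr, hc⟩
            · exact h2 r hr hc
        · rintro ⟨h1, h2⟩
          by_cases hp : ∃ q : Port Δ.bot, p = Sum.inr q ∧ q.node = t
          · exact Or.inl hp
          · refine Or.inr ⟨⟨fun q hq => ?_, fun r hr hc => h2 r hr (Finset.mem_insert_of_mem hc)⟩, ?_⟩
            · rcases Finset.mem_insert.1 (h1 q hq) with h | h
              · exact absurd ⟨q, hq, h⟩ hp
              · exact h
            · rintro ⟨r, hr, hc⟩
              exact h2 r hr (hc ▸ Finset.mem_insert_self _ _)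
      · have ht0 := List.length_pos_iff.2 (Δ.top_ne_nil t)
        have hb0 := List.length_pos_iff.2 (bot_ne_nil t)
        have lin : pin.length = (Δ.top t).length := length_sideList _ _
        have lout : pout.length = (Δ.bot t).length := length_sideList _ _
        obtain ⟨s, hs, -⟩ := exists_relLetter ι (Δ.rel t)
        have c1 := realizes_iterate_merge (A := A) ((Δ.top t).length - 1) rest.length
        rw [show rest.length + 1 + ((Δ.top t).length - 1) = (pin ++ rest).length by
          rw [List.length_append]; omega] at c1
        have c2 := realizes_lab s rest.length
        have c3 := realizes_iterate_split (A := A) ((Δ.bot t).length - 1) rest.length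
        rw [show rest.length + 1 + ((Δ.bot t).length - 1) = (pout ++ rest).length by
          rw [List.length_append]; omega] at c3
        refine (((hR.comp c1).comp c2).comp c3).congr ?_ fun L hL => ?_
        · have := hB t
          rw [Nat.mul_succ]
          omega
        · have hv := hV L hL
          have e1 : pin.map (V L) = inputs (presentationAlgebra ι) Δ (V L) t := by
            simp only [pin, inputs, sideList, List.map_ofFn]
            rfl
          have e2 : pout.map (V L) = outputs Δ (V L) t := by
            simp only [pout, outputs, sideList, List.map_ofFn]
            rfl
          have e3 : outputs Δ (V L) t = splitHead^[(Δ.bot t).length - 1]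
              (labHead s (mergeHead^[(Δ.top t).length - 1]
                (inputs (presentationAlgebra ι) Δ (V L) t))) := by
            rw [hv.node]
            show splitHead^[_] (relHead ι _ _ _) = _
            rw [relHead, hs]
            rfl
          have l1 : (inputs (presentationAlgebra ι) Δ (V L) t).length = (Δ.top t).length :=
            length_inputs _ _ _ _
          have l2 : (mergeHead^[(Δ.top t).length - 1]
              (inputs (presentationAlgebra ι) Δ (V L) t)).length = 1 := by
            rw [length_iterate_mergeHead (by omega)]
            omega
          simp only [List.map_append]
          rw [e1, e2, e3, iterate_mergeHead_append _ (by omega), labHead_append,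
            iterate_splitHead_append]
          · apply List.length_pos_iff.1
            rw [length_labHead]
            omega
          · apply List.length_pos_iff.1
            omega
  obtain ⟨U, hU, -, l, hl, hm, hR⟩ := key _ le_rfl
  have hU : U = Finset.univ := Finset.eq_univ_of_card _ hU
  -- Once all transistors are drawn, the cut consists of the wires ending on the bottom of the
  -- frame, which only have to be put in order.
  have hR := hR.map_of_perm (l' := List.ofFn fun i : Fin w.length => Δ.wire.symm (Sum.inl i)) hl
    (List.nodup_ofFn.2 (Δ.wire.symm.injective.comp Sum.inl_injective)) (fun p => by
      rw [hm, List.mem_ofFn, hU]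
      simp only [Finset.mem_univ, implies_true, true_and, not_true_eq_false]
      constructor
      · intro h
        rcases hq : Δ.wire p with i | r
        · exact ⟨i, by rw [← hq, Equiv.symm_apply_apply]⟩
        · exact absurd hq (h r)
      · rintro ⟨i, rfl⟩ r hr
        rw [Equiv.apply_symm_apply] at hr
        cases hr)
  rw [List.length_ofFn, ← Nat.card_eq_fintype_card] at hR
  refine hR.congr le_rfl fun L hL => ?_
  rw [(hV L hL).sem_eq, List.map_ofFn]
  rfl

end BraidedDiagram

/-! ### Evaluation of group elements -/

namespace BraidedPictureProduct

variable {S : Type u} {P : SemigroupPresentation S} {K : Type v} [Group K] {w : List S}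
  {N : Type*} (𝔄 : WireAlgebra P K N)

/-- The map on lists of values defined by an element of a braided picture product. -/
noncomputable def eval : BraidedPictureProduct P K w → List N → List N :=
  Quotient.lift (sem 𝔄) fun _ _ h => sem_eq_of_modDipoles h

variable {𝔄}

theorem eval_mk (Δ : BraidedDiagram P K w w) : eval 𝔄 (mk Δ) = sem 𝔄 Δ := rfl

theorem eval_mul (g h : BraidedPictureProduct P K w) {L : List N} (hL : L.length = w.length) :
    eval 𝔄 (g * h) L = eval 𝔄 h (eval 𝔄 g L) := by
  rcases g with ⟨Δ₁⟩
  rcases h with ⟨Δ₂⟩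
  exact sem_comp Δ₁ Δ₂ hL

theorem eval_one {L : List N} (hL : L.length = w.length) :
    eval 𝔄 (1 : BraidedPictureProduct P K w) L = L := sem_trivial hL

theorem length_eval (g : BraidedPictureProduct P K w) {L : List N} (hL : L.length = w.length) :
    (eval 𝔄 g L).length = w.length := by
  rcases g with ⟨Δ⟩
  exact length_sem Δ hL

theorem exists_isReduced_mk (g : BraidedPictureProduct P K w) :
    ∃ Δ : BraidedDiagram P K w w, Δ.IsReduced ∧ mk Δ = g := by
  rcases g with ⟨Δ⟩
  obtain ⟨Δ', h1, h2⟩ := exists_isReduced Δ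
  exact ⟨Δ', h1, (Quotient.sound h2).symm⟩

end BraidedPictureProduct

open BraidedPictureProduct

namespace UniversalPictureProduct

variable {A : Type v}

/-- If g and h agree at the variable, then gh⁻¹ fixes it, so its reduced diagram is trivial. -/
theorem eq_of_eval_var {g h : UniversalPictureProduct A}
    (e : eval (thompsonAlgebra A) g [var] = eval (thompsonAlgebra A) h [var]) : g = h := by
  rw [← mul_inv_eq_one]
  obtain ⟨Δ, hΔ, hg⟩ := exists_isReduced_mk (g * h⁻¹)
  rw [← hg]
  refine mk_eq_of_iso (hΔ.iso_trivial ?_)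
  have hL : ([var] : List (NormalTerm A)).length = [()].length := rfl
  rw [← eval_mk, hg, eval_mul _ _ hL, e, ← eval_mul _ _ hL, mul_inv_cancel, eval_one hL]

theorem diagramLength_le_cost (Δ : BraidedDiagram thompsonPresentation (FreeGroup A) [()] [()]) :
    diagramLength (mk Δ) ≤ cost Δ := by
  obtain ⟨Δ', h1, h2, h3⟩ := exists_isReduced_cost_le Δ
  exact le_trans (Nat.sInf_le ⟨Δ', h1, (Quotient.sound h2).symm, rfl⟩) h3

/-- The infimum defining the length is attained, since every element has a reduced representative;
uniqueness of that representative is not needed. -/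
theorem exists_cost_eq (g : UniversalPictureProduct A) :
    ∃ Δ : BraidedDiagram thompsonPresentation (FreeGroup A) [()] [()], mk Δ = g ∧
      cost Δ = diagramLength g := by
  obtain ⟨Δ₀, h₀, h₀'⟩ := exists_isReduced_mk g
  obtain ⟨Δ, -, h2, h3⟩ := Nat.sInf_mem (s := {n | ∃ Δ : BraidedDiagram thompsonPresentation
    (FreeGroup A) [()] [()], Δ.IsReduced ∧ mk Δ = g ∧ cost Δ = n}) ⟨_, Δ₀, h₀, h₀', rfl⟩
  exact ⟨Δ, h2, h3⟩

theorem diagramLength_one : diagramLength (1 : UniversalPictureProduct A) = 0 := by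
  refine Nat.le_zero.1 ((diagramLength_le_cost (BraidedDiagram.trivial [()])).trans_eq ?_)
  have := Fintype.ofFinite (Ends [()]
    (BraidedDiagram.trivial [()] : BraidedDiagram thompsonPresentation (FreeGroup A) _ _).bot)
  rw [cost_eq, Finset.sum_eq_zero fun p _ => wordLength_one]
  exact Nat.card_of_isEmpty (α := Empty)

end UniversalPictureProduct

/-! ### The embedding and its length estimates -/

namespace BraidedDiagramGroup

variable {S : Type u} {P : SemigroupPresentation S} {w : List S}

theorem exists_card_eq (g : BraidedDiagramGroup P w) :
    ∃ Δ : BraidedDiagram P PUnit.{1} w w, Δ.IsReduced ∧ mk Δ = g ∧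
      Nat.card Δ.T = diagramLength g := by
  obtain ⟨Δ₀, h₀, h₀'⟩ := exists_isReduced_mk g
  exact Nat.sInf_mem (s := {n | ∃ Δ : BraidedDiagram P PUnit.{1} w w,
    Δ.IsReduced ∧ mk Δ = g ∧ Nat.card Δ.T = n}) ⟨_, Δ₀, h₀, h₀', rfl⟩

/-- If the letters of `w` are pairwise distinct then only the trivial element has length `0`. -/
theorem eq_one_of_diagramLength_eq_zero (hw : w.Nodup) {g : BraidedDiagramGroup P w}
    (hg : diagramLength g = 0) : g = 1 := by
  obtain ⟨Δ, -, rfl, h⟩ := exists_card_eq g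
  rw [hg, Nat.card_eq_zero, or_iff_left (not_infinite_iff_finite.2 Δ.finite)] at h
  refine mk_eq_of_iso ⟨Equiv.equivEmpty Δ.T, fun t => h.elim t, fun t => h.elim t, ?_⟩
  rintro (i | q)
  · refine ⟨?_, rfl⟩
    have hl := Δ.letter_wire (Sum.inl i)
    rcases hj : Δ.wire (Sum.inl i) with j | q
    · rw [hj] at hl
      have hl : w[j.1] = w[i.1] := hl
      -- Wires preserve letters, and each letter occurs only once in w.
      exact congrArg Sum.inl (Fin.ext ((hw.getElem_inj_iff).1 hl)).symm
    · exact h.elim q.node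
  · exact h.elim q.node

variable {A : Type v}

/-- `h` acts on one term as `g` acts on the list of terms obtained by splitting it. -/
def Encodes (ι : P.rels → A) (g : BraidedDiagramGroup P w) (h : UniversalPictureProduct A) :
    Prop :=
  ∀ L : List (NormalTerm A), L.length = 1 → eval (thompsonAlgebra A) h L =
    mergeHead^[w.length - 1] (eval (presentationAlgebra ι) g (splitHead^[w.length - 1] L))

theorem length_iterate_splitHead_sub (hw : w ≠ []) {L : List (NormalTerm A)} (hL : L.length = 1) :
    (splitHead^[w.length - 1] L).length = w.length := by
  have h := List.length_pos_iff.2 hw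
  rw [length_iterate_splitHead (List.length_pos_iff.1 (by omega)), hL]
  omega

/-- A comb of |w| − 1 splittings is placed above the redrawn diagram and its mirror image below;
together they account for the term 2|w|. -/
theorem exists_encodes (ι : P.rels → A) (hw : w ≠ []) (Δ : BraidedDiagram P PUnit.{1} w w) {B : ℕ}
    (hB : ∀ t, (Δ.top t).length + (Δ.bot t).length ≤ B) :
    ∃ D : BraidedDiagram thompsonPresentation (FreeGroup A) [()] [()],
      Encodes ι (mk Δ) (mk D) ∧ cost D ≤ 2 * w.length + B * Nat.card Δ.T := by
  have h0 := List.length_pos_iff.2 hw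
  have c1 := realizes_iterate_split (A := A) (w.length - 1) 0
  have c2 := realizes_iterate_merge (A := A) (w.length - 1) 0
  rw [show 0 + 1 + (w.length - 1) = w.length by omega] at c1 c2
  obtain ⟨D, h1, h2⟩ := (c1.comp (exists_realizes ι Δ hB)).comp c2
  exact ⟨D, h2, by omega⟩

/-- Even when the relations are infinite in number, a single diagram uses finitely many of them, so
Φ exists without any finiteness assumption on `P`. -/
theorem exists_bound_of_diagram (Δ : BraidedDiagram P PUnit.{1} w w) :
    ∃ B, ∀ t, (Δ.top t).length + (Δ.bot t).length ≤ B :=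
  exists_bound fun t => (Δ.top t).length + (Δ.bot t).length

variable {ι : P.rels → A} {g g' : BraidedDiagramGroup P w} {h h' : UniversalPictureProduct A}

/-- Faithfulness at the variable; this is what makes Φ independent of the diagrams chosen. -/
theorem Encodes.unique (H : Encodes ι g h) (H' : Encodes ι g h') : h = h' :=
  UniversalPictureProduct.eq_of_eval_var (by rw [H _ rfl, H' _ rfl])

/-- In the composite, the merge after g and the splitting before g' cancel. -/
theorem Encodes.mul (hw : w ≠ []) (H : Encodes ι g h) (H' : Encodes ι g' h') :
    Encodes ι (g * g') (h * h') := by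
  intro L hL
  have h0 := List.length_pos_iff.2 hw
  have h1 := length_iterate_splitHead_sub hw hL
  have h2 := length_eval (𝔄 := presentationAlgebra ι) g h1
  rw [eval_mul _ _ hL, H L hL, H' _ (by rw [length_iterate_mergeHead (by omega), h2]; omega),
    iterate_splitHead_mergeHead (by omega), eval_mul _ _ h1]

theorem Encodes.labSubs (H : Encodes ι g h) :
    labSubs (eval (presentationAlgebra ι) g (splitVar A w)) =
      labSubs (eval (thompsonAlgebra A) h [var]) := by
  rw [H _ rfl, labSubs_iterate_mergeHead]
  rfl

/-- The merged output is the variable; splitting it again shows that g fixes the generic input, and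
a reduced diagram doing so is trivial. -/
theorem Encodes.eq_one (hι : Function.Injective ι) (hw : w ≠ []) (H : Encodes ι g 1) : g = 1 := by
  have h0 := List.length_pos_iff.2 hw
  obtain ⟨Δ, hΔ, rfl⟩ := exists_isReduced_mk g
  refine mk_eq_of_iso (hΔ.iso_trivial_of_sem hι hw ?_)
  have h1 := H [var] rfl
  have hL : ([var] : List (NormalTerm A)).length = [()].length := rfl
  rw [eval_one hL] at h1
  have h2 := length_eval (𝔄 := presentationAlgebra ι) (mk Δ) (length_splitVar (A := A) hw)
  have h3 := iterate_splitHead_mergeHead (L := eval (presentationAlgebra ι) (mk Δ) (splitVar A w))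
    (k := w.length - 1) (by omega)
  rw [← eval_mk, ← h3]
  exact congrArg _ h1.symm

/-- Each transistor of a reduced diagram for g leaves its own subterm in the output. The merging in
`Encodes` preserves these subterms, and a diagram for h cannot create more of them than its cost. -/
theorem Encodes.diagramLength_le (hι : Function.Injective ι) (hw : w ≠ []) (H : Encodes ι g h) :
    diagramLength g ≤ UniversalPictureProduct.diagramLength h := by
  obtain ⟨D, rfl, hD⟩ := UniversalPictureProduct.exists_cost_eq h
  obtain ⟨Δ, hΔ, rfl, hc⟩ := exists_card_eq g
  rw [← hc, ← hD]
  obtain ⟨m, hm, hm'⟩ := hΔ.exists_labSubs hι hw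
  refine card_le_cost_of_labSubs (L := [var]) rfl ?_ m hm fun t => ?_
  · exact labSubs_splitVar (w := [()])
  · rw [← eval_mk, ← H.labSubs]
    exact hm' t

/-- By uniqueness, h is represented by the redrawing of a shortest diagram for g. -/
theorem Encodes.le_diagramLength (hw : w ≠ []) (H : Encodes ι g h) {B : ℕ}
    (hB : ∀ r ∈ P.rels, r.1.length + r.2.length ≤ B) :
    UniversalPictureProduct.diagramLength h ≤ 2 * w.length + B * diagramLength g := by
  obtain ⟨Δ, -, rfl, hc⟩ := exists_card_eq g
  obtain ⟨D, hD, hD'⟩ := exists_encodes ι hw Δ (B := B) (fun t => by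
    rcases Δ.rel t with h | h
    · exact hB _ h
    · rw [Nat.add_comm]
      exact hB _ h)
  rw [H.unique hD, ← hc]
  exact (UniversalPictureProduct.diagramLength_le_cost D).trans hD'

/-- The embedding of the braided diagram group. -/
theorem exists_hom (ι : P.rels → A) (hw : w ≠ []) :
    ∃ Φ : BraidedDiagramGroup P w →* UniversalPictureProduct A, ∀ g, Encodes ι g (Φ g) := by
  have h : ∀ g : BraidedDiagramGroup P w, ∃ h : UniversalPictureProduct A, Encodes ι g h := by
    rintro ⟨Δ⟩
    obtain ⟨B, hB⟩ := exists_bound_of_diagram Δ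
    obtain ⟨D, hD, -⟩ := exists_encodes ι hw Δ hB
    exact ⟨mk D, hD⟩
  choose Φ hΦ using h
  exact ⟨MonoidHom.mk' Φ fun g g' => (hΦ _).unique ((hΦ g).mul hw (hΦ g')), hΦ⟩

end BraidedDiagramGroup

/-! ### The main theorem -/

theorem mainTheorem10 {S : Type u} (P : SemigroupPresentation S) (w : List S) (hw : w ≠ [])
    (A : Type v)
    (hA : Cardinal.lift.{v} (Cardinal.mk P.rels) ≤ Cardinal.lift.{u} (Cardinal.mk A)) :
    ∃ Φ : BraidedDiagramGroup P w →* UniversalPictureProduct A,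
      Function.Injective Φ ∧
      (P.rels.Finite → ∃ C : ℕ,
        (∀ g : BraidedDiagramGroup P w,
          BraidedDiagramGroup.diagramLength g ≤
            C * UniversalPictureProduct.diagramLength (Φ g)) ∧
        (∀ g : BraidedDiagramGroup P w,
          UniversalPictureProduct.diagramLength (Φ g) ≤
            C * max 1 (BraidedDiagramGroup.diagramLength g)) ∧
        (w.Nodup → ∀ g : BraidedDiagramGroup P w,
          UniversalPictureProduct.diagramLength (Φ g) ≤
            C * BraidedDiagramGroup.diagramLength g)) := by
  -- The cardinality assumption serves only to give each relation its own generator.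
  obtain ⟨⟨ι, hι⟩⟩ := Cardinal.lift_mk_le'.1 hA
  obtain ⟨Φ, hΦ⟩ := BraidedDiagramGroup.exists_hom ι hw
  refine ⟨Φ, (injective_iff_map_eq_one Φ).2 fun g hg => ?_, fun hfin => ?_⟩
  · have := hΦ g
    rw [hg] at this
    exact this.eq_one hι hw
  · obtain ⟨B, hB⟩ := (hfin.image fun r => r.1.length + r.2.length).bddAbove
    have hB : ∀ r ∈ P.rels, r.1.length + r.2.length ≤ B := fun r hr => hB ⟨r, hr, rfl⟩
    -- For m ≥ 1 the additive term 2|w| is absorbed into a multiple of m. This is used with m =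
    -- max(1, |g|), and with m = |g| when |g| > 0. The summand 1 in the constant keeps it positive,
    -- as the lower inequality requires.
    have upper : ∀ (g : BraidedDiagramGroup P w) (m : ℕ), 1 ≤ m →
        BraidedDiagramGroup.diagramLength g ≤ m →
        UniversalPictureProduct.diagramLength (Φ g) ≤ (2 * w.length + B + 1) * m := by
      intro g m h1 h2
      refine ((hΦ g).le_diagramLength hw hB).trans ?_
      have h3 := Nat.mul_le_mul_left B h2
      have h4 := Nat.mul_le_mul_left (2 * w.length) h1
      rw [Nat.add_mul, Nat.add_mul]
      omega
    refine ⟨2 * w.length + B + 1, fun g => ?_, fun g => upper g _ (le_max_left _ _)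
      (le_max_right _ _), fun hn g => ?_⟩
    · exact ((hΦ g).diagramLength_le hι hw).trans (Nat.le_mul_of_pos_left _ (Nat.succ_pos _))
    · rcases Nat.eq_zero_or_pos (BraidedDiagramGroup.diagramLength g) with h | h
      · rw [BraidedDiagramGroup.eq_one_of_diagramLength_eq_zero hn h, map_one,
          UniversalPictureProduct.diagramLength_one]
        exact Nat.zero_le _
      · exact upper g _ h le_rfl
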